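/- Setting. Fix a differentiable function $\Phi:\mathbb R\to\mathbb R$ such that $\Phi$ and $\Phi'$ are Lipschitz continuous and bounded. Write $\|\Phi\|_\infty,\|\Phi'\|_\infty$ for the sup norms and $\mathrm{Lip}\,\Phi,\mathrm{Lip}\,\Phi'$ for the least Lipschitz constants. For $n_0,n_1\ge 1$, parameters $\theta=(\theta^{(0)},\theta^{(1)})\in\mathbb R^{n_0\times n_1}\times\mathbb R^{n_1}$ and an input $x\in\mathbb R^{n_0}$ let $$f(x;\theta)=\frac1{\sqrt{n_1}}\sum_{j=1}^{n_1}\Phi\Big(\frac1{\sqrt{n_0}}\sum_{i=1}^{n_0}x_i\theta^{(0)}_{ij}\Big)\theta^{(1)}_j .$$ Let $\mathcal X=(x_1,\dots,x_n)\in\mathbb R^{n_0\times n}$ ($n\ge1$) be training inputs, with Frobenius norm $\|\mathcal X\|$, and $y\in\mathbb R^n$ labels. Let the entries of $\theta_0$ be i.i.d. standard Gaussian. Let $(\theta_t)_{t\ge0}$ be the gradient flow $\partial_t\theta_t=-\nabla_\theta\,\tfrac12\sum_{i=1}^n(f(x_i;\theta)-y_i)^2\big|_{\theta=\theta_t}$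 started at $\theta_0$; let $f^{\rm lin}(x;\theta)=f(x;\theta_0)+\nabla_\theta f(x;\theta_0)\cdot(\theta-\theta_0)$, and let $(\bar\theta_t)_{t\ge0}$ be the linearized flow $\partial_t\bar\theta_t=-\sum_{i=1}^n\big(f^{\rm lin}(x_i;\bar\theta_t)-y_i\big)\nabla_\theta f(x_i;\theta_0)$, $\bar\theta_0=\theta_0$. Put $\tilde{\mathcal K}(x,x')=\frac1{n_0}x^\top x'$ and $$k_\infty(x,x')=\mathbb E[\Phi(u)\Phi(v)]+\tilde{\mathcal K}(x,x')\,\mathbb E[\Phi'(u)\Phi'(v)],\qquad (u,v)\sim\mathcal N\left(0,\begin{pmatrix}\tilde{\mathcal K}(x,x)&\tilde{\mathcal K}(x,x')\\ \tilde{\mathcal K}(x',x)&\tilde{\mathcal K}(x',x')\end{pmatrix}\right),$$ and let $\lambda_{\min}^\infty$ be the smallest eigenvalue of the matrix $k_\infty(\mathcal X,\mathcal X)=(k_\infty(x_i,x_j))_{i,j\le n}$. For real-valued random variables $U,V$, $\mathcal W_2(U,V)$ denotes the $2$-Wasserstein distance of their laws. Statement. For every $n\ge1$, every real $r\ge5$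 and every $B$ there are constants $a_1,a_2>0$, depending only on $\Phi,n,r,B$ (in particular not on $n_0$, $n_1$ or $t$), such that the following holds for all $n_0,n_1\ge1$, all $\mathcal X\in\mathbb R^{n_0\times n}$, $y\in\mathbb R^n$ and every test point $x\in\mathbb R^{n_0}$ with $\|\mathcal X\|,\|y\|,\|x\|\le B$. If $k_\infty(\mathcal X,\mathcal X)$ is positive definite and $$\frac{4\|\mathcal X\|(\sqrt5\|\Phi\|_\infty+\|y\|)}{\sqrt{n_1n_0}}\left(\|\Phi'\|_\infty+\mathrm{Lip}\,\Phi+\frac{\|\mathcal X\|\,\mathrm{Lip}\,\Phi'\sqrt{r\log n_1}}{\sqrt{n_0}}\right)<\lambda_{\min}^\infty,$$ then for all $t\ge0$ $$\mathcal W_2^2\big(f(x;\theta_t),f^{\rm lin}(x;\bar\theta_t)\big)\le r\left(\frac{a_1\log n_1}{(\lambda_{\min}^\infty)^3n_1n_0}+\frac{a_2\,n_0}{(\lambda_{\min}^\infty)^r\,n_1^{r/4}}(1+t^8)\right).$$ -/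

import Mathlib

open MeasureTheory ProbabilityTheory Matrix
open scoped ENNReal NNReal Gradient

noncomputable section

/-- The parameter space `ℝ^N`, `N = n₀ n₁ + n₁`, with its Euclidean structure: the coordinate
`Sum.inl (i, j)` is the inner weight `θ⁽⁰⁾ᵢⱼ`, the coordinate `Sum.inr j` is the outer weight
`θ⁽¹⁾ⱼ`. -/
abbrev Params (n₀ n₁ : ℕ) : Type := EuclideanSpace ℝ ((Fin n₀ × Fin n₁) ⊕ Fin n₁)

/-- Law of the parameters at initialization: all coordinates i.i.d. standard Gaussian. -/
def initLaw (n₀ n₁ : ℕ) : Measure (Params n₀ n₁) :=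
  (Measure.pi fun _ : (Fin n₀ × Fin n₁) ⊕ Fin n₁ => gaussianReal 0 1).map (WithLp.toLp 2)

/-- Preactivation `h_j(x; θ) = n₀^{-1/2} ∑ᵢ xᵢ θ⁽⁰⁾ᵢⱼ` of the `j`-th hidden neuron. -/
def preact {n₀ n₁ : ℕ} (x : EuclideanSpace ℝ (Fin n₀)) (θ : Params n₀ n₁) (j : Fin n₁) : ℝ :=
  1 / √(n₀ : ℝ) * ∑ i, x i * θ (Sum.inl (i, j))

/-- The shallow network `f(x; θ) = n₁^{-1/2} Φ(n₀^{-1/2} x θ⁽⁰⁾) θ⁽¹⁾`. -/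
def network (Φ : ℝ → ℝ) {n₀ n₁ : ℕ} (x : EuclideanSpace ℝ (Fin n₀)) (θ : Params n₀ n₁) : ℝ :=
  1 / √(n₁ : ℝ) * ∑ j, Φ (preact x θ j) * θ (Sum.inr j)

/-- Empirical risk `½ ‖f(𝒳; θ) - y‖²` of the mean squared error loss. -/
def empRisk (Φ : ℝ → ℝ) {n n₀ n₁ : ℕ} (X : Fin n → EuclideanSpace ℝ (Fin n₀))
    (y : EuclideanSpace ℝ (Fin n)) (θ : Params n₀ n₁) : ℝ :=
  1 / 2 * ∑ i, (network Φ (X i) θ - y i) ^ 2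

/-- The linearization at `θ₀`: `f^lin(x; θ) = f(x; θ₀) + ∇_θ f(x; θ₀) (θ - θ₀)`. -/
def linNetwork (Φ : ℝ → ℝ) {n₀ n₁ : ℕ} (x : EuclideanSpace ℝ (Fin n₀))
    (θ₀ θ : Params n₀ n₁) : ℝ :=
  network Φ x θ₀ + inner ℝ (∇ (network Φ x) θ₀) (θ - θ₀)

/-- `θ` is the gradient flow of the empirical risk on `[0, ∞)` started at `θ₀`. -/
def IsGradientFlow (Φ : ℝ → ℝ) {n n₀ n₁ : ℕ} (X : Fin n → EuclideanSpace ℝ (Fin n₀))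
    (y : EuclideanSpace ℝ (Fin n)) (θ₀ : Params n₀ n₁) (θ : ℝ → Params n₀ n₁) : Prop :=
  θ 0 = θ₀ ∧ ∀ t : ℝ, 0 ≤ t →
    HasDerivWithinAt θ (-∇ (empRisk Φ X y) (θ t)) (Set.Ici 0) t

/-- `θ` is the linearized gradient flow `∂ₜ θ = -∇_θ f(𝒳; θ₀) (f^lin(𝒳; θ) - y)` on `[0, ∞)`
started at `θ₀`. -/
def IsLinGradientFlow (Φ : ℝ → ℝ) {n n₀ n₁ : ℕ} (X : Fin n → EuclideanSpace ℝ (Fin n₀))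
    (y : EuclideanSpace ℝ (Fin n)) (θ₀ : Params n₀ n₁) (θ : ℝ → Params n₀ n₁) : Prop :=
  θ 0 = θ₀ ∧ ∀ t : ℝ, 0 ≤ t →
    HasDerivWithinAt θ
      (-∑ i, (linNetwork Φ (X i) θ₀ (θ t) - y i) • ∇ (network Φ (X i)) θ₀) (Set.Ici 0) t

/-- The kernel `𝒦̃(x, x') = n₀⁻¹ xᵀ x'`. -/
def inputKernel {n₀ : ℕ} (x x' : EuclideanSpace ℝ (Fin n₀)) : ℝ :=
  1 / (n₀ : ℝ) * inner ℝ x x'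

/-- The `2 × 2` covariance matrix `𝒯(x, x')`. -/
def inputCov {n₀ : ℕ} (x x' : EuclideanSpace ℝ (Fin n₀)) : Matrix (Fin 2) (Fin 2) ℝ :=
  !![inputKernel x x, inputKernel x x'; inputKernel x' x, inputKernel x' x']

/-- `E_{(u,v) ∼ 𝒩(0, 𝒯(x, x'))} [ψ(u) ψ(v)]`. -/
def gaussPair (ψ : ℝ → ℝ) {n₀ : ℕ} (x x' : EuclideanSpace ℝ (Fin n₀)) : ℝ :=
  ∫ w, ψ (w 0) * ψ (w 1) ∂(multivariateGaussian 0 (inputCov x x'))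

/-- The limiting neural tangent kernel `k_∞(x, x')`. -/
def ntkLimit (Φ : ℝ → ℝ) {n₀ : ℕ} (x x' : EuclideanSpace ℝ (Fin n₀)) : ℝ :=
  gaussPair Φ x x' + inputKernel x x' * gaussPair (deriv Φ) x x'

/-- The matrix `k_∞ = k_∞(𝒳, 𝒳)` on the training inputs. -/
def ntkLimitMatrix (Φ : ℝ → ℝ) {n n₀ : ℕ} (X : Fin n → EuclideanSpace ℝ (Fin n₀)) :
    Matrix (Fin n) (Fin n) ℝ :=
  Matrix.of fun i j => ntkLimit Φ (X i) (X j)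

/-- Smallest (real) eigenvalue of a square matrix; used for symmetric matrices of size `≥ 1`. -/
def minEigenvalue {n : ℕ} (A : Matrix (Fin n) (Fin n) ℝ) : ℝ :=
  sInf {μ : ℝ | Module.End.HasEigenvalue (Matrix.toLin' A) μ}

/-- Frobenius norm `‖𝒳‖` of the matrix of training inputs. -/
def inputNorm {n n₀ : ℕ} (X : Fin n → EuclideanSpace ℝ (Fin n₀)) : ℝ :=
  √(∑ i, ‖X i‖ ^ 2)

/-- Sup norm of a (bounded) function on `ℝ`. -/
def supNorm (g : ℝ → ℝ) : ℝ := ⨆ z, |g z|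

/-- Least Lipschitz constant of a (Lipschitz) function on `ℝ`. -/
def lipConst (g : ℝ → ℝ) : ℝ := sInf {K : ℝ | 0 ≤ K ∧ ∀ a b, |g a - g b| ≤ K * |a - b|}

/-- `Φ` is differentiable, and `Φ` and `Φ'` are Lipschitz continuous and bounded. -/
structure RegularActivation (Φ : ℝ → ℝ) : Prop where
  differentiable : Differentiable ℝ Φ
  lipschitz : ∃ K : ℝ≥0, LipschitzWith K Φ
  lipschitz_deriv : ∃ K : ℝ≥0, LipschitzWith K (deriv Φ)
  bounded : ∃ M : ℝ, ∀ z, |Φ z| ≤ M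
  bounded_deriv : ∃ M : ℝ, ∀ z, |deriv Φ z| ≤ M

/-- The overparametrization inequality with parameter `r`. -/
def Overparam (Φ : ℝ → ℝ) {n n₀ : ℕ} (n₁ : ℕ) (X : Fin n → EuclideanSpace ℝ (Fin n₀))
    (y : EuclideanSpace ℝ (Fin n)) (r : ℝ) : Prop :=
  4 * inputNorm X * (√5 * supNorm Φ + ‖y‖) / √((n₁ : ℝ) * (n₀ : ℝ)) *
      (supNorm (deriv Φ) + lipConst Φ +
        inputNorm X * lipConst (deriv Φ) * √(r * Real.log n₁) / √(n₀ : ℝ))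
    < minEigenvalue (ntkLimitMatrix Φ X)

/-- The `p`-Wasserstein distance `inf_γ (E_γ[d(x, y)^p])^{1/p}` over all couplings `γ` of `μ` and
`ν`, with values in `[0, ∞]`. -/
def wasserstein {M : Type*} [PseudoEMetricSpace M] [MeasurableSpace M] (p : ℝ)
    (μ ν : Measure M) : ℝ≥0∞ :=
  ⨅ γ ∈ {γ : Measure (M × M) | γ.map Prod.fst = μ ∧ γ.map Prod.snd = ν},
    (∫⁻ z, edist z.1 z.2 ^ p ∂γ) ^ (1 / p)

end

/-! ### Least-squares gradient flows in an inner product space -/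

section Flows

open Set

variable {E : Type*} [NormedAddCommGroup E] [InnerProductSpace ℝ E]

/-! Both flows start at the same random `θ₀`, so the pair of outputs at time `t` is a coupling, and
the squared distance is at most the expectation of a pathwise bound on the squared difference of the
outputs. Write `λ` for the smallest eigenvalue of the limit kernel matrix. The overparametrization
inequality supplies `λ > 0`; the smallness that makes training lazy is a random condition, `lazySize
< λ √n₁`, and the pathwise bound distinguishes whether it holds.

If it holds, the empirical kernel at `θ₀` is at least `λ / 2 = σ²`, and the gradients are Lipschitz
around `θ₀` with constant `κ` of order `(n₁ n₀)^(-1/2)`, up to the largest outer weight, with `4 κ R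
≤ σ²` where `R` bounds the initial residual. A bootstrap (`IsLSFlow.lazy`) keeps the flow within `2
R / σ` of `θ₀` and makes the residual decay exponentially. The difference of the two flows then
solves a perturbed linear least-squares flow, and `norm_le_of_perturbed_contraction` bounds it by a
multiple of `κ R² / σ³` uniformly in time. Squaring gives the factor `1 / (λ³ n₁ n₀)`.

If it fails, energy dissipation alone bounds both displacements linearly in `t`
(`norm_sub_le_of_energy`). The resulting crude bound is multiplied by `(lazySize / (λ √n₁))^r ≥ 1`,
a Markov inequality applied before integrating, which produces the negative powers of `λ` and `n₁`.

It remains to bound moments at initialization. The network output and the rescaled kernel deviation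
are normalized sums of independent centred variables, one per neuron, so all their moments are
bounded uniformly in the widths (`exists_integral_sum_pow_le`). The largest outer weight has fourth
moment of order `(log n₁)²`, the source of the logarithm; its higher moments are bounded by a
multiple of `n₁`, which is absorbed by replacing `n₁^(-r/2)` with `n₁^(-r/4)`. -/

theorem norm_sub_le_of_energy_decay {z Z : ℝ → E} {q : ℝ → ℝ} {R m τ : ℝ} (hR : 0 < R) (hm : 0 < m)
    (hzc : ContinuousOn z (Icc 0 τ)) (hqc : ContinuousOn q (Icc 0 τ))
    (hz : ∀ s ∈ Ico 0 τ, HasDerivWithinAt z (-Z s) (Ici s) s)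
    (hq : ∀ s ∈ Ico 0 τ, HasDerivWithinAt q (-2 * ‖Z s‖ ^ 2) (Ici s) s)
    (hq0 : q 0 ≤ R ^ 2) (hqpos : ∀ s, 0 ≤ q s)
    (hlow : ∀ s ∈ Ico 0 τ, m ^ 2 * q s ≤ ‖Z s‖ ^ 2) :
    ∀ s ∈ Icc 0 τ, ‖z s - z 0‖ < R / m ∧ q s ≤ R ^ 2 * Real.exp (-(m ^ 2 * s)) := by
  have hexp (s : ℝ) :
      HasDerivAt (fun s => Real.exp (m ^ 2 * s)) (Real.exp (m ^ 2 * s) * m ^ 2) s := by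
    simpa using ((hasDerivAt_id s).const_mul (m ^ 2)).exp
  have hexpn (s : ℝ) : HasDerivAt (fun s => Real.exp (-(m ^ 2 * s)))
      (Real.exp (-(m ^ 2 * s)) * (-m ^ 2)) s := by
    simpa using ((hasDerivAt_id s).const_mul (m ^ 2)).neg.exp
  have hw (s) (hs : s ∈ Ico 0 τ) : HasDerivWithinAt (fun s => Real.exp (m ^ 2 * s) * q s)
      (Real.exp (m ^ 2 * s) * m ^ 2 * q s + Real.exp (m ^ 2 * s) * (-2 * ‖Z s‖ ^ 2)) (Ici s) s :=
    (hexp s).hasDerivWithinAt.mul (hq s hs)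
  have hwc : ContinuousOn (fun s => Real.exp (m ^ 2 * s) * q s) (Icc 0 τ) := by fun_prop
  have hcancel (s : ℝ) : Real.exp (m ^ 2 * s) * Real.exp (-(m ^ 2 * s)) = 1 := by
    rw [← Real.exp_add]; simp
  -- The right side vanishes or is positive at `0`, and its derivative dominates `‖Z‖` by the
  -- inequality of arithmetic and geometric means between `exp(m² s) ‖Z‖² / (R m)` and `R m exp(-m²
  -- s)`. Half of the dissipation pays for the weight `exp(m² s)`. Working with `q` rather than its
  -- square root avoids dividing by zero when the residual vanishes.
  have key : ∀ s ∈ Icc 0 τ, ‖z s - z 0‖ ≤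
      1 / 2 * ((R ^ 2 - Real.exp (m ^ 2 * s) * q s) / (R * m)
        + R / m * (1 - Real.exp (-(m ^ 2 * s)))) := by
    refine image_norm_le_of_norm_deriv_right_le_deriv_boundary' (f' := fun s => -Z s)
      (B' := fun s => 1 / 2 * ((-(Real.exp (m ^ 2 * s) * m ^ 2 * q s
        + Real.exp (m ^ 2 * s) * (-2 * ‖Z s‖ ^ 2))) / (R * m)
        + R / m * (-(Real.exp (-(m ^ 2 * s)) * (-m ^ 2)))))
      (by fun_prop) (fun s hs => ?_) ?_ (by fun_prop) (fun s hs => ?_) (fun s hs => ?_)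
    · simpa using (hz s hs).sub_const (z 0)
    · simp only [sub_self, norm_zero, mul_zero, Real.exp_zero, one_mul, neg_zero, add_zero]
      have : 0 ≤ (R ^ 2 - q 0) / (R * m) := div_nonneg (by linarith) (by positivity)
      linarith
    · exact ((((hw s hs).const_sub (R ^ 2)).div_const _).add
        (((hexpn s).hasDerivWithinAt.const_sub 1).const_mul (R / m))).const_mul (1 / 2)
    · rw [norm_neg]
      set x := Real.exp (m ^ 2 * s)
      set y := Real.exp (-(m ^ 2 * s))
      have hxy : x * y = 1 := hcancel s
      have hxp : 0 < x := Real.exp_pos _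
      have hyp : 0 < y := Real.exp_pos _
      have h1 := hlow s hs
      have e1 : x * ‖Z s‖ ^ 2 / (R * m)
          ≤ (-(x * m ^ 2 * q s + x * (-2 * ‖Z s‖ ^ 2))) / (R * m) := by
        gcongr
        nlinarith [mul_le_mul_of_nonneg_left h1 hxp.le]
      have e2 : R / m * (-(y * (-m ^ 2))) = R * m * y := by field_simp
      have e3 : 2 * ‖Z s‖ ≤ x * ‖Z s‖ ^ 2 / (R * m) + R * m * y := by
        have hc : 0 < R * m := by positivity
        rw [div_add' _ _ _ hc.ne', le_div_iff₀ hc]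
        have h4 : x * (2 * ‖Z s‖ * (R * m)) ≤ x * (x * ‖Z s‖ ^ 2 + R * m * y * (R * m)) := by
          have : x * (x * ‖Z s‖ ^ 2 + R * m * y * (R * m)) - x * (2 * ‖Z s‖ * (R * m))
            = (x * ‖Z s‖ - R * m) ^ 2 := by linear_combination (R * m) ^ 2 * hxy
          nlinarith [sq_nonneg (x * ‖Z s‖ - R * m)]
        exact le_of_mul_le_mul_left h4 hxp
      rw [e2]; linarith
  have key2 : ∀ s ∈ Icc 0 τ, Real.exp (m ^ 2 * s) * q s ≤ R ^ 2 := by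
    refine image_le_of_deriv_right_le_deriv_boundary hwc hw (B := fun _ => R ^ 2)
      (B' := fun _ => 0) (by simpa using hq0) continuousOn_const
      (fun s _ => hasDerivWithinAt_const _ _ _) (fun s hs => ?_)
    have h1 := hlow s hs
    have : 0 < Real.exp (m ^ 2 * s) := Real.exp_pos _
    nlinarith [mul_le_mul_of_nonneg_left h1 this.le, mul_nonneg this.le (sq_nonneg ‖Z s‖)]
  intro s hs
  -- Strictness comes from `exp(-m² s) > 0` and is what closes the bootstrap in `IsLSFlow.lazy`.
  refine ⟨(key s hs).trans_lt ?_, ?_⟩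
  · have h1 : (R ^ 2 - Real.exp (m ^ 2 * s) * q s) / (R * m) ≤ R / m := by
      rw [div_le_div_iff₀ (by positivity) hm]
      have : 0 ≤ Real.exp (m ^ 2 * s) * q s := mul_nonneg (Real.exp_pos _).le (hqpos s)
      nlinarith [mul_nonneg this hm.le]
    have h2 : R / m * (1 - Real.exp (-(m ^ 2 * s))) < R / m := by
      have : 0 < R / m * Real.exp (-(m ^ 2 * s)) := mul_pos (by positivity) (Real.exp_pos _)
      linarith
    linarith
  · have h1 := key2 s hs
    have : q s = Real.exp (m ^ 2 * s) * q s * Real.exp (-(m ^ 2 * s)) := by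
      linear_combination (-q s) * hcancel s
    rw [this]
    gcongr

/-- The speed satisfies `‖Z‖ ≤ ‖Z‖² / 2 + 1 / 2`, and `‖Z‖² / 2` is the rate of loss of `q / 4`. No
lower bound on the kernel enters, so this serves when training is not lazy. -/
theorem norm_sub_le_of_energy {z Z : ℝ → E} {q : ℝ → ℝ} 
    (hz : ∀ s, 0 ≤ s → HasDerivWithinAt z (-Z s) (Ici 0) s)
    (hq : ∀ s, 0 ≤ s → HasDerivWithinAt q (-2 * ‖Z s‖ ^ 2) (Ici 0) s)
    (hqpos : ∀ s, 0 ≤ q s) {t : ℝ} (ht : 0 ≤ t) :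
    ‖z t - z 0‖ ≤ q 0 / 4 + t / 2 := by
  have hzc : ContinuousOn z (Icc 0 t) := fun s hs =>
    (hz s hs.1).continuousWithinAt.mono Icc_subset_Ici_self
  have hqc : ContinuousOn q (Icc 0 t) := fun s hs =>
    (hq s hs.1).continuousWithinAt.mono Icc_subset_Ici_self
  have key : ∀ s ∈ Icc 0 t, ‖z s - z 0‖ ≤ 1 / 4 * (q 0 - q s) + s / 2 := by
    refine image_norm_le_of_norm_deriv_right_le_deriv_boundary' (f' := fun s => -Z s)
      (B' := fun s => 1 / 4 * (-(-2 * ‖Z s‖ ^ 2)) + 1 / 2)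
      (by fun_prop) (fun s hs => ?_) (by simp) (by fun_prop) (fun s hs => ?_) (fun s hs => ?_)
    · simpa using ((hz s hs.1).mono (Ici_subset_Ici.2 hs.1)).sub_const (z 0)
    · exact ((((hq s hs.1).mono (Ici_subset_Ici.2 hs.1)).const_sub (q 0)).const_mul (1 / 4)).add
        ((hasDerivWithinAt_id s _).div_const 2)
    · rw [norm_neg]; nlinarith [sq_nonneg (‖Z s‖ - 1)]
  have := key t ⟨ht, le_rfl⟩
  linarith [hqpos t]

variable {ι : Type*}

/-- The vector `(⟨gᵢ, u⟩)ᵢ`. -/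
noncomputable def gradPair (g : ι → E) (u : E) : EuclideanSpace ℝ ι :=
  WithLp.toLp 2 fun i => inner ℝ (g i) u

variable [Fintype ι]

/-- The linear combination `∑ᵢ vᵢ gᵢ`. -/
def gradComb (g : ι → E) (v : EuclideanSpace ℝ ι) : E := ∑ i, v i • g i

/-- If the `g i` are the rows of a Jacobian `J`, then `gradPair` is `J` and `gradComb` is its
adjoint. -/
theorem inner_gradComb (g : ι → E) (v : EuclideanSpace ℝ ι) (u : E) :
    inner ℝ u (gradComb g v) = inner ℝ v (gradPair g u) := by
  simp [gradComb, gradPair, inner_sum, PiLp.inner_apply, inner_smul_right, real_inner_comm,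
    mul_comm]

theorem gradComb_add (g : ι → E) (v w : EuclideanSpace ℝ ι) :
    gradComb g (v + w) = gradComb g v + gradComb g w := by
  simp [gradComb, add_smul, Finset.sum_add_distrib]

/-- The residual vector of a family of functions with labels `y`. -/
def lsResidual (f : ι → E → ℝ) (y : EuclideanSpace ℝ ι) (θ : E) : EuclideanSpace ℝ ι :=
  WithLp.toLp 2 fun i => f i θ - y i

variable [CompleteSpace E]

/-- `γ` is the least-squares gradient flow of the functions `f i` with gradients `g i`. -/
def IsLSFlow (f : ι → E → ℝ) (g : ι → E → E) (y : EuclideanSpace ℝ ι) (γ : ℝ → E) : Prop :=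
  (∀ i θ, HasGradientAt (f i) (g i θ) θ) ∧ ∀ t, 0 ≤ t →
    HasDerivWithinAt γ (-gradComb (fun i => g i (γ t)) (lsResidual f y (γ t))) (Ici 0) t

variable {f : ι → E → ℝ} {g : ι → E → E} {y : EuclideanSpace ℝ ι} {γ : ℝ → E}

theorem IsLSFlow.hasDerivWithinAt_energy (h : IsLSFlow f g y γ) {t : ℝ} (ht : 0 ≤ t) :
    HasDerivWithinAt (fun t => ‖lsResidual f y (γ t)‖ ^ 2)
      (-2 * ‖gradComb (fun i => g i (γ t)) (lsResidual f y (γ t))‖ ^ 2) (Ici 0) t := by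
  set Z := gradComb (fun i => g i (γ t)) (lsResidual f y (γ t)) with hZ
  have h1 (i : ι) : HasDerivWithinAt (fun t => f i (γ t) - y i) (inner ℝ (g i (γ t)) (-Z))
      (Ici 0) t := by
    have := (h.1 i (γ t)).hasFDerivAt.comp_hasDerivWithinAt t (h.2 t ht)
    simpa using this.sub_const (y i)
  have h2 : HasDerivWithinAt (fun t => ∑ i, (f i (γ t) - y i) ^ 2)
      (∑ i, 2 * (f i (γ t) - y i) * inner ℝ (g i (γ t)) (-Z)) (Ici 0) t := by
    refine HasDerivWithinAt.fun_sum fun i _ => ?_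
    simpa using (h1 i).fun_pow 2
  have h3 : (fun t => ‖lsResidual f y (γ t)‖ ^ 2) = fun t => ∑ i, (f i (γ t) - y i) ^ 2 := by
    ext t; simp [EuclideanSpace.norm_sq_eq, lsResidual]
  rw [h3]
  convert h2 using 1
  have : ‖Z‖ ^ 2 = inner ℝ (lsResidual f y (γ t)) (gradPair (fun i => g i (γ t)) Z) := by
    rw [← inner_gradComb, ← hZ, real_inner_self_eq_norm_sq]
  rw [this]
  simp [PiLp.inner_apply, lsResidual, gradPair, Finset.mul_sum]
  refine Finset.sum_congr rfl fun i _ => ?_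
  ring

theorem IsLSFlow.norm_sub_le (h : IsLSFlow f g y γ) {t : ℝ} (ht : 0 ≤ t) :
    ‖γ t - γ 0‖ ≤ ‖lsResidual f y (γ 0)‖ ^ 2 / 4 + t / 2 :=
  norm_sub_le_of_energy (q := fun t => ‖lsResidual f y (γ t)‖ ^ 2) h.2
    (fun _ hs => h.hasDerivWithinAt_energy hs) (fun _ => sq_nonneg _) ht

theorem IsLSFlow.continuousOn (h : IsLSFlow f g y γ) : ContinuousOn γ (Ici 0) :=
  fun s hs => (h.2 s hs).continuousWithinAt

/-- Bootstrap: inside the ball of radius `2 R / σ` the Jacobian moves by at most `σ / 2`, so the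
lower bound `σ` degrades to no less than `σ / 2`. The energy estimate with `m = σ / 2` then gives a
displacement strictly below `R / m`, which is the radius itself, so the flow never reaches the
boundary. -/
theorem IsLSFlow.lazy (h : IsLSFlow f g y γ) {σ κ R : ℝ} (hσ : 0 < σ) (hR : 0 < R)
    (hr0 : ‖lsResidual f y (γ 0)‖ ≤ R) (hlow : ∀ v, σ * ‖v‖ ≤ ‖gradComb (fun i => g i (γ 0)) v‖)
    (hκ : ∀ θ v, ‖gradComb (fun i => g i θ) v - gradComb (fun i => g i (γ 0)) v‖
      ≤ κ * ‖θ - γ 0‖ * ‖v‖) (hsmall : 4 * κ * R ≤ σ ^ 2) (hκ0 : 0 ≤ κ) {t : ℝ} (ht : 0 ≤ t) :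
    ‖γ t - γ 0‖ ≤ 2 * R / σ ∧
      ‖lsResidual f y (γ t)‖ ≤ R * Real.exp (-(σ ^ 2 / 8 * t)) := by
  have hb : 2 * R / σ = R / (σ / 2) := by field_simp
  have hlow' (θ) (hθ : ‖θ - γ 0‖ ≤ 2 * R / σ) (v) :
      σ / 2 * ‖v‖ ≤ ‖gradComb (fun i => g i θ) v‖ := by
    have h1 := hκ θ v
    have h2 : κ * ‖θ - γ 0‖ ≤ σ / 2 := by
      calc κ * ‖θ - γ 0‖ ≤ κ * (2 * R / σ) := by gcongr
        _ ≤ σ / 2 := by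
          rw [mul_div_assoc', div_le_div_iff₀ hσ two_pos]; nlinarith
    have h3 : ‖gradComb (fun i => g i (γ 0)) v‖ ≤ ‖gradComb (fun i => g i θ) v‖
        + ‖gradComb (fun i => g i θ) v - gradComb (fun i => g i (γ 0)) v‖ := by
      have := norm_sub_norm_le (gradComb (fun i => g i (γ 0)) v) (gradComb (fun i => g i θ) v)
      rw [norm_sub_rev] at this
      linarith
    have := mul_le_mul_of_nonneg_right h2 (norm_nonneg v)
    linarith [hlow v]
  have main (τ : ℝ) (hτ : ∀ s ∈ Ico 0 τ, ‖γ s - γ 0‖ ≤ 2 * R / σ) : ∀ s ∈ Icc 0 τ,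
      ‖γ s - γ 0‖ < R / (σ / 2) ∧
        ‖lsResidual f y (γ s)‖ ^ 2 ≤ R ^ 2 * Real.exp (-((σ / 2) ^ 2 * s)) := by
    refine norm_sub_le_of_energy_decay hR (by positivity)
      (q := fun s => ‖lsResidual f y (γ s)‖ ^ 2)
      (h.continuousOn.mono Icc_subset_Ici_self) (fun s hs => ?_)
      (fun s hs => (h.2 s hs.1).mono (Ici_subset_Ici.2 hs.1))
      (fun s hs => (h.hasDerivWithinAt_energy hs.1).mono (Ici_subset_Ici.2 hs.1))
      (by gcongr) (fun _ => sq_nonneg _) (fun s hs => ?_)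
    · exact (h.hasDerivWithinAt_energy hs.1).continuousWithinAt.mono Icc_subset_Ici_self
    · rw [← mul_pow]
      have := hlow' _ (hτ s hs) (lsResidual f y (γ s))
      gcongr
  -- At the first time the distance is at least the radius, the strict bound from `main` is
  -- contradicted.
  have stay : ∀ s, 0 ≤ s → ‖γ s - γ 0‖ ≤ 2 * R / σ := by
    by_contra! hcon
    obtain ⟨t₁, ht₁, hbad⟩ := hcon
    let S : Set ℝ := Icc 0 t₁ ∩ (fun s => ‖γ s - γ 0‖) ⁻¹' Ici (2 * R / σ)
    have hSc : IsClosed S := by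
      refine ContinuousOn.preimage_isClosed_of_isClosed ?_ isClosed_Icc isClosed_Ici
      have : ContinuousOn γ (Icc 0 t₁) := h.continuousOn.mono Icc_subset_Ici_self
      fun_prop
    have hSn : S.Nonempty := ⟨t₁, ⟨ht₁, le_rfl⟩, hbad.le⟩
    have hSb : BddBelow S := ⟨0, fun s hs => hs.1.1⟩
    have hmem := hSc.csInf_mem hSn hSb
    have := (main (sInf S) (fun s hs => by
      by_contra! hgt
      exact absurd (csInf_le hSb ⟨⟨hs.1, hs.2.le.trans hmem.1.2⟩, hgt.le⟩) (not_le.2 hs.2))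
      (sInf S) ⟨hmem.1.1, le_rfl⟩).1
    have h2 : 2 * R / σ ≤ ‖γ (sInf S) - γ 0‖ := hmem.2
    linarith
  refine ⟨stay t ht, ?_⟩
  have := (main t (fun s hs => stay s hs.1) t ⟨ht, le_rfl⟩).2
  refine (sq_le_sq₀ (norm_nonneg _) (by positivity)).1 ?_
  have hexp : (2 : ℕ) * -(σ ^ 2 / 8 * t) = -((σ / 2) ^ 2 * t) := by push_cast; ring
  rwa [mul_pow, ← Real.exp_nat_mul, hexp]

end Flows

/-! ### Comparison of a flow with its linearization -/

section Comparison

open Set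

variable {E : Type*} [NormedAddCommGroup E] [InnerProductSpace ℝ E] {ι : Type*} [Fintype ι]

theorem gradComb_mem_span (g : ι → E) (v : EuclideanSpace ℝ ι) :
    gradComb g v ∈ Submodule.span ℝ (range g) :=
  Submodule.sum_mem _ fun i _ => Submodule.smul_mem _ _ (Submodule.subset_span ⟨i, rfl⟩)

/-- A lower bound for `J*` passes to `J` on the range of `J*`: for `u = J* v`, `‖u‖² = ⟨v, J u⟩ ≤
‖v‖ ‖J u‖` and `σ ‖v‖ ≤ ‖u‖`. -/
theorem mul_norm_le_norm_gradPair {g : ι → E} {σ : ℝ}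
    (hlow : ∀ v, σ * ‖v‖ ≤ ‖gradComb g v‖) {u : E} (hu : u ∈ Submodule.span ℝ (range g)) :
    σ * ‖u‖ ≤ ‖gradPair g u‖ := by
  obtain ⟨c, hc⟩ := (Submodule.mem_span_range_iff_exists_fun ℝ).1 hu
  set v : EuclideanSpace ℝ ι := WithLp.toLp 2 c
  have hv : gradComb g v = u := by simpa [gradComb, v] using hc
  rcases eq_or_ne u 0 with rfl | hu0
  · simp
  have h1 : ‖u‖ ^ 2 ≤ ‖v‖ * ‖gradPair g u‖ := by
    rw [← real_inner_self_eq_norm_sq]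
    nth_rw 2 [← hv]
    rw [inner_gradComb]
    exact real_inner_le_norm _ _
  have h2 := hlow v
  rw [hv] at h2
  have hpos : 0 < ‖u‖ := norm_pos_iff.2 hu0
  rcases le_or_gt σ 0 with hs | hs
  · exact (mul_nonpos_of_nonpos_of_nonneg hs hpos.le).trans (norm_nonneg _)
  · refine le_of_mul_le_mul_left ?_ hpos
    calc ‖u‖ * (σ * ‖u‖) = σ * ‖u‖ ^ 2 := by ring
      _ ≤ σ * (‖v‖ * ‖gradPair g u‖) := by gcongr
      _ = (σ * ‖v‖) * ‖gradPair g u‖ := by ring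
      _ ≤ ‖u‖ * ‖gradPair g u‖ := by gcongr

/-- Split `w` along the span of the `g i` and its orthogonal complement. On the complement only `p`
acts, and its integral is at most `c / μ`. On the span the drift `-J*(J w + ρ)` points inward once
`σ ‖w‖ ≥ ρ₀`, so the bounded perturbation `ρ` costs `ρ₀ / σ` regardless of time, and the integrable
`p` adds a multiple of `c / μ`. -/
theorem norm_le_of_perturbed_contraction {g : ι → E} {w p : ℝ → E} {ρ : ℝ → EuclideanSpace ℝ ι}
    {σ ρ₀ c μ : ℝ} (hσ : 0 < σ) (hρ₀ : 0 < ρ₀) (hc : 0 < c) (hμ : 0 < μ)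
    (hlow : ∀ v, σ * ‖v‖ ≤ ‖gradComb g v‖) (hw0 : w 0 = 0)
    (hw : ∀ t, 0 ≤ t → HasDerivWithinAt w (-gradComb g (gradPair g (w t) + ρ t) - p t) (Ici 0) t)
    (hρ : ∀ t, 0 ≤ t → ‖ρ t‖ ≤ ρ₀) (hp : ∀ t, 0 ≤ t → ‖p t‖ ≤ c * Real.exp (-(μ * t)))
    {t : ℝ} (ht : 0 ≤ t) : ‖w t‖ ≤ ρ₀ / σ + 3 * (c / μ) := by
  let K := Submodule.span ℝ (range g)
  have hfd : FiniteDimensional ℝ K := FiniteDimensional.span_of_finite ℝ (finite_range g)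
  let P : E →L[ℝ] E := K.starProjection
  let Q : E →L[ℝ] E := Kᗮ.starProjection
  have hgP (u : E) : gradPair g (P u) = gradPair g u := by
    ext i
    simp only [gradPair]
    rw [← K.inner_starProjection_left_eq_right]
    congr 1
    exact K.starProjection_eq_self_iff.2 (Submodule.subset_span ⟨i, rfl⟩)
  have hPc (v) : P (gradComb g v) = gradComb g v :=
    K.starProjection_eq_self_iff.2 (gradComb_mem_span g v)
  have hQc (v) : Q (gradComb g v) = 0 :=
    K.starProjection_orthogonal_apply_eq_zero (gradComb_mem_span g v)
  have hexp (s : ℝ) : HasDerivAt (fun s => c / μ * (1 - Real.exp (-(μ * s))))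
      (c * Real.exp (-(μ * s))) s := by
    have := (((((hasDerivAt_id s).const_mul μ).neg).exp).const_sub 1).const_mul (c / μ)
    refine this.congr_deriv ?_
    simp only [id_eq, mul_one, mul_neg, neg_neg, Pi.neg_apply]
    field_simp
  have hwc : ContinuousOn w (Icc 0 t) := fun s hs =>
    (hw s hs.1).continuousWithinAt.mono Icc_subset_Ici_self
  have hexp_le (s : ℝ) : c / μ * (1 - Real.exp (-(μ * s))) ≤ c / μ := by
    have : 0 < c / μ * Real.exp (-(μ * s)) := by positivity
    linarith
  have hQ : ‖Q (w t)‖ ≤ c / μ * (1 - Real.exp (-(μ * t))) := by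
    refine image_norm_le_of_norm_deriv_right_le_deriv_boundary' (f := fun s => Q (w s))
      (f' := fun s => -Q (p s)) (B' := fun s => c * Real.exp (-(μ * s)))
      (by fun_prop) (fun s hs => ?_) (by simp [hw0])
      (by fun_prop) (fun s _ => (hexp s).hasDerivWithinAt) (fun s hs => ?_) ⟨ht, le_rfl⟩
    · have := Q.hasFDerivAt.comp_hasDerivWithinAt s
        ((hw s hs.1).mono (Ici_subset_Ici.2 hs.1))
      rw [map_sub, map_neg, hQc, neg_zero, zero_sub] at this
      exact this
    · rw [norm_neg]
      exact (Kᗮ.norm_starProjection_apply_le _).trans (hp s hs.1)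
  have hP : ‖P (w t)‖ ≤ ρ₀ / σ + 2 * (c / μ * (1 - Real.exp (-(μ * t)))) := by
    have hNpos (s : ℝ) (hs : 0 ≤ s) :
        ρ₀ / σ ≤ ρ₀ / σ + 2 * (c / μ * (1 - Real.exp (-(μ * s)))) := by
      have : Real.exp (-(μ * s)) ≤ 1 := Real.exp_le_one_iff.2 (by nlinarith)
      have : 0 ≤ c / μ * (1 - Real.exp (-(μ * s))) :=
        mul_nonneg (by positivity) (by linarith)
      linarith
    have hρσ : 0 < ρ₀ / σ := by positivity
    refine (sq_le_sq₀ (norm_nonneg _) (hρσ.le.trans (hNpos t ht))).1 ?_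
    -- The derivatives need comparing only where the squared norm touches the barrier. The factor
    -- `2` before `c / μ` in the barrier makes that comparison strict.
    refine image_le_of_deriv_right_lt_deriv_boundary' (f := fun s => ‖P (w s)‖ ^ 2)
      (f' := fun s => 2 * inner ℝ (P (w s)) (-gradComb g (gradPair g (w s) + ρ s) - P (p s)))
      (B := fun s => (ρ₀ / σ + 2 * (c / μ * (1 - Real.exp (-(μ * s))))) ^ 2)
      (B' := fun s => 2 * (ρ₀ / σ + 2 * (c / μ * (1 - Real.exp (-(μ * s)))))
        * (2 * (c * Real.exp (-(μ * s)))))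
      (by fun_prop) (fun s hs => ?_) (by simp [hw0]; positivity)
      (by fun_prop) (fun s _ => ?_) (fun s hs heq => ?_) ⟨ht, le_rfl⟩
    · have := P.hasFDerivAt.comp_hasDerivWithinAt s
        ((hw s hs.1).mono (Ici_subset_Ici.2 hs.1))
      rw [map_sub, map_neg, hPc] at this
      exact this.norm_sq
    · simpa using (((hexp s).const_mul 2).const_add (ρ₀ / σ)).fun_pow 2 |>.hasDerivWithinAt
    · set N := ρ₀ / σ + 2 * (c / μ * (1 - Real.exp (-(μ * s))))
      have hN1 : ρ₀ / σ ≤ N := hNpos s hs.1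
      have hN0 : 0 < N := hρσ.trans_le hN1
      have hu : ‖P (w s)‖ = N := (sq_eq_sq₀ (norm_nonneg _) hN0.le).1 heq
      set a := gradPair g (w s)
      have ha1 : ρ₀ ≤ ‖a‖ := by
        have := mul_norm_le_norm_gradPair hlow (K.starProjection_apply_mem (w s))
        change σ * ‖P (w s)‖ ≤ ‖gradPair g (P (w s))‖ at this
        rw [hgP, hu] at this
        refine le_trans ?_ this
        rw [div_le_iff₀ hσ] at hN1
        linarith
      have h1 : inner ℝ (P (w s)) (gradComb g (a + ρ s)) = inner ℝ (a + ρ s) a := by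
        rw [inner_gradComb, hgP]
      have h2 : 0 ≤ inner ℝ (a + ρ s) a := by
        rw [inner_add_left, real_inner_self_eq_norm_sq]
        have h3 := (abs_le.1 (abs_real_inner_le_norm (ρ s) a)).1
        have h4 := hρ s hs.1
        nlinarith [mul_le_mul_of_nonneg_right (h4.trans ha1) (norm_nonneg a)]
      have h3 : -inner ℝ (P (w s)) (P (p s)) ≤ N * (c * Real.exp (-(μ * s))) := by
        have h4 := (abs_le.1 (abs_real_inner_le_norm (P (w s)) (P (p s)))).1
        have h5 : ‖P (p s)‖ ≤ c * Real.exp (-(μ * s)) :=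
          (K.norm_starProjection_apply_le _).trans (hp s hs.1)
        rw [hu] at h4
        nlinarith [mul_le_mul_of_nonneg_left h5 hN0.le]
      rw [inner_sub_right, inner_neg_right, h1]
      have h6 : 0 < N * (c * Real.exp (-(μ * s))) := by positivity
      nlinarith
  have hsum : w t = P (w t) + Q (w t) :=
    (K.starProjection_add_starProjection_orthogonal (w t)).symm
  calc ‖w t‖ ≤ ‖P (w t)‖ + ‖Q (w t)‖ := by
        conv_lhs => rw [hsum]
        exact norm_add_le _ _
    _ ≤ _ := by linarith [hexp_le t]

variable [CompleteSpace E]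

theorem abs_sub_linearization_le {h : E → ℝ} {k : E → E} {κ : ℝ} {θ₀ : E} (hκ0 : 0 ≤ κ)
    (hk : ∀ θ, HasGradientAt h (k θ) θ) (hκ : ∀ θ, ‖k θ - k θ₀‖ ≤ κ * ‖θ - θ₀‖) (θ : E) :
    |h θ - h θ₀ - inner ℝ (k θ₀) (θ - θ₀)| ≤ κ * ‖θ - θ₀‖ ^ 2 := by
  have := (convex_closedBall θ₀ ‖θ - θ₀‖).norm_image_sub_le_of_norm_hasFDerivWithin_le'
    (f := h) (f' := fun θ => InnerProductSpace.toDual ℝ E (k θ))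
    (φ := InnerProductSpace.toDual ℝ E (k θ₀)) (C := κ * ‖θ - θ₀‖) (x := θ₀) (y := θ)
    (fun x _ => (hk x).hasFDerivAt.hasFDerivWithinAt) (fun x hx => ?_)
    (Metric.mem_closedBall_self (norm_nonneg _)) (by simp [dist_eq_norm])
  · rw [Real.norm_eq_abs] at this
    simpa [sq, mul_assoc] using this
  · rw [← map_sub, LinearIsometryEquiv.norm_map]
    refine (hκ x).trans ?_
    rw [Metric.mem_closedBall, dist_eq_norm] at hx
    gcongr

/-- Duality: the scalar Taylor estimate is applied to `∑ ρᵢ fᵢ`, with `ρ` the remainder vector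
itself frozen at the given `θ`. This yields `‖ρ‖² ≤ κ ‖ρ‖ ‖θ - θ₀‖²` with no loss in the number of
functions. -/
theorem norm_residual_sub_linearization_le {f : ι → E → ℝ} {g : ι → E → E} {κ : ℝ} {θ₀ : E}
    (hκ0 : 0 ≤ κ) (hf : ∀ i θ, HasGradientAt (f i) (g i θ) θ)
    (hκ : ∀ θ v, ‖gradComb (fun i => g i θ) v - gradComb (fun i => g i θ₀) v‖
      ≤ κ * ‖θ - θ₀‖ * ‖v‖) (θ : E) :
    ‖(WithLp.toLp 2 fun i => f i θ - f i θ₀ - inner ℝ (g i θ₀) (θ - θ₀) : EuclideanSpace ℝ ι)‖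
      ≤ κ * ‖θ - θ₀‖ ^ 2 := by
  set ρ : EuclideanSpace ℝ ι := WithLp.toLp 2 fun i => f i θ - f i θ₀ - inner ℝ (g i θ₀) (θ - θ₀)
  rcases eq_or_ne ρ 0 with h0 | h0
  · rw [h0, norm_zero]; positivity
  have hpos := norm_pos_iff.2 h0
  have h1 := abs_sub_linearization_le (h := fun θ => ∑ i, ρ i * f i θ)
    (k := fun θ => gradComb (fun i => g i θ) ρ) (κ := κ * ‖ρ‖) (θ₀ := θ₀) (by positivity)
    (fun θ => ?_) (fun θ => by linarith [hκ θ ρ]) θ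
  · have h2 : ‖ρ‖ ^ 2 = ∑ i, ρ i * f i θ - ∑ i, ρ i * f i θ₀
        - inner ℝ (gradComb (fun i => g i θ₀) ρ) (θ - θ₀) := by
      rw [real_inner_comm, inner_gradComb, EuclideanSpace.real_norm_sq_eq, PiLp.inner_apply,
        ← Finset.sum_sub_distrib, ← Finset.sum_sub_distrib]
      refine Finset.sum_congr rfl fun i _ => ?_
      have : ρ i = f i θ - f i θ₀ - inner ℝ (g i θ₀) (θ - θ₀) := rfl
      simp only [gradPair, RCLike.inner_apply, conj_trivial]
      rw [sq]
      nth_rw 2 [this]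
      ring
    rw [← h2, abs_of_nonneg (sq_nonneg _)] at h1
    nlinarith
  · have := HasFDerivAt.fun_sum (u := Finset.univ)
      fun i _ => ((hf i θ).hasFDerivAt.const_mul (ρ i))
    rw [hasGradientAt_iff_hasFDerivAt]
    refine this.congr_fderiv ?_
    simp [gradComb]

theorem IsLSFlow.norm_sub_linearized_le {f : ι → E → ℝ} {g : ι → E → E} {y : EuclideanSpace ℝ ι}
    {γ η : ℝ → E} {θ₀ : E} (h : IsLSFlow f g y γ)
    (hlin : IsLSFlow (fun i θ => f i θ₀ + inner ℝ (g i θ₀) (θ - θ₀)) (fun i _ => g i θ₀) y η)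
    (hγ0 : γ 0 = θ₀) (hη0 : η 0 = θ₀) {σ κ R : ℝ} (hσ : 0 < σ) (hR : 0 < R)
    (hr0 : ‖lsResidual f y θ₀‖ ≤ R) (hlow : ∀ v, σ * ‖v‖ ≤ ‖gradComb (fun i => g i θ₀) v‖)
    (hκ : ∀ θ v, ‖gradComb (fun i => g i θ) v - gradComb (fun i => g i θ₀) v‖
      ≤ κ * ‖θ - θ₀‖ * ‖v‖) (hsmall : 4 * κ * R ≤ σ ^ 2) (hκ0 : 0 < κ) {t : ℝ} (ht : 0 ≤ t) :
    ‖γ t - θ₀‖ ≤ 2 * R / σ ∧ ‖γ t - η t‖ ≤ 52 * (κ * R ^ 2 / σ ^ 3) := by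
  subst hγ0
  have lazy {s : ℝ} (hs : 0 ≤ s) := h.lazy hσ hR hr0 hlow hκ hsmall hκ0.le hs
  refine ⟨(lazy ht).1, ?_⟩
  -- The difference of the flows is driven by two errors: `ρ`, the Taylor remainder of the outputs,
  -- bounded by lazy training, and `p`, the change of Jacobian applied to the decaying residual. The
  -- two contributions `4` and `3 · 2 · 8` make up the constant `52`.
  have key := norm_le_of_perturbed_contraction (g := fun i => g i (γ 0))
    (w := fun s => γ s - η s)
    (ρ := fun s => WithLp.toLp 2 fun i =>
      f i (γ s) - f i (γ 0) - inner ℝ (g i (γ 0)) (γ s - γ 0))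
    (p := fun s => gradComb (fun i => g i (γ s)) (lsResidual f y (γ s))
      - gradComb (fun i => g i (γ 0)) (lsResidual f y (γ s)))
    (ρ₀ := κ * (2 * R / σ) ^ 2) (c := κ * (2 * R / σ) * R) (μ := σ ^ 2 / 8)
    hσ (by positivity) (by positivity) (by positivity) hlow (by simp [hη0]) (fun s hs => ?_)
    (fun s hs => ?_) (fun s hs => ?_) ht
  · refine key.trans (le_of_eq ?_)
    field_simp
    ring
  · refine ((h.2 s hs).sub (hlin.2 s hs)).congr_deriv ?_
    have : gradPair (fun i => g i (γ 0)) (γ s - η s) + (WithLp.toLp 2 fun i =>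
        f i (γ s) - f i (γ 0) - inner ℝ (g i (γ 0)) (γ s - γ 0))
        + lsResidual (fun i θ => f i (γ 0) + inner ℝ (g i (γ 0)) (θ - γ 0)) y (η s)
        = lsResidual f y (γ s) := by
      ext i
      simp only [gradPair, lsResidual, PiLp.add_apply, inner_sub_right]
      ring
    have h2 := congrArg (gradComb (fun i => g i (γ 0))) this
    rw [gradComb_add] at h2
    rw [← h2]
    abel
  · refine (norm_residual_sub_linearization_le hκ0.le h.1 hκ (γ s)).trans ?_
    have := (lazy hs).1
    gcongr
  · refine (hκ (γ s) _).trans ?_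
    obtain ⟨h1, h2⟩ := lazy hs
    rw [mul_assoc _ R]
    gcongr

end Comparison

/-! ### Gradients of the network -/

section NetworkCalculus

/-- All the size bounds on an activation function, with a single constant `A ≥ 1`. -/
structure BoundedActivation (Φ : ℝ → ℝ) (A : ℝ) : Prop where
  one_le : 1 ≤ A
  differentiable : Differentiable ℝ Φ
  abs_le : ∀ z, |Φ z| ≤ A
  abs_deriv_le : ∀ z, |deriv Φ z| ≤ A
  lipschitz : ∀ a b, |Φ a - Φ b| ≤ A * |a - b|
  lipschitz_deriv : ∀ a b, |deriv Φ a - deriv Φ b| ≤ A * |a - b|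

theorem RegularActivation.exists_bounded {Φ : ℝ → ℝ} (h : RegularActivation Φ) (B : ℝ) :
    ∃ A, B ≤ A ∧ BoundedActivation Φ A := by
  obtain ⟨K, hK⟩ := h.lipschitz
  obtain ⟨K', hK'⟩ := h.lipschitz_deriv
  obtain ⟨M, hM⟩ := h.bounded
  obtain ⟨M', hM'⟩ := h.bounded_deriv
  have hM0 : 0 ≤ M := (abs_nonneg _).trans (hM 0)
  have hM0' : 0 ≤ M' := (abs_nonneg _).trans (hM' 0)
  have hB := le_abs_self B
  have hB' := abs_nonneg B
  refine ⟨1 + |B| + K + K' + M + M', by linarith, by linarith, h.differentiable,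
    fun z => (hM z).trans (by linarith), fun z => (hM' z).trans (by linarith), fun a b => ?_,
    fun a b => ?_⟩
  · refine (by simpa [Real.dist_eq] using hK.dist_le_mul a b : |Φ a - Φ b| ≤ K * |a - b|).trans ?_
    gcongr; linarith
  · refine (by simpa [Real.dist_eq] using hK'.dist_le_mul a b :
      |deriv Φ a - deriv Φ b| ≤ K' * |a - b|).trans ?_
    gcongr; linarith

variable {n₀ n₁ : ℕ}

/-- The parameter vector with inner weights `aⱼ xᵢ / √n₀` and outer weights `bⱼ`. -/
noncomputable def colComb (x : EuclideanSpace ℝ (Fin n₀)) (a b : Fin n₁ → ℝ) : Params n₀ n₁ :=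
  WithLp.toLp 2 (Sum.elim (fun p => a p.2 * (1 / √(n₀ : ℝ) * x p.1)) b)

theorem inner_colComb (x : EuclideanSpace ℝ (Fin n₀)) (a b : Fin n₁ → ℝ) (θ : Params n₀ n₁) :
    inner ℝ (colComb x a b) θ = ∑ j, a j * preact x θ j + ∑ j, b j * θ (Sum.inr j) := by
  simp only [PiLp.inner_apply, colComb, Fintype.sum_sum_type, Sum.elim_inl, Sum.elim_inr,
    RCLike.inner_apply, conj_trivial, Fintype.sum_prod_type_right, preact]
  congr 1
  · refine Finset.sum_congr rfl fun j _ => ?_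
    rw [Finset.mul_sum, Finset.mul_sum]
    refine Finset.sum_congr rfl fun i _ => ?_
    ring
  · exact Finset.sum_congr rfl fun j _ => mul_comm _ _

theorem preact_colComb (x x' : EuclideanSpace ℝ (Fin n₀)) (a b : Fin n₁ → ℝ) (j : Fin n₁) :
    preact x (colComb x' a b) j = a j * inputKernel x x' := by
  have h : 1 / √(n₀ : ℝ) * (1 / √(n₀ : ℝ)) = 1 / n₀ := by
    rw [div_mul_div_comm, one_mul, Real.mul_self_sqrt (Nat.cast_nonneg _)]
  simp only [preact, colComb, Sum.elim_inl, inputKernel, PiLp.inner_apply, RCLike.inner_apply,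
    conj_trivial, ← h, Finset.mul_sum]
  refine Finset.sum_congr rfl fun i _ => ?_
  ring

theorem inner_colComb_colComb (x x' : EuclideanSpace ℝ (Fin n₀)) (a b a' b' : Fin n₁ → ℝ) :
    inner ℝ (colComb x a b) (colComb x' a' b')
      = inputKernel x x' * ∑ j, a j * a' j + ∑ j, b j * b' j := by
  rw [inner_colComb, Finset.mul_sum]
  congr 1
  refine Finset.sum_congr rfl fun j _ => ?_
  rw [preact_colComb]
  ring

theorem inputKernel_self (x : EuclideanSpace ℝ (Fin n₀)) : inputKernel x x = ‖x‖ ^ 2 / n₀ := by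
  rw [inputKernel, real_inner_self_eq_norm_sq]; ring

theorem norm_colComb_sq (x : EuclideanSpace ℝ (Fin n₀)) (a b : Fin n₁ → ℝ) :
    ‖colComb x a b‖ ^ 2 = ‖x‖ ^ 2 / n₀ * ∑ j, a j ^ 2 + ∑ j, b j ^ 2 := by
  rw [← real_inner_self_eq_norm_sq, inner_colComb_colComb, inputKernel_self]
  simp [sq]

theorem colComb_sub (x : EuclideanSpace ℝ (Fin n₀)) (a b a' b' : Fin n₁ → ℝ) :
    colComb x a b - colComb x a' b' = colComb x (a - a') (b - b') := by
  ext c; rcases c with p | j <;> simp [colComb, sub_mul]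

/-- The gradient of the network with respect to the parameters. -/
noncomputable def netGrad (Φ : ℝ → ℝ) (x : EuclideanSpace ℝ (Fin n₀)) (θ : Params n₀ n₁) :
    Params n₀ n₁ :=
  colComb x (fun j => 1 / √(n₁ : ℝ) * (deriv Φ (preact x θ j) * θ (Sum.inr j)))
    (fun j => 1 / √(n₁ : ℝ) * Φ (preact x θ j))

theorem preact_eq_inner (x : EuclideanSpace ℝ (Fin n₀)) (θ : Params n₀ n₁) (j : Fin n₁) :
    preact x θ j = inner ℝ (colComb x (Pi.single j 1) 0) θ := by
  simp [inner_colComb, Pi.single_apply]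

theorem hasGradientAt_network {Φ : ℝ → ℝ} (hΦ : Differentiable ℝ Φ)
    (x : EuclideanSpace ℝ (Fin n₀)) (θ : Params n₀ n₁) :
    HasGradientAt (network Φ x) (netGrad Φ x θ) θ := by
  have h1 (j : Fin n₁) : HasFDerivAt (fun θ : Params n₀ n₁ => preact x θ j)
      (innerSL ℝ (colComb x (Pi.single j 1) 0)) θ := by
    simp_rw [preact_eq_inner]
    exact (innerSL ℝ (colComb x (Pi.single j 1) 0)).hasFDerivAt
  have h2 (j : Fin n₁) : HasFDerivAt (fun θ : Params n₀ n₁ => θ (Sum.inr j))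
      (EuclideanSpace.proj (𝕜 := ℝ) (Sum.inr j)) θ :=
    (EuclideanSpace.proj (𝕜 := ℝ) (Sum.inr j : (Fin n₀ × Fin n₁) ⊕ Fin n₁)).hasFDerivAt
  have h3 := (HasFDerivAt.fun_sum (u := Finset.univ) fun j _ =>
    (((hΦ (preact x θ j)).hasDerivAt.comp_hasFDerivAt θ (h1 j)).fun_mul (h2 j))).const_mul
      (1 / √(n₁ : ℝ))
  rw [hasGradientAt_iff_hasFDerivAt]
  refine h3.congr_fderiv ?_
  ext v
  simp only [_root_.smul_apply, _root_.sum_apply,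
    _root_.add_apply, innerSL_apply_apply, InnerProductSpace.toDual_apply_apply, netGrad,
    ← preact_eq_inner]
  rw [inner_colComb, ← Finset.sum_add_distrib, smul_eq_mul, Finset.mul_sum]
  refine Finset.sum_congr rfl fun j _ => ?_
  simp [Function.comp]
  ring

theorem gradient_network {Φ : ℝ → ℝ} (hΦ : Differentiable ℝ Φ)
    (x : EuclideanSpace ℝ (Fin n₀)) (θ : Params n₀ n₁) :
    ∇ (network Φ x) θ = netGrad Φ x θ :=
  (hasGradientAt_network hΦ x θ).gradient

theorem gradient_empRisk {Φ : ℝ → ℝ} (hΦ : Differentiable ℝ Φ) {n : ℕ}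
    (X : Fin n → EuclideanSpace ℝ (Fin n₀)) (y : EuclideanSpace ℝ (Fin n)) (θ : Params n₀ n₁) :
    ∇ (empRisk Φ X y) θ = gradComb (fun i => netGrad Φ (X i) θ)
      (lsResidual (fun i => network Φ (X i)) y θ) := by
  refine HasGradientAt.gradient ?_
  rw [hasGradientAt_iff_hasFDerivAt]
  have h := (HasFDerivAt.fun_sum (u := Finset.univ) fun i _ =>
    (((hasGradientAt_network hΦ (X i) θ).hasFDerivAt.sub_const (y i)).pow 2)).const_mul (1 / 2 : ℝ)
  refine h.congr_fderiv ?_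
  ext v
  simp only [gradComb, lsResidual, Finset.mul_sum, _root_.smul_apply, _root_.sum_apply, map_sum,
    map_smul, InnerProductSpace.toDual_apply_apply, smul_eq_mul]
  refine Finset.sum_congr rfl fun i _ => ?_
  simp
  ring

theorem preact_sub (x : EuclideanSpace ℝ (Fin n₀)) (θ θ' : Params n₀ n₁) (j : Fin n₁) :
    preact x θ j - preact x θ' j = preact x (θ - θ') j := by
  simp only [preact_eq_inner, inner_sub_right]

theorem sum_sq_outer_le (θ : Params n₀ n₁) : ∑ j, θ (Sum.inr j) ^ 2 ≤ ‖θ‖ ^ 2 := by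
  rw [EuclideanSpace.real_norm_sq_eq, Fintype.sum_sum_type]
  exact le_add_of_nonneg_left (Finset.sum_nonneg fun _ _ => sq_nonneg _)

theorem sum_preact_sq_le (x : EuclideanSpace ℝ (Fin n₀)) (θ : Params n₀ n₁) :
    ∑ j, preact x θ j ^ 2 ≤ ‖x‖ ^ 2 / n₀ * ‖θ‖ ^ 2 := by
  have h1 (j : Fin n₁) : preact x θ j ^ 2 ≤ ‖x‖ ^ 2 / n₀ * ∑ i, θ (Sum.inl (i, j)) ^ 2 := by
    rw [preact, mul_pow, div_pow, one_pow, Real.sq_sqrt (Nat.cast_nonneg _),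
      EuclideanSpace.real_norm_sq_eq, div_mul_eq_mul_div, one_mul, div_mul_eq_mul_div]
    gcongr
    exact Finset.sum_mul_sq_le_sq_mul_sq _ _ _
  calc ∑ j, preact x θ j ^ 2 ≤ ∑ j, ‖x‖ ^ 2 / n₀ * ∑ i, θ (Sum.inl (i, j)) ^ 2 :=
        Finset.sum_le_sum fun j _ => h1 j
    _ = ‖x‖ ^ 2 / n₀ * ∑ p, θ (Sum.inl p) ^ 2 := by
        rw [← Finset.mul_sum, Fintype.sum_prod_type_right]
    _ ≤ ‖x‖ ^ 2 / n₀ * ‖θ‖ ^ 2 := by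
        gcongr
        rw [EuclideanSpace.real_norm_sq_eq, Fintype.sum_sum_type]
        exact le_add_of_nonneg_right (Finset.sum_nonneg fun _ _ => sq_nonneg _)

/-- The largest outer weight, in absolute value. -/
noncomputable def outerMax (θ : Params n₀ n₁) : ℝ := ‖fun j => θ (Sum.inr j)‖

/-- The quadratic mean of the outer weights. -/
noncomputable def outerMean (θ : Params n₀ n₁) : ℝ := √(1 / n₁ * ∑ j, θ (Sum.inr j) ^ 2)

theorem outerMax_nonneg (θ : Params n₀ n₁) : 0 ≤ outerMax θ := norm_nonneg _

theorem outerMean_nonneg (θ : Params n₀ n₁) : 0 ≤ outerMean θ := Real.sqrt_nonneg _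

theorem abs_outer_le (θ : Params n₀ n₁) (j : Fin n₁) : |θ (Sum.inr j)| ≤ outerMax θ :=
  norm_le_pi_norm (fun j => θ (Sum.inr j)) j

theorem outerMean_sq (θ : Params n₀ n₁) :
    outerMean θ ^ 2 = 1 / n₁ * ∑ j, θ (Sum.inr j) ^ 2 :=
  Real.sq_sqrt (mul_nonneg (by positivity) (Finset.sum_nonneg fun _ _ => sq_nonneg _))

theorem outerMax_le_norm (θ : Params n₀ n₁) : outerMax θ ≤ ‖θ‖ :=
  (pi_norm_le_iff_of_nonneg (norm_nonneg _)).2 fun _ => PiLp.norm_apply_le θ _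

theorem outerMean_le_norm (θ : Params n₀ n₁) : outerMean θ ≤ ‖θ‖ := by
  refine (sq_le_sq₀ (outerMean_nonneg _) (norm_nonneg _)).1 ?_
  rw [outerMean_sq]
  rcases Nat.eq_zero_or_pos n₁ with rfl | h
  · simp
  refine (mul_le_of_le_one_left (Finset.sum_nonneg fun _ _ => sq_nonneg _) ?_).trans
    (sum_sq_outer_le θ)
  rw [div_le_one (by positivity)]
  exact_mod_cast h

variable {Φ : ℝ → ℝ} {A : ℝ} (hΦ : BoundedActivation Φ A)

theorem norm_sq_div_le {x : EuclideanSpace ℝ (Fin n₀)} (hx : ‖x‖ ≤ A) (h₀ : 0 < n₀) :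
    ‖x‖ ^ 2 / n₀ ≤ A ^ 2 := by
  have h1 : (1 : ℝ) ≤ n₀ := by exact_mod_cast h₀
  refine (div_le_self (by positivity) h1).trans ?_
  gcongr

include hΦ in
-- The outer weights enter through their quadratic mean, whose moments do not grow with the width.
theorem norm_netGrad_le {x : EuclideanSpace ℝ (Fin n₀)} (hx : ‖x‖ ≤ A) (h₀ : 0 < n₀) (h₁ : 0 < n₁)
    (θ : Params n₀ n₁) : ‖netGrad Φ x θ‖ ≤ A ^ 2 * (1 + outerMean θ) := by
  have hA := hΦ.one_le
  have hn : (0 : ℝ) < n₁ := by exact_mod_cast h₁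
  have hG := outerMean_nonneg θ
  refine (sq_le_sq₀ (norm_nonneg _) (by positivity)).1 ?_
  rw [netGrad, norm_colComb_sq]
  have e1 : ∑ j, (1 / √(n₁ : ℝ) * (deriv Φ (preact x θ j) * θ (Sum.inr j))) ^ 2
      ≤ A ^ 2 * outerMean θ ^ 2 := by
    rw [outerMean_sq, Finset.mul_sum, Finset.mul_sum]
    refine Finset.sum_le_sum fun j _ => ?_
    rw [mul_pow, div_pow, one_pow, Real.sq_sqrt hn.le, mul_pow]
    have : deriv Φ (preact x θ j) ^ 2 ≤ A ^ 2 := sq_le_sq' (abs_le.1 (hΦ.abs_deriv_le _)).1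
      (abs_le.1 (hΦ.abs_deriv_le _)).2
    calc _ ≤ 1 / (n₁ : ℝ) * (A ^ 2 * θ (Sum.inr j) ^ 2) := by gcongr
      _ = _ := by ring
  have e2 : ∑ j, (1 / √(n₁ : ℝ) * Φ (preact x θ j)) ^ 2 ≤ A ^ 2 := by
    calc _ ≤ ∑ _j : Fin n₁, 1 / (n₁ : ℝ) * A ^ 2 := by
          refine Finset.sum_le_sum fun j _ => ?_
          rw [mul_pow, div_pow, one_pow, Real.sq_sqrt hn.le]
          have : Φ (preact x θ j) ^ 2 ≤ A ^ 2 := sq_le_sq' (abs_le.1 (hΦ.abs_le _)).1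
            (abs_le.1 (hΦ.abs_le _)).2
          gcongr
      _ = A ^ 2 := by simp; field_simp
  have e3 := norm_sq_div_le hx h₀
  calc _ ≤ A ^ 2 * (A ^ 2 * outerMean θ ^ 2) + A ^ 2 * 1 := by
        rw [mul_one]
        have : 0 ≤ outerMean θ ^ 2 := sq_nonneg _
        gcongr
    _ ≤ A ^ 2 * (A ^ 2 * outerMean θ ^ 2) + A ^ 2 * A ^ 2 := by gcongr; nlinarith
    _ ≤ (A ^ 2 * (1 + outerMean θ)) ^ 2 := by nlinarith [mul_nonneg (sq_nonneg (A ^ 2)) hG]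

include hΦ in
-- Each inner gradient coordinate carries `1 / √(n₀ n₁)`, and each outer one carries `1 / √n₁` and
-- varies through a preactivation, which supplies the other `1 / √n₀`. Only the reference point `θ'`
-- enters the constant, so the bound is global in `θ`. The maximum of the outer weights is used,
-- since they multiply, neuron by neuron, increments of `Φ'` controlled only in quadratic sum.
theorem norm_netGrad_sub_le {x : EuclideanSpace ℝ (Fin n₀)} (hx : ‖x‖ ≤ A) (h₀ : 0 < n₀)
    (h₁ : 0 < n₁) (θ θ' : Params n₀ n₁) :
    ‖netGrad Φ x θ - netGrad Φ x θ'‖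
      ≤ 3 * A ^ 3 * (1 + outerMax θ') / √((n₁ : ℝ) * n₀) * ‖θ - θ'‖ := by
  have hA := hΦ.one_le
  have hn : (0 : ℝ) < n₁ := by exact_mod_cast h₁
  have hn0 : (1 : ℝ) ≤ n₀ := by exact_mod_cast h₀
  have hM := outerMax_nonneg θ'
  have hx2 : ‖x‖ ^ 2 ≤ A ^ 2 := by gcongr
  set D := ‖θ - θ'‖ ^ 2 with hD
  have hS : ∑ j, (preact x θ j - preact x θ' j) ^ 2 ≤ A ^ 2 / n₀ * D := by
    simp_rw [preact_sub]
    refine (sum_preact_sq_le x _).trans ?_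
    gcongr
  have hS' : ∑ j, (preact x θ j - preact x θ' j) ^ 2 ≤ A ^ 2 * D := by
    refine hS.trans ?_
    gcongr
    exact div_le_self (by positivity) hn0
  have hT : ∑ j, (θ (Sum.inr j) - θ' (Sum.inr j)) ^ 2 ≤ D := sum_sq_outer_le (θ - θ')
  refine (sq_le_sq₀ (norm_nonneg _) (by positivity)).1 ?_
  rw [netGrad, netGrad, colComb_sub, norm_colComb_sq, mul_pow, ← hD, div_pow,
    Real.sq_sqrt (by positivity)]
  have e1 : ∑ j, (1 / √(n₁ : ℝ) * Φ (preact x θ j) - 1 / √(n₁ : ℝ) * Φ (preact x θ' j)) ^ 2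
      ≤ A ^ 4 * D / (n₁ * n₀) := by
    calc _ ≤ ∑ j, A ^ 2 / n₁ * (preact x θ j - preact x θ' j) ^ 2 := by
          refine Finset.sum_le_sum fun j _ => ?_
          rw [← mul_sub, mul_pow, div_pow, one_pow, Real.sq_sqrt hn.le]
          have : (Φ (preact x θ j) - Φ (preact x θ' j)) ^ 2
              ≤ A ^ 2 * (preact x θ j - preact x θ' j) ^ 2 := by
            have := hΦ.lipschitz (preact x θ j) (preact x θ' j)
            rw [← sq_abs (Φ _ - Φ _), ← sq_abs (preact x θ j - preact x θ' j), ← mul_pow]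
            gcongr
          calc _ ≤ 1 / (n₁ : ℝ) * (A ^ 2 * (preact x θ j - preact x θ' j) ^ 2) := by gcongr
            _ = _ := by ring
      _ ≤ A ^ 2 / n₁ * (A ^ 2 / n₀ * D) := by rw [← Finset.mul_sum]; gcongr
      _ = _ := by field_simp
  have e2 : ∑ j, (1 / √(n₁ : ℝ) * (deriv Φ (preact x θ j) * θ (Sum.inr j))
      - 1 / √(n₁ : ℝ) * (deriv Φ (preact x θ' j) * θ' (Sum.inr j))) ^ 2
      ≤ 2 * A ^ 2 / n₁ * (D + outerMax θ' ^ 2 * (A ^ 2 * D)) := by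
    calc _ ≤ ∑ j, (2 * A ^ 2 / n₁ * (θ (Sum.inr j) - θ' (Sum.inr j)) ^ 2
            + 2 * A ^ 2 / n₁ * outerMax θ' ^ 2 * (preact x θ j - preact x θ' j) ^ 2) := by
          refine Finset.sum_le_sum fun j _ => ?_
          rw [← mul_sub, mul_pow, div_pow, one_pow, Real.sq_sqrt hn.le]
          set u := deriv Φ (preact x θ j)
          set v := deriv Φ (preact x θ' j)
          set a := θ (Sum.inr j)
          set b := θ' (Sum.inr j)
          set h := preact x θ j - preact x θ' j
          have f1 : u ^ 2 ≤ A ^ 2 := sq_le_sq' (abs_le.1 (hΦ.abs_deriv_le _)).1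
            (abs_le.1 (hΦ.abs_deriv_le _)).2
          have f2 : (u - v) ^ 2 ≤ A ^ 2 * h ^ 2 := by
            have := hΦ.lipschitz_deriv (preact x θ j) (preact x θ' j)
            rw [← sq_abs (u - v), ← sq_abs h, ← mul_pow]
            gcongr
          have f3 : b ^ 2 ≤ outerMax θ' ^ 2 := by
            rw [← sq_abs b]
            have := abs_outer_le θ' j
            gcongr
          have f4 : (u * a - v * b) ^ 2
              ≤ 2 * (A ^ 2 * (a - b) ^ 2) + 2 * (A ^ 2 * h ^ 2 * outerMax θ' ^ 2) := by
            -- This splitting leaves the outer weight `b` of `θ'` as the sole unbounded factor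
            -- besides the increments.
            calc (u * a - v * b) ^ 2 = (u * (a - b) + (u - v) * b) ^ 2 := by ring
              _ ≤ 2 * (u * (a - b)) ^ 2 + 2 * ((u - v) * b) ^ 2 := by
                nlinarith [sq_nonneg (u * (a - b) - (u - v) * b)]
              _ = 2 * (u ^ 2 * (a - b) ^ 2) + 2 * ((u - v) ^ 2 * b ^ 2) := by ring
              _ ≤ _ := by gcongr
          calc _ ≤ 1 / (n₁ : ℝ) * (2 * (A ^ 2 * (a - b) ^ 2)
                + 2 * (A ^ 2 * h ^ 2 * outerMax θ' ^ 2)) := by gcongr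
            _ = _ := by ring
      _ ≤ 2 * A ^ 2 / n₁ * D + 2 * A ^ 2 / n₁ * outerMax θ' ^ 2 * (A ^ 2 * D) := by
          rw [Finset.sum_add_distrib, ← Finset.mul_sum, ← Finset.mul_sum]
          gcongr
      _ = _ := by ring
  calc _ ≤ A ^ 2 / n₀ * (2 * A ^ 2 / n₁ * (D + outerMax θ' ^ 2 * (A ^ 2 * D)))
        + A ^ 4 * D / (n₁ * n₀) := by
        refine add_le_add ?_ e1
        refine mul_le_mul ?_ e2 (Finset.sum_nonneg fun _ _ => sq_nonneg _) (by positivity)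
        gcongr
    _ = (3 * A ^ 4 + 2 * A ^ 6 * outerMax θ' ^ 2) / (n₁ * n₀) * D := by field_simp; ring
    _ ≤ _ := by
        gcongr
        have : A ^ 4 ≤ A ^ 6 := pow_le_pow_right₀ hA (by norm_num)
        have h6 : 0 ≤ A ^ 6 := by positivity
        nlinarith [mul_nonneg h6 hM, mul_nonneg h6 (sq_nonneg (outerMax θ'))]

include hΦ in
-- The products are split so that only the outer weights of `θ'` remain; Cauchy–Schwarz then needs
-- their quadratic mean rather than their maximum.
theorem abs_network_sub_le {x : EuclideanSpace ℝ (Fin n₀)} (hx : ‖x‖ ≤ A) (h₀ : 0 < n₀)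
    (h₁ : 0 < n₁) (θ θ' : Params n₀ n₁) :
    |network Φ x θ - network Φ x θ'| ≤ A ^ 2 * (1 + outerMean θ') * ‖θ - θ'‖ := by
  have hA := hΦ.one_le
  have hn : (0 : ℝ) < n₁ := by exact_mod_cast h₁
  have hG := outerMean_nonneg θ'
  have cs (a b : Fin n₁ → ℝ) {α β : ℝ} (hα : 0 ≤ α) (hβ : 0 ≤ β) (ha : ∑ j, a j ^ 2 ≤ α ^ 2)
      (hb : ∑ j, b j ^ 2 ≤ β ^ 2) : |∑ j, a j * b j| ≤ α * β := by
    refine abs_le_of_sq_le_sq ?_ (mul_nonneg hα hβ)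
    rw [mul_pow]
    refine (Finset.sum_mul_sq_le_sq_mul_sq _ _ _).trans ?_
    exact mul_le_mul ha hb (Finset.sum_nonneg fun _ _ => sq_nonneg _) (sq_nonneg _)
  have e : network Φ x θ - network Φ x θ'
      = ∑ j, (1 / √(n₁ : ℝ) * Φ (preact x θ j)) * (θ (Sum.inr j) - θ' (Sum.inr j))
        + ∑ j, (Φ (preact x θ j) - Φ (preact x θ' j)) * (1 / √(n₁ : ℝ) * θ' (Sum.inr j)) := by
    rw [network, network, Finset.mul_sum, Finset.mul_sum, ← Finset.sum_sub_distrib,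
      ← Finset.sum_add_distrib]
    refine Finset.sum_congr rfl fun j _ => ?_
    ring
  have e1 := cs (fun j => 1 / √(n₁ : ℝ) * Φ (preact x θ j))
    (fun j => θ (Sum.inr j) - θ' (Sum.inr j)) (by positivity : 0 ≤ A) (norm_nonneg (θ - θ')) (by
      calc _ ≤ ∑ _j : Fin n₁, 1 / (n₁ : ℝ) * A ^ 2 := by
            refine Finset.sum_le_sum fun j _ => ?_
            rw [mul_pow, div_pow, one_pow, Real.sq_sqrt hn.le]
            have : Φ (preact x θ j) ^ 2 ≤ A ^ 2 := sq_le_sq' (abs_le.1 (hΦ.abs_le _)).1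
              (abs_le.1 (hΦ.abs_le _)).2
            gcongr
        _ = A ^ 2 := by simp; field_simp) (sum_sq_outer_le (θ - θ'))
  have e2 := cs (fun j => Φ (preact x θ j) - Φ (preact x θ' j))
    (fun j => 1 / √(n₁ : ℝ) * θ' (Sum.inr j)) (by positivity : 0 ≤ A * (A * ‖θ - θ'‖)) hG (by
      calc _ ≤ ∑ j, A ^ 2 * (preact x (θ - θ') j) ^ 2 := by
            refine Finset.sum_le_sum fun j _ => ?_
            have := hΦ.lipschitz (preact x θ j) (preact x θ' j)
            rw [preact_sub] at this
            rw [← sq_abs (Φ _ - Φ _), ← sq_abs (preact _ _ _), ← mul_pow]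
            gcongr
        _ ≤ A ^ 2 * (A ^ 2 * ‖θ - θ'‖ ^ 2) := by
            rw [← Finset.mul_sum]
            gcongr
            refine (sum_preact_sq_le x _).trans ?_
            gcongr
            exact norm_sq_div_le hx h₀
        _ = _ := by ring) (by
      rw [outerMean_sq, Finset.mul_sum]
      refine Finset.sum_le_sum fun j _ => ?_
      rw [mul_pow, div_pow, one_pow, Real.sq_sqrt hn.le])
  rw [e]
  refine (abs_add_le _ _).trans ((add_le_add e1 e2).trans ?_)
  have : A * ‖θ - θ'‖ ≤ A ^ 2 * ‖θ - θ'‖ := by gcongr; nlinarith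
  nlinarith

end NetworkCalculus

/-! ### Continuous dependence of the flows on the initialization -/

section LipOnBalls

variable {V W : Type*} [NormedAddCommGroup V] [NormedAddCommGroup W]

/-- `F` is Lipschitz on every bounded set. -/
def LipOnBalls (F : V → W) : Prop :=
  ∀ ρ : ℝ, ∃ K : ℝ≥0, LipschitzOnWith K F (Metric.closedBall 0 ρ)

theorem LipOnBalls.of_norm_sub_le {F : V → W} (c : ℝ)
    (h : ∀ a b, ‖F a - F b‖ ≤ c * (1 + ‖b‖) * ‖a - b‖) : LipOnBalls F := by
  intro ρ
  refine ⟨Real.toNNReal (|c| * (1 + |ρ|)), LipschitzOnWith.of_dist_le_mul fun a _ b hb => ?_⟩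
  rw [dist_eq_norm, dist_eq_norm, Real.coe_toNNReal _ (by positivity)]
  refine (h a b).trans ?_
  have hb' : ‖b‖ ≤ |ρ| := (by simpa using hb : ‖b‖ ≤ ρ).trans (le_abs_self ρ)
  have := le_abs_self c
  gcongr

theorem LipOnBalls.bounded {F : V → W} (h : LipOnBalls F) (ρ : ℝ) :
    ∃ C, 0 ≤ C ∧ ∀ a ∈ Metric.closedBall (0 : V) ρ, ‖F a‖ ≤ C := by
  obtain ⟨K, hK⟩ := h ρ
  refine ⟨‖F 0‖ + K * |ρ|, by positivity, fun a ha => ?_⟩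
  have ha' : ‖a‖ ≤ ρ := by simpa using ha
  have hρ : 0 ≤ ρ := (norm_nonneg a).trans ha'
  have h1 := hK.dist_le_mul a ha 0 (by simpa using hρ)
  rw [dist_eq_norm, dist_zero_right] at h1
  have h2 : ‖F a‖ ≤ ‖F 0‖ + ‖F a - F 0‖ := by
    have := norm_add_le (F 0) (F a - F 0)
    simpa using this
  have h3 : (K : ℝ) * ‖a‖ ≤ K * |ρ| := by
    gcongr; exact ha'.trans (le_abs_self _)
  linarith

theorem LipOnBalls.continuous {F : V → W} (h : LipOnBalls F) : Continuous F := by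
  refine continuous_iff_continuousAt.2 fun a => ?_
  obtain ⟨K, hK⟩ := h (‖a‖ + 1)
  refine hK.continuousOn.continuousAt ?_
  refine Filter.mem_of_superset (Metric.closedBall_mem_nhds a one_pos) fun b hb => ?_
  rw [Metric.mem_closedBall, dist_zero_right]
  rw [Metric.mem_closedBall, dist_eq_norm] at hb
  have := norm_add_le a (b - a)
  rw [add_sub_cancel] at this
  linarith

theorem LipOnBalls.const (w : W) : LipOnBalls fun _ : V => w :=
  fun _ => ⟨0, (LipschitzWith.const w).lipschitzOnWith⟩

theorem LipOnBalls.of_lipschitz {F : V → W} {K : ℝ≥0} (h : LipschitzWith K F) : LipOnBalls F :=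
  fun _ => ⟨K, h.lipschitzOnWith⟩

theorem LipOnBalls.comp_fst {U : Type*} [NormedAddCommGroup U] {F : V → W} (h : LipOnBalls F) :
    LipOnBalls fun p : V × U => F p.1 := by
  intro ρ
  obtain ⟨K, hK⟩ := h ρ
  refine ⟨K * 1, hK.comp LipschitzWith.prod_fst.lipschitzOnWith fun p hp => ?_⟩
  rw [Metric.mem_closedBall, dist_zero_right] at hp ⊢
  exact (norm_fst_le p).trans hp

theorem LipOnBalls.add {F G : V → W} (hF : LipOnBalls F) (hG : LipOnBalls G) :
    LipOnBalls fun a => F a + G a := fun ρ => by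
  obtain ⟨K, hK⟩ := hF ρ
  obtain ⟨L, hL⟩ := hG ρ
  exact ⟨K + L, hK.add hL⟩

theorem LipOnBalls.neg {F : V → W} (hF : LipOnBalls F) : LipOnBalls fun a => -F a := fun ρ => by
  obtain ⟨K, hK⟩ := hF ρ
  exact ⟨K, hK.neg⟩

theorem LipOnBalls.sub {F G : V → W} (hF : LipOnBalls F) (hG : LipOnBalls G) :
    LipOnBalls fun a => F a - G a := by
  simpa only [sub_eq_add_neg] using hF.add hG.neg

theorem LipOnBalls.sum {ι : Type*} {F : ι → V → W} (s : Finset ι) (h : ∀ i, LipOnBalls (F i)) :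
    LipOnBalls fun a => ∑ i ∈ s, F i a := by
  classical
  induction s using Finset.induction_on with
  | empty => simpa using LipOnBalls.const (V := V) (0 : W)
  | insert i s hi ih =>
    simp only [Finset.sum_insert hi]
    exact (h i).add ih

theorem LipOnBalls.prodMk {U : Type*} [NormedAddCommGroup U] {F : V → W} {G : V → U}
    (hF : LipOnBalls F) (hG : LipOnBalls G) : LipOnBalls fun a => (F a, G a) := fun ρ => by
  obtain ⟨K, hK⟩ := hF ρ
  obtain ⟨L, hL⟩ := hG ρ
  exact ⟨max K L, hK.prodMk hL⟩

theorem LipOnBalls.bilinear {W₁ W₂ : Type*} [NormedAddCommGroup W₁] [NormedAddCommGroup W₂]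
    {F : V → W₁} {G : V → W₂} (hF : LipOnBalls F) (hG : LipOnBalls G) (m : W₁ → W₂ → W)
    (hm : ∀ a b, ‖m a b‖ ≤ ‖a‖ * ‖b‖) (hl : ∀ a b c, m (a - b) c = m a c - m b c)
    (hr : ∀ a b c, m a (b - c) = m a b - m a c) : LipOnBalls fun a => m (F a) (G a) := by
  intro ρ
  obtain ⟨K, hK⟩ := hF ρ
  obtain ⟨L, hL⟩ := hG ρ
  obtain ⟨C, hC0, hC⟩ := hF.bounded ρ
  obtain ⟨D, hD0, hD⟩ := hG.bounded ρ
  refine ⟨Real.toNNReal (K * D + C * L), LipschitzOnWith.of_dist_le_mul fun a ha b hb => ?_⟩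
  have h1 := hK.dist_le_mul a ha b hb
  have h2 := hL.dist_le_mul a ha b hb
  rw [dist_eq_norm] at h1 h2
  rw [dist_eq_norm, Real.coe_toNNReal _ (by positivity)]
  have : m (F a) (G a) - m (F b) (G b) = m (F a - F b) (G a) + m (F b) (G a - G b) := by
    rw [hl, hr]; abel
  rw [this]
  calc _ ≤ ‖F a - F b‖ * ‖G a‖ + ‖F b‖ * ‖G a - G b‖ :=
        (norm_add_le _ _).trans (add_le_add (hm _ _) (hm _ _))
    _ ≤ K * dist a b * D + C * (L * dist a b) := by
        have := hD a ha
        have := hC b hb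
        gcongr
    _ = _ := by ring

theorem LipOnBalls.smul [NormedSpace ℝ W] {F : V → ℝ} {G : V → W} (hF : LipOnBalls F)
    (hG : LipOnBalls G) : LipOnBalls fun a => F a • G a :=
  hF.bilinear hG (fun c w => c • w) (fun c w => (norm_smul c w).le) (fun _ _ _ => sub_smul _ _ _)
    (fun _ _ _ => smul_sub _ _ _)

theorem LipOnBalls.inner {H : Type*} [NormedAddCommGroup H] [InnerProductSpace ℝ H] {F G : V → H}
    (hF : LipOnBalls F) (hG : LipOnBalls G) : LipOnBalls fun a => inner ℝ (F a) (G a) :=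
  hF.bilinear hG (fun c w => Inner.inner ℝ c w) (fun c w => norm_inner_le_norm c w)
    (fun _ _ _ => inner_sub_left _ _ _) (fun _ _ _ => inner_sub_right _ _ _)

/-- The a priori bound `c` keeps nearby trajectories in one common ball on `[0, t]`, where the field
is Lipschitz and Grönwall's inequality applies. -/
theorem continuous_of_flow [NormedSpace ℝ V] {P : Type*} [TopologicalSpace P] {v : V → V}
    (hv : LipOnBalls v) {sol : P → ℝ → V} {t : ℝ} (ht : 0 ≤ t)
    (h0 : Continuous fun p => sol p 0)
    (hsol : ∀ p s, 0 ≤ s → HasDerivWithinAt (sol p) (v (sol p s)) (Set.Ici 0) s)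
    {c : P → ℝ} (hc : Continuous c) (hbd : ∀ p, ∀ s ∈ Set.Icc 0 t, ‖sol p s‖ ≤ c p) :
    Continuous fun p => sol p t := by
  refine continuous_iff_continuousAt.2 fun p => ?_
  obtain ⟨K, hK⟩ := hv (c p + 1)
  have hev : ∀ᶠ q in nhds p, c q < c p + 1 :=
    hc.continuousAt.eventually_lt continuousAt_const (by linarith)
  rw [ContinuousAt, tendsto_iff_dist_tendsto_zero]
  have hlim : Filter.Tendsto (fun q => dist (sol q 0) (sol p 0) * Real.exp (K * (t - 0)))
      (nhds p) (nhds 0) := by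
    have : Filter.Tendsto (fun q => dist (sol q 0) (sol p 0)) (nhds p) (nhds 0) :=
      tendsto_iff_dist_tendsto_zero.1 h0.continuousAt
    simpa using this.mul_const (Real.exp (K * (t - 0)))
  refine squeeze_zero' (Filter.Eventually.of_forall fun _ => dist_nonneg) ?_ hlim
  filter_upwards [hev] with q hq
  have hcont (q : P) : ContinuousOn (sol q) (Set.Icc 0 t) := fun s hs =>
    (hsol q s hs.1).continuousWithinAt.mono Set.Icc_subset_Ici_self
  refine dist_le_of_trajectories_ODE_of_mem (v := fun _ => v) (f := sol q) (g := sol p)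
    (s := fun _ => Metric.closedBall 0 (c p + 1)) (fun _ _ => hK) (hcont q)
    (fun s hs => (hsol q s hs.1).mono (Set.Ici_subset_Ici.2 hs.1)) (fun s hs => ?_) (hcont p)
    (fun s hs => (hsol p s hs.1).mono (Set.Ici_subset_Ici.2 hs.1)) (fun s hs => ?_) le_rfl t
    ⟨ht, le_rfl⟩
  · rw [Metric.mem_closedBall, dist_zero_right]
    exact (hbd q s ⟨hs.1, hs.2.le⟩).trans hq.le
  · rw [Metric.mem_closedBall, dist_zero_right]
    linarith [hbd p s ⟨hs.1, hs.2.le⟩]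

end LipOnBalls

/-! ### The network flows as least-squares flows, and their continuity in the initialization -/

section NetworkFlows

variable {n n₀ n₁ : ℕ} {Φ : ℝ → ℝ} {A : ℝ} {X : Fin n → EuclideanSpace ℝ (Fin n₀)}
  {y : EuclideanSpace ℝ (Fin n)} {x : EuclideanSpace ℝ (Fin n₀)}

theorem IsGradientFlow.isLSFlow (hΦ : Differentiable ℝ Φ) {θ₀ : Params n₀ n₁}
    {γ : ℝ → Params n₀ n₁} (h : IsGradientFlow Φ X y θ₀ γ) :
    IsLSFlow (fun i => network Φ (X i)) (fun i => netGrad Φ (X i)) y γ := by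
  refine ⟨fun i θ => hasGradientAt_network hΦ (X i) θ, fun t ht => ?_⟩
  have := h.2 t ht
  rwa [gradient_empRisk hΦ] at this

theorem linNetwork_eq (hΦ : Differentiable ℝ Φ) (x : EuclideanSpace ℝ (Fin n₀))
    (θ₀ θ : Params n₀ n₁) :
    linNetwork Φ x θ₀ θ = network Φ x θ₀ + inner ℝ (netGrad Φ x θ₀) (θ - θ₀) := by
  rw [linNetwork, gradient_network hΦ]

theorem IsLinGradientFlow.isLSFlow (hΦ : Differentiable ℝ Φ) {θ₀ : Params n₀ n₁}
    {γ : ℝ → Params n₀ n₁} (h : IsLinGradientFlow Φ X y θ₀ γ) :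
    IsLSFlow (fun i θ => network Φ (X i) θ₀ + inner ℝ (netGrad Φ (X i) θ₀) (θ - θ₀))
      (fun i _ => netGrad Φ (X i) θ₀) y γ := by
  refine ⟨fun i θ => ?_, fun t ht => ?_⟩
  · rw [hasGradientAt_iff_hasFDerivAt]
    exact (((InnerProductSpace.toDual ℝ (Params n₀ n₁)
      (netGrad Φ (X i) θ₀)).hasFDerivAt.comp θ ((hasFDerivAt_id θ).sub_const θ₀)).const_add _)
  · have := h.2 t ht
    simp_rw [gradient_network hΦ, linNetwork_eq hΦ] at this
    exact this

variable (hΦ : BoundedActivation Φ A) (h₀ : 0 < n₀) (h₁ : 0 < n₁)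

include hΦ h₀ h₁

theorem lipOnBalls_network (hx : ‖x‖ ≤ A) : LipOnBalls (network Φ x : Params n₀ n₁ → ℝ) := by
  refine LipOnBalls.of_norm_sub_le (A ^ 2) fun a b => ?_
  refine (abs_network_sub_le hΦ hx h₀ h₁ a b).trans ?_
  have := outerMean_le_norm b
  gcongr

theorem lipOnBalls_netGrad (hx : ‖x‖ ≤ A) :
    LipOnBalls (netGrad Φ x : Params n₀ n₁ → Params n₀ n₁) := by
  refine LipOnBalls.of_norm_sub_le (3 * A ^ 3) fun a b => ?_
  refine (norm_netGrad_sub_le hΦ hx h₀ h₁ a b).trans ?_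
  have h1 := outerMax_le_norm b
  have h2 := outerMax_nonneg b
  have hA := hΦ.one_le
  have h3 : 1 ≤ √((n₁ : ℝ) * n₀) := by
    rw [Real.one_le_sqrt]
    exact_mod_cast Nat.one_le_iff_ne_zero.2 (by positivity)
  gcongr
  exact (div_le_self (by positivity) h3).trans (by gcongr)

theorem continuous_lsResidual (hX : ∀ i, ‖X i‖ ≤ A) :
    Continuous (lsResidual (fun i => (network Φ (X i) : Params n₀ n₁ → ℝ)) y) := by
  have (i : Fin n) := (lipOnBalls_network hΦ h₀ h₁ (hX i)).continuous
  unfold lsResidual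
  fun_prop

/-- Continuity supplies the measurability without which the laws at time `t` and their coupling
could not be formed as image measures. -/
theorem continuous_gradientFlow (hX : ∀ i, ‖X i‖ ≤ A)
    {γ : Params n₀ n₁ → ℝ → Params n₀ n₁} (h : ∀ θ₀, IsGradientFlow Φ X y θ₀ (γ θ₀))
    {t : ℝ} (ht : 0 ≤ t) : Continuous fun θ₀ => γ θ₀ t := by
  have hls (θ₀) := (h θ₀).isLSFlow hΦ.differentiable
  refine continuous_of_flow (v := fun θ => -gradComb (fun i => netGrad Φ (X i) θ)
      (lsResidual (fun i => network Φ (X i)) y θ)) ?_ ht ?_ (fun p s hs => (hls p).2 s hs)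
    (c := fun θ₀ => ‖θ₀‖ + (‖lsResidual (fun i => network Φ (X i)) y θ₀‖ ^ 2 / 4 + t / 2)) ?_
    (fun p s hs => ?_)
  · refine (LipOnBalls.sum _ fun i => LipOnBalls.smul ?_ (lipOnBalls_netGrad hΦ h₀ h₁ (hX i))).neg
    exact (lipOnBalls_network hΦ h₀ h₁ (hX i)).sub (LipOnBalls.const (y i))
  · simp_rw [(h _).1]; exact continuous_id
  · have := continuous_lsResidual (y := y) hΦ h₀ h₁ hX
    fun_prop
  · have h1 := (hls p).norm_sub_le hs.1
    rw [(h p).1] at h1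
    have h2 := norm_add_le p (γ p s - p)
    rw [add_sub_cancel] at h2
    linarith [hs.2]

/-- The vector field depends on `θ₀`. Adjoining `θ₀` as a constant component turns the family into
one autonomous flow on pairs. -/
theorem continuous_linGradientFlow (hX : ∀ i, ‖X i‖ ≤ A)
    {γ : Params n₀ n₁ → ℝ → Params n₀ n₁} (h : ∀ θ₀, IsLinGradientFlow Φ X y θ₀ (γ θ₀))
    {t : ℝ} (ht : 0 ≤ t) : Continuous fun θ₀ => γ θ₀ t := by
  have hls (θ₀) := (h θ₀).isLSFlow hΦ.differentiable
  have key : Continuous fun θ₀ => (θ₀, γ θ₀ t) := by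
    refine continuous_of_flow (sol := fun θ₀ s => (θ₀, γ θ₀ s))
      (v := fun p : Params n₀ n₁ × Params n₀ n₁ => ((0 : Params n₀ n₁),
        -gradComb (fun i => netGrad Φ (X i) p.1)
        (lsResidual (fun i θ => network Φ (X i) p.1 + inner ℝ (netGrad Φ (X i) p.1) (θ - p.1))
          y p.2)))
      ?_ ht ?_ (fun p s hs => (hasDerivWithinAt_const _ _ _).prodMk ((hls p).2 s hs))
      (c := fun θ₀ => ‖θ₀‖ + (‖lsResidual (fun i => network Φ (X i)) y θ₀‖ ^ 2 / 4 + t / 2)) ?_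
      (fun p s hs => ?_)
    · refine (LipOnBalls.const _).prodMk
        (LipOnBalls.sum _ fun i => LipOnBalls.smul ?_
          (lipOnBalls_netGrad hΦ h₀ h₁ (hX i)).comp_fst).neg
      refine ((lipOnBalls_network hΦ h₀ h₁ (hX i)).comp_fst.add
        (LipOnBalls.inner (lipOnBalls_netGrad hΦ h₀ h₁ (hX i)).comp_fst ?_)).sub
          (LipOnBalls.const (y i))
      exact (LipOnBalls.of_lipschitz LipschitzWith.prod_snd).sub
        (LipOnBalls.of_lipschitz LipschitzWith.prod_fst)
    · simp_rw [(h _).1]; fun_prop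
    · have := continuous_lsResidual (y := y) hΦ h₀ h₁ hX
      fun_prop
    · have h1 := (hls p).norm_sub_le hs.1
      rw [(h p).1] at h1
      have h2 := norm_add_le p (γ p s - p)
      rw [add_sub_cancel] at h2
      have h3 : lsResidual (fun i θ => network Φ (X i) p + inner ℝ (netGrad Φ (X i) p) (θ - p)) y p
          = lsResidual (fun i => network Φ (X i)) y p := by
        ext i; simp [lsResidual]
      rw [h3] at h1
      have h4 := sq_nonneg ‖lsResidual (fun i => network Φ (X i)) y p‖
      refine max_le ?_ (by linarith [hs.2])
      change ‖p‖ ≤ _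
      linarith
  exact continuous_snd.comp key

end NetworkFlows

/-! ### Moments of sums of independent centred random variables -/

section SumMoments

/-- The term linear in `z` is kept exact because its expectation will vanish. Every other mixed term
has a factor `z²`, and the rest of it is at most `S^(2m) + z^(2m)`. -/
theorem add_pow_two_mul_le (m : ℕ) : ∃ D : ℝ, 0 ≤ D ∧ ∀ S z : ℝ,
    (S + z) ^ (2 * (m + 1)) ≤ S ^ (2 * (m + 1)) + (2 * (m + 1) : ℕ) * (S ^ (2 * m + 1) * z)
      + D * (S ^ (2 * m) * z ^ 2 + z ^ (2 * (m + 1))) := by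
  refine ⟨∑ k ∈ Finset.range (2 * m + 1), (Nat.choose (2 * (m + 1)) k : ℝ), by positivity,
    fun S z => ?_⟩
  have hN : 2 * (m + 1) = 2 * m + 1 + 1 := by ring
  rw [add_pow, hN, Finset.sum_range_succ, Finset.sum_range_succ, Finset.sum_mul]
  have h1 : ∑ k ∈ Finset.range (2 * m + 1),
      S ^ k * z ^ (2 * m + 1 + 1 - k) * (Nat.choose (2 * m + 1 + 1) k : ℝ)
      ≤ ∑ k ∈ Finset.range (2 * m + 1), (Nat.choose (2 * m + 1 + 1) k : ℝ)
        * (S ^ (2 * m) * z ^ 2 + z ^ (2 * m + 1 + 1)) := by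
    refine Finset.sum_le_sum fun k hk => ?_
    have hk' : k ≤ 2 * m := Nat.lt_succ_iff.1 (Finset.mem_range.1 hk)
    rw [mul_comm]
    refine mul_le_mul_of_nonneg_left ?_ (Nat.cast_nonneg _)
    have h2 : |S| ^ k * |z| ^ (2 * m - k) ≤ |S| ^ (2 * m) + |z| ^ (2 * m) := by
      have e : k + (2 * m - k) = 2 * m := by omega
      rcases le_total |S| |z| with h | h
      · calc |S| ^ k * |z| ^ (2 * m - k) ≤ |z| ^ k * |z| ^ (2 * m - k) := by gcongr
          _ = |z| ^ (2 * m) := by rw [← pow_add, e]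
          _ ≤ _ := le_add_of_nonneg_left (by positivity)
      · calc |S| ^ k * |z| ^ (2 * m - k) ≤ |S| ^ k * |S| ^ (2 * m - k) := by gcongr
          _ = |S| ^ (2 * m) := by rw [← pow_add, e]
          _ ≤ _ := le_add_of_nonneg_right (by positivity)
    have e2 : 2 * m + 1 + 1 - k = (2 * m - k) + 2 := by omega
    calc S ^ k * z ^ (2 * m + 1 + 1 - k) ≤ |S ^ k * z ^ (2 * m + 1 + 1 - k)| := le_abs_self _
      _ = (|S| ^ k * |z| ^ (2 * m - k)) * z ^ 2 := by
        rw [e2, abs_mul, abs_pow, abs_pow, pow_add, sq_abs, mul_assoc]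
      _ ≤ (|S| ^ (2 * m) + |z| ^ (2 * m)) * z ^ 2 := by gcongr
      _ = _ := by
        rw [Even.pow_abs (even_two_mul m), Even.pow_abs (even_two_mul m)]
        ring
  have h3 : (Nat.choose (2 * m + 1 + 1) (2 * m + 1) : ℝ) = (2 * m + 1 + 1 : ℕ) := by
    rw [Nat.choose_succ_self_right]
  have h4 : 2 * m + 1 + 1 - (2 * m + 1) = 1 := by omega
  rw [h3, h4, Nat.sub_self, Nat.choose_self]
  simp only [pow_one, pow_zero, Nat.cast_one, mul_one]
  linarith

variable {Ω : Type*} [MeasurableSpace Ω] {μ : Measure Ω}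

theorem integrable_pow_of_memLp [IsFiniteMeasure μ] {f : Ω → ℝ} {q : ℕ} (h : MemLp f q μ) :
    Integrable (fun ω => f ω ^ q) μ :=
  (h.integrable_norm_pow').mono' (h.aestronglyMeasurable.pow q)
    (Filter.Eventually.of_forall fun ω => by simp)

/-- Induction on `p`, and on the number of summands inside it. Adding one independent centred term
kills the linear part of the expansion and raises the moment of order `2(m+1)` by at most a multiple
of the moment of order `2m` plus a constant, hence by a constant times the `m`-th power of the new
cardinality. Summing the increments gives the power `m + 1`. -/
theorem exists_integral_sum_pow_le (p : ℕ) (c : ℝ) (hc : 0 ≤ c) : ∃ C : ℝ, 0 ≤ C ∧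
    ∀ {Ω ι : Type} [MeasurableSpace Ω] (μ : Measure Ω) [IsProbabilityMeasure μ] (Z : ι → Ω → ℝ)
      (s : Finset ι), (∀ i, ∀ q : ℕ, MemLp (Z i) q μ) →
      (∀ (s : Finset ι) (i : ι), i ∉ s → IndepFun (fun ω => ∑ j ∈ s, Z j ω) (Z i) μ) →
      (∀ i, ∫ ω, Z i ω ∂μ = 0) → (∀ i, ∀ q ≤ p, ∫ ω, Z i ω ^ (2 * q) ∂μ ≤ c) →
      ∫ ω, (∑ i ∈ s, Z i ω) ^ (2 * p) ∂μ ≤ C * (s.card : ℝ) ^ p := by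
  induction p with
  | zero => exact ⟨1, zero_le_one, fun μ _ Z s _ _ _ _ => by simp⟩
  | succ m ih =>
    obtain ⟨C, hC0, hC⟩ := ih
    obtain ⟨D, hD0, hD⟩ := add_pow_two_mul_le m
    refine ⟨D * (c * (C + 1)), by positivity, fun {Ω ι} _ μ _ Z s hL hI hE hM => ?_⟩
    classical
    have hLS (s : Finset ι) (q : ℕ) : MemLp (fun ω => ∑ j ∈ s, Z j ω) q μ :=
      memLp_finsetSum s fun i _ => hL i q
    have hIk (s : Finset ι) (i : ι) (hi : i ∉ s) (k l : ℕ) :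
        IndepFun (fun ω => (∑ j ∈ s, Z j ω) ^ k) (fun ω => Z i ω ^ l) μ :=
      (hI s i hi).comp (φ := fun x => x ^ k) (ψ := fun x => x ^ l)
        (measurable_id.pow_const k) (measurable_id.pow_const l)
    have hprod (s : Finset ι) (i : ι) (hi : i ∉ s) (k l : ℕ) :
        Integrable (fun ω => (∑ j ∈ s, Z j ω) ^ k * Z i ω ^ l) μ :=
      (hIk s i hi k l).integrable_mul (integrable_pow_of_memLp (hLS s k))
        (integrable_pow_of_memLp (hL i l))
    have hprod' (s : Finset ι) (i : ι) (hi : i ∉ s) (k l : ℕ) :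
        ∫ ω, (∑ j ∈ s, Z j ω) ^ k * Z i ω ^ l ∂μ
          = (∫ ω, (∑ j ∈ s, Z j ω) ^ k ∂μ) * ∫ ω, Z i ω ^ l ∂μ :=
      (hIk s i hi k l).integral_fun_mul_eq_mul_integral
        (integrable_pow_of_memLp (hLS s k)).aestronglyMeasurable
        (integrable_pow_of_memLp (hL i l)).aestronglyMeasurable
    induction s using Finset.induction_on with
    | empty => simp
    | insert i s hi ihs =>
      have hS := hC μ Z s hL hI hE fun i q hq => hM i q (hq.trans m.le_succ)
      simp only [Finset.sum_insert hi, Finset.card_insert_of_notMem hi]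
      have h1 := integrable_pow_of_memLp (hLS s (2 * (m + 1)))
      have h2 : Integrable (fun ω => (∑ j ∈ s, Z j ω) ^ (2 * m + 1) * Z i ω) μ := by
        simpa using hprod s i hi (2 * m + 1) 1
      have h3 := hprod s i hi (2 * m) 2
      have h4 := integrable_pow_of_memLp (hL i (2 * (m + 1)))
      have e2 : ∫ ω, (∑ j ∈ s, Z j ω) ^ (2 * m + 1) * Z i ω ∂μ = 0 := by
        simpa [hE i] using hprod' s i hi (2 * m + 1) 1
      have e3 : ∫ ω, (∑ j ∈ s, Z j ω) ^ (2 * m) * Z i ω ^ 2 ∂μ ≤ C * (s.card : ℝ) ^ m * c := by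
        rw [hprod' s i hi (2 * m) 2]
        refine mul_le_mul hS (hM i 1 (by omega)) (integral_nonneg fun ω => sq_nonneg _)
          (by positivity)
      have e4 := hM i (m + 1) le_rfl
      calc ∫ ω, (Z i ω + ∑ j ∈ s, Z j ω) ^ (2 * (m + 1)) ∂μ
          ≤ ∫ ω, ((∑ j ∈ s, Z j ω) ^ (2 * (m + 1))
            + (2 * (m + 1) : ℕ) * ((∑ j ∈ s, Z j ω) ^ (2 * m + 1) * Z i ω)
            + D * ((∑ j ∈ s, Z j ω) ^ (2 * m) * Z i ω ^ 2 + Z i ω ^ (2 * (m + 1)))) ∂μ := by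
            refine integral_mono ?_ ((h1.add (h2.const_mul _)).add ((h3.add h4).const_mul D))
              fun ω => ?_
            · have := integrable_pow_of_memLp (hLS (insert i s) (2 * (m + 1)))
              simpa only [Finset.sum_insert hi] using this
            · rw [add_comm (Z i ω)]
              exact hD _ _
        _ = ∫ ω, (∑ j ∈ s, Z j ω) ^ (2 * (m + 1)) ∂μ
            + (2 * (m + 1) : ℕ) * ∫ ω, (∑ j ∈ s, Z j ω) ^ (2 * m + 1) * Z i ω ∂μ
            + D * (∫ ω, (∑ j ∈ s, Z j ω) ^ (2 * m) * Z i ω ^ 2 ∂μ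
              + ∫ ω, Z i ω ^ (2 * (m + 1)) ∂μ) := by
            have h12 : Integrable (fun ω => (∑ j ∈ s, Z j ω) ^ (2 * (m + 1))
                + (2 * (m + 1) : ℕ) * ((∑ j ∈ s, Z j ω) ^ (2 * m + 1) * Z i ω)) μ :=
              h1.add (h2.const_mul _)
            have h34 : Integrable (fun ω => D * ((∑ j ∈ s, Z j ω) ^ (2 * m) * Z i ω ^ 2
                + Z i ω ^ (2 * (m + 1)))) μ := (h3.add h4).const_mul D
            rw [integral_add h12 h34, integral_add h1 (h2.const_mul _), integral_const_mul,
              integral_const_mul, integral_add h3 h4]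
        _ ≤ D * (c * (C + 1)) * (s.card : ℝ) ^ (m + 1) + (2 * (m + 1) : ℕ) * 0
            + D * (C * (s.card : ℝ) ^ m * c + c) := by
            rw [e2]; gcongr
        _ ≤ D * (c * (C + 1)) * ((s.card + 1 : ℕ) : ℝ) ^ (m + 1) := by
            push_cast
            have f1 : (s.card : ℝ) ^ m ≤ ((s.card : ℝ) + 1) ^ m := by gcongr; linarith
            have f2 : (1 : ℝ) ≤ ((s.card : ℝ) + 1) ^ m := one_le_pow₀ (by linarith)
            have f3 : (s.card : ℝ) ^ (m + 1) ≤ s.card * ((s.card : ℝ) + 1) ^ m := by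
              rw [pow_succ, mul_comm]; gcongr
            have f4 : C * (s.card : ℝ) ^ m * c + c ≤ c * (C + 1) * ((s.card : ℝ) + 1) ^ m := by
              have : 0 ≤ C * c := by positivity
              nlinarith [mul_le_mul_of_nonneg_left f1 this, mul_le_mul_of_nonneg_left f2 hc]
            calc _ ≤ D * (c * (C + 1)) * (s.card * ((s.card : ℝ) + 1) ^ m)
                  + (2 * (m + 1)) * 0 + D * (c * (C + 1) * ((s.card : ℝ) + 1) ^ m) := by gcongr
              _ = _ := by ring

theorem one_add_pow_le {a : ℝ} (ha : 0 ≤ a) (q : ℕ) :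
    (1 + a) ^ q ≤ 4 ^ q * (1 + a ^ (2 * q)) := by
  rcases le_total a 1 with h | h
  · calc (1 + a) ^ q ≤ 4 ^ q := by gcongr; linarith
      _ ≤ _ := le_mul_of_one_le_right (by positivity) (by linarith [pow_nonneg ha (2 * q)])
  · calc (1 + a) ^ q ≤ (4 * a ^ 2) ^ q := by gcongr; nlinarith
      _ = 4 ^ q * a ^ (2 * q) := by rw [mul_pow, ← pow_mul]
      _ ≤ _ := by gcongr; linarith

theorem sum_pow_le_card_pow_mul {ι : Type*} [Fintype ι] (a : ι → ℝ) (ha : ∀ i, 0 ≤ a i) (k : ℕ)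
    (hk : k ≠ 0) : (∑ i, a i) ^ k ≤ (Fintype.card ι : ℝ) ^ k * ∑ i, a i ^ k := by
  rcases isEmpty_or_nonempty ι with h | h
  · simp [hk]
  obtain ⟨i, -, hi⟩ := Finset.exists_max_image Finset.univ a Finset.univ_nonempty
  calc (∑ j, a j) ^ k ≤ (∑ _j : ι, a i) ^ k := by
        gcongr with j
        · exact Finset.sum_nonneg fun j _ => ha j
        · exact hi j (Finset.mem_univ j)
    _ = (Fintype.card ι : ℝ) ^ k * a i ^ k := by simp [mul_pow]
    _ ≤ _ := by
        gcongr
        exact Finset.single_le_sum (f := fun i => a i ^ k) (fun j _ => pow_nonneg (ha j) _)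
          (Finset.mem_univ i)

theorem moment_one_add_le [IsProbabilityMeasure μ] {f : Ω → ℝ} (hf : 0 ≤ f) (hm : Measurable f)
    {q : ℕ} {C : ℝ} (hi : Integrable (fun ω => f ω ^ (2 * q)) μ)
    (hC : ∫ ω, f ω ^ (2 * q) ∂μ ≤ C) :
    Integrable (fun ω => (1 + f ω) ^ q) μ ∧ ∫ ω, (1 + f ω) ^ q ∂μ ≤ 4 ^ q * (1 + C) := by
  have hb : Integrable (fun ω => (4 : ℝ) ^ q * (1 + f ω ^ (2 * q))) μ :=
    ((integrable_const 1).add hi).const_mul _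
  have hint : Integrable (fun ω => (1 + f ω) ^ q) μ := by
    refine hb.mono' (by fun_prop) (Filter.Eventually.of_forall fun ω => ?_)
    have := hf ω
    rw [Real.norm_of_nonneg (pow_nonneg (add_nonneg zero_le_one this) _)]
    exact one_add_pow_le this q
  refine ⟨hint, (integral_mono hint hb fun ω => one_add_pow_le (hf ω) q).trans ?_⟩
  rw [integral_const_mul, integral_add (integrable_const 1) hi]
  simp only [integral_const, probReal_univ, smul_eq_mul, mul_one]
  gcongr

theorem moment_one_add_sum_le [IsProbabilityMeasure μ] {ι : Type*} [Fintype ι] {f : ι → Ω → ℝ}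
    (hm : ∀ i, Measurable (f i)) {q : ℕ} {C : ℝ}
    (hi : ∀ i, Integrable (fun ω => f i ω ^ (2 * q)) μ)
    (hC : ∀ i, ∫ ω, f i ω ^ (2 * q) ∂μ ≤ C) :
    Integrable (fun ω => (1 + ∑ i, |f i ω|) ^ q) μ ∧ ∫ ω, (1 + ∑ i, |f i ω|) ^ q ∂μ
      ≤ 4 ^ q * (1 + (1 + (Fintype.card ι : ℝ) ^ (2 * q) * (Fintype.card ι * C))) := by
  have hs : Measurable fun ω => ∑ i, |f i ω| := Finset.measurable_sum _ fun i _ => (hm i).abs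
  have hb : Integrable (fun ω => 1 + (Fintype.card ι : ℝ) ^ (2 * q) * ∑ i, f i ω ^ (2 * q)) μ :=
    (integrable_const 1).add ((integrable_finsetSum _ fun i _ => hi i).const_mul _)
  have hle (ω : Ω) : (∑ i, |f i ω|) ^ (2 * q)
      ≤ 1 + (Fintype.card ι : ℝ) ^ (2 * q) * ∑ i, f i ω ^ (2 * q) := by
    have hnn : 0 ≤ (Fintype.card ι : ℝ) ^ (2 * q) * ∑ i, f i ω ^ (2 * q) :=
      mul_nonneg (by positivity) (Finset.sum_nonneg fun i _ => (even_two_mul q).pow_nonneg _)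
    rcases Nat.eq_zero_or_pos q with rfl | hq
    · simp only [mul_zero, pow_zero] at hnn ⊢
      linarith
    · refine (sum_pow_le_card_pow_mul (fun i => |f i ω|) (fun i => abs_nonneg _) (2 * q)
        (by omega)).trans ?_
      simp only [(even_two_mul q).pow_abs]
      linarith
  have hint : Integrable (fun ω => (∑ i, |f i ω|) ^ (2 * q)) μ := by
    refine hb.mono' (by fun_prop) (Filter.Eventually.of_forall fun ω => ?_)
    rw [Real.norm_of_nonneg ((even_two_mul q).pow_nonneg _)]
    exact hle ω
  refine moment_one_add_le (fun ω => Finset.sum_nonneg fun i _ => abs_nonneg _) hs hint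
    ((integral_mono hint hb hle).trans ?_)
  rw [integral_add (integrable_const 1)
    ((integrable_finsetSum _ fun i _ => hi i).const_mul _), integral_const_mul,
    integral_finsetSum _ fun i _ => hi i]
  simp only [integral_const, probReal_univ, smul_eq_mul, mul_one]
  gcongr
  calc ∑ i, ∫ ω, f i ω ^ (2 * q) ∂μ ≤ ∑ _i : ι, C := Finset.sum_le_sum fun i _ => hC i
    _ = _ := by simp

end SumMoments

/-! ### The Gaussian law of the parameters at initialization -/

section InitLaw

variable {n₀ n₁ : ℕ}

theorem initLaw_eq_stdGaussian (n₀ n₁ : ℕ) : initLaw n₀ n₁ = stdGaussian (Params n₀ n₁) :=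
  map_pi_eq_stdGaussian

instance isProbabilityMeasure_initLaw : IsProbabilityMeasure (initLaw n₀ n₁) := by
  rw [initLaw_eq_stdGaussian]; infer_instance

theorem measurePreserving_coord (c : (Fin n₀ × Fin n₁) ⊕ Fin n₁) :
    MeasurePreserving (fun θ : Params n₀ n₁ => θ c) (initLaw n₀ n₁) (gaussianReal 0 1) := by
  rw [initLaw_eq_stdGaussian, ← multivariateGaussian_zero_one]
  simpa using measurePreserving_eval_multivariateGaussian
    (μ := (0 : Params n₀ n₁)) (S := 1) Matrix.PosSemidef.one (i := c)

theorem iIndepFun_coord :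
    iIndepFun (fun (c : (Fin n₀ × Fin n₁) ⊕ Fin n₁) (θ : Params n₀ n₁) => θ c)
      (initLaw n₀ n₁) := by
  rw [iIndepFun_iff_map_fun_eq_pi_map (fun c => (by fun_prop))]
  simp_rw [(measurePreserving_coord _).map_eq]
  rw [initLaw, Measure.map_map (by fun_prop) (by fun_prop)]
  exact Measure.map_id

theorem indepFun_of_disjoint_coord {β γ : Type*} [MeasurableSpace β] [MeasurableSpace γ]
    {F : Params n₀ n₁ → β} {G : Params n₀ n₁ → γ} (hF : Measurable F) (hG : Measurable G)
    (S T : Finset ((Fin n₀ × Fin n₁) ⊕ Fin n₁)) (hST : Disjoint S T)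
    (hFS : ∀ θ θ' : Params n₀ n₁, (∀ c ∈ S, θ c = θ' c) → F θ = F θ')
    (hGT : ∀ θ θ' : Params n₀ n₁, (∀ c ∈ T, θ c = θ' c) → G θ = G θ') :
    IndepFun F G (initLaw n₀ n₁) := by
  classical
  -- Extension by zero lets a function of the coordinates in `S` factor measurably through them.
  let ext (S : Finset ((Fin n₀ × Fin n₁) ⊕ Fin n₁)) (r : S → ℝ) : Params n₀ n₁ :=
    WithLp.toLp 2 fun c => if h : c ∈ S then r ⟨c, h⟩ else 0
  have hext (S) : Measurable (ext S) := by
    refine (WithLp.measurable_toLp 2 _).comp (measurable_pi_lambda _ fun c => ?_)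
    by_cases h : c ∈ S
    · simpa [h] using measurable_pi_apply _
    · simp [h]
  have h := (iIndepFun_coord (n₀ := n₀) (n₁ := n₁)).indepFun_finset S T hST
    (fun c => by fun_prop)
  have h2 := h.comp (φ := fun r => F (ext S r)) (ψ := fun r => G (ext T r))
    (hF.comp (hext S)) (hG.comp (hext T))
  convert h2 using 1
  · ext θ
    exact hFS _ _ fun c hc => by simp [ext, hc]
  · ext θ
    exact hGT _ _ fun c hc => by simp [ext, hc]

/-- `F` only depends on the weights of the `j`-th hidden neuron. -/
def DependsOnNeuron {β : Type*} (j : Fin n₁) (F : Params n₀ n₁ → β) : Prop :=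
  ∀ θ θ' : Params n₀ n₁, (∀ i, θ (Sum.inl (i, j)) = θ' (Sum.inl (i, j))) →
    θ (Sum.inr j) = θ' (Sum.inr j) → F θ = F θ'

theorem indepFun_sum_neurons {Z : Fin n₁ → Params n₀ n₁ → ℝ} (hm : ∀ j, Measurable (Z j))
    (hd : ∀ j, DependsOnNeuron j (Z j)) (s : Finset (Fin n₁)) (j : Fin n₁) (hj : j ∉ s) :
    IndepFun (fun θ => ∑ l ∈ s, Z l θ) (Z j) (initLaw n₀ n₁) := by
  classical
  let col (c : (Fin n₀ × Fin n₁) ⊕ Fin n₁) : Fin n₁ := Sum.elim Prod.snd id c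
  refine indepFun_of_disjoint_coord (Finset.measurable_sum _ fun i _ => hm i) (hm j)
    (Finset.univ.filter fun c => col c ∈ s) (Finset.univ.filter fun c => col c = j) ?_ ?_ ?_
  · rw [Finset.disjoint_filter]
    rintro c - h1 rfl
    exact hj h1
  · intro θ θ' h
    refine Finset.sum_congr rfl fun l hl => hd l θ θ' (fun i => h _ ?_) (h _ ?_) <;> simpa [col]
  · intro θ θ' h
    refine hd j θ θ' (fun i => h _ ?_) (h _ ?_) <;> simp [col]

theorem preact_congr {j : Fin n₁} {θ θ' : Params n₀ n₁}
    (h : ∀ i, θ (Sum.inl (i, j)) = θ' (Sum.inl (i, j))) (x : EuclideanSpace ℝ (Fin n₀)) :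
    preact x θ j = preact x θ' j := by
  simp [preact, h]

theorem continuous_preact (x : EuclideanSpace ℝ (Fin n₀)) (j : Fin n₁) :
    Continuous fun θ : Params n₀ n₁ => preact x θ j := by
  unfold preact; fun_prop

theorem indepFun_preact_outer {β : Type*} [MeasurableSpace β] {F : Params n₀ n₁ → β}
    (hF : Measurable F) (j : Fin n₁)
    (hd : ∀ θ θ' : Params n₀ n₁, (∀ i, θ (Sum.inl (i, j)) = θ' (Sum.inl (i, j))) → F θ = F θ') :
    IndepFun F (fun θ => θ (Sum.inr j)) (initLaw n₀ n₁) := by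
  classical
  refine indepFun_of_disjoint_coord hF (by fun_prop)
    (Finset.univ.filter fun c => c ≠ Sum.inr j) {Sum.inr j} ?_ ?_ ?_
  · rw [Finset.disjoint_singleton_right]; simp
  · intro θ θ' h
    exact hd θ θ' fun i => h _ (by simp)
  · intro θ θ' h
    exact h _ (by simp)

theorem inputKernel_comm (x x' : EuclideanSpace ℝ (Fin n₀)) :
    inputKernel x x' = inputKernel x' x := by
  rw [inputKernel, inputKernel, real_inner_comm]

/-- Exhibits the input covariance as a Gram matrix: this gives both its positivity and the law of a
pair of preactivations. -/
theorem norm_sq_colComb_add (x x' : EuclideanSpace ℝ (Fin n₀)) (j : Fin n₁)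
    (t : EuclideanSpace ℝ (Fin 2)) :
    ‖colComb x (Pi.single j (t 0)) 0 + colComb x' (Pi.single j (t 1)) 0‖ ^ 2
      = t ⬝ᵥ inputCov x x' *ᵥ t := by
  rw [← real_inner_self_eq_norm_sq]
  simp only [inner_add_left, inner_add_right, inner_colComb_colComb]
  simp [Pi.single_apply, inputCov, Matrix.mulVec, dotProduct, Fin.sum_univ_two]
  rw [inputKernel_comm x' x]
  ring

theorem posSemidef_inputCov (x x' : EuclideanSpace ℝ (Fin n₀)) : (inputCov x x').PosSemidef := by
  refine Matrix.PosSemidef.of_dotProduct_mulVec_nonneg ?_ fun t => ?_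
  · ext i k
    fin_cases i <;> fin_cases k <;> simp [inputCov, inputKernel_comm x' x]
  · have := norm_sq_colComb_add (n₁ := 1) x x' 0 (WithLp.toLp 2 t)
    simp only [star_trivial]
    rw [← this]
    positivity

/-- Preactivations are linear in the Gaussian parameters, so the characteristic functions agree. -/
theorem measurePreserving_preact_pair (x x' : EuclideanSpace ℝ (Fin n₀)) (j : Fin n₁) :
    MeasurePreserving (fun θ : Params n₀ n₁ =>
      (WithLp.toLp 2 ![preact x θ j, preact x' θ j] : EuclideanSpace ℝ (Fin 2)))
      (initLaw n₀ n₁) (multivariateGaussian 0 (inputCov x x')) := by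
  have hc : Continuous (fun θ : Params n₀ n₁ =>
      (WithLp.toLp 2 ![preact x θ j, preact x' θ j] : EuclideanSpace ℝ (Fin 2))) := by
    have := continuous_preact x j
    have := continuous_preact x' j
    refine (PiLp.continuous_toLp 2 _).comp (continuous_pi fun i => ?_)
    fin_cases i <;> simpa
  refine ⟨hc.measurable, ?_⟩
  have : IsProbabilityMeasure ((initLaw n₀ n₁).map fun θ : Params n₀ n₁ =>
      (WithLp.toLp 2 ![preact x θ j, preact x' θ j] : EuclideanSpace ℝ (Fin 2))) :=
    Measure.isProbabilityMeasure_map hc.measurable.aemeasurable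
  refine Measure.ext_of_charFun ?_
  ext t
  rw [charFun_multivariateGaussian (posSemidef_inputCov x x'), charFun_apply,
    integral_map hc.measurable.aemeasurable (by fun_prop), initLaw_eq_stdGaussian]
  have h1 (θ : Params n₀ n₁) :
      inner ℝ (WithLp.toLp 2 ![preact x θ j, preact x' θ j] : EuclideanSpace ℝ (Fin 2)) t
      = inner ℝ θ (colComb x (Pi.single j (t 0)) 0 + colComb x' (Pi.single j (t 1)) 0) := by
    rw [inner_add_right, real_inner_comm, real_inner_comm _ θ, real_inner_comm _ θ, inner_colComb,
      inner_colComb]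
    simp [PiLp.inner_apply, Fin.sum_univ_two, Pi.single_apply]
    ring
  simp_rw [h1]
  rw [← charFun_apply, charFun_stdGaussian, ← Complex.ofReal_pow, norm_sq_colComb_add]
  simp
  ring_nf

theorem integral_preact_pair {ψ : ℝ → ℝ} (hψ : Continuous ψ) (x x' : EuclideanSpace ℝ (Fin n₀))
    (j : Fin n₁) :
    ∫ θ, ψ (preact x θ j) * ψ (preact x' θ j) ∂(initLaw n₀ n₁) = gaussPair ψ x x' := by
  rw [gaussPair, ← (measurePreserving_preact_pair x x' j).map_eq,
    integral_map (measurePreserving_preact_pair x x' j).measurable.aemeasurable]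
  · simp
  · exact Continuous.aestronglyMeasurable (by fun_prop)

/-- The even moments of the standard Gaussian distribution. -/
noncomputable def gaussMoment (q : ℕ) : ℝ := ∫ x, x ^ (2 * q) ∂(gaussianReal 0 1)

theorem gaussMoment_nonneg (q : ℕ) : 0 ≤ gaussMoment q :=
  integral_nonneg fun x => (even_two_mul q).pow_nonneg x

theorem memLp_coord (c : (Fin n₀ × Fin n₁) ⊕ Fin n₁) (q : ℕ) :
    MemLp (fun θ : Params n₀ n₁ => θ c) q (initLaw n₀ n₁) :=
  (memLp_id_gaussianReal' (q : ℝ≥0∞) (by simp)).comp_measurePreserving (measurePreserving_coord c)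

theorem integral_coord_pow (c : (Fin n₀ × Fin n₁) ⊕ Fin n₁) (q : ℕ) :
    ∫ θ, θ c ^ (2 * q) ∂(initLaw n₀ n₁) = gaussMoment q := by
  rw [gaussMoment, ← (measurePreserving_coord c).map_eq,
    integral_map (measurePreserving_coord c).measurable.aemeasurable (by fun_prop)]

theorem integral_coord (c : (Fin n₀ × Fin n₁) ⊕ Fin n₁) : ∫ θ, θ c ∂(initLaw n₀ n₁) = 0 := by
  have h : ∫ x, x ∂((initLaw n₀ n₁).map fun θ => θ c) = ∫ θ, θ c ∂(initLaw n₀ n₁) :=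
    integral_map (measurePreserving_coord c).measurable.aemeasurable (by fun_prop)
  rw [← h, (measurePreserving_coord c).map_eq, integral_id_gaussianReal]

theorem integral_coord_sq (c : (Fin n₀ × Fin n₁) ⊕ Fin n₁) :
    ∫ θ, θ c ^ 2 ∂(initLaw n₀ n₁) = 1 := by
  have h := variance_of_integral_eq_zero (measurePreserving_coord c).measurable.aemeasurable
    (integral_coord c)
  rw [← h]
  have := (measurePreserving_coord (n₀ := n₀) (n₁ := n₁) c).variance_fun_comp (f := id)
    aemeasurable_id
  simpa [variance_id_gaussianReal] using this

/-- Moments of normalized sums of centred functions of the single neurons. -/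
theorem exists_moment_sum_neurons_le (p : ℕ) (c : ℝ) (hc : 0 ≤ c) : ∃ C : ℝ, 0 ≤ C ∧
    ∀ {n₀ n₁ : ℕ}, 0 < n₁ → ∀ (Z : Fin n₁ → Params n₀ n₁ → ℝ), (∀ j, Measurable (Z j)) →
      (∀ j, DependsOnNeuron j (Z j)) → (∀ j, ∀ q : ℕ, MemLp (Z j) q (initLaw n₀ n₁)) →
      (∀ j, ∫ θ, Z j θ ∂(initLaw n₀ n₁) = 0) →
      (∀ j, ∀ q ≤ p, ∫ θ, Z j θ ^ (2 * q) ∂(initLaw n₀ n₁) ≤ c) →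
      Integrable (fun θ => (1 / √(n₁ : ℝ) * ∑ j, Z j θ) ^ (2 * p)) (initLaw n₀ n₁) ∧
      ∫ θ, (1 / √(n₁ : ℝ) * ∑ j, Z j θ) ^ (2 * p) ∂(initLaw n₀ n₁) ≤ C := by
  obtain ⟨C, hC0, hC⟩ := exists_integral_sum_pow_le p c hc
  refine ⟨C, hC0, fun {n₀ n₁} h₁ Z hm hd hL hE hM => ?_⟩
  have hn : (0 : ℝ) < n₁ := by exact_mod_cast h₁
  have h := hC (initLaw n₀ n₁) Z Finset.univ hL (indepFun_sum_neurons hm hd) hE hM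
  have hpow : (1 / √(n₁ : ℝ)) ^ (2 * p) = 1 / (n₁ : ℝ) ^ p := by
    rw [pow_mul, div_pow, one_pow, Real.sq_sqrt hn.le, div_pow, one_pow]
  simp_rw [mul_pow, hpow]
  refine ⟨(integrable_pow_of_memLp (memLp_finsetSum _ fun j _ => hL j _)).const_mul _, ?_⟩
  rw [integral_const_mul]
  calc 1 / (n₁ : ℝ) ^ p * ∫ θ, (∑ j, Z j θ) ^ (2 * p) ∂(initLaw n₀ n₁)
      ≤ 1 / (n₁ : ℝ) ^ p * (C * (n₁ : ℝ) ^ p) := by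
        gcongr; simpa using h
    _ = C := by field_simp

end InitLaw

/-! ### Moments of the network, its kernel and the outer weights at initialization -/

section InitMoments

theorem BoundedActivation.continuous {Φ : ℝ → ℝ} {A : ℝ} (hΦ : BoundedActivation Φ A) :
    Continuous Φ := hΦ.differentiable.continuous

theorem BoundedActivation.continuous_deriv {Φ : ℝ → ℝ} {A : ℝ} (hΦ : BoundedActivation Φ A) :
    Continuous (deriv Φ) := by
  have hA : 0 ≤ A := zero_le_one.trans hΦ.one_le
  refine (LipschitzWith.of_dist_le_mul (K := ⟨A, hA⟩) fun a b => ?_).continuous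
  rw [Real.dist_eq, Real.dist_eq]
  exact hΦ.lipschitz_deriv a b

/-- Produces the single constant valid for all `q ≤ p` that the moment bound for sums requires. -/
theorem moment_le_sum_gaussMoment {p q : ℕ} (hq : q ≤ p) {K : ℝ} (hK : 1 ≤ K) (m : ℕ → ℕ) :
    K ^ (2 * q) * (1 + gaussMoment (m q))
      ≤ K ^ (2 * p) * ∑ k ∈ Finset.range (p + 1), (1 + gaussMoment (m k)) := by
  have h0 (k) : 0 ≤ 1 + gaussMoment (m k) := by linarith [gaussMoment_nonneg (m k)]
  have h1 : 1 + gaussMoment (m q) ≤ ∑ k ∈ Finset.range (p + 1), (1 + gaussMoment (m k)) :=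
    Finset.single_le_sum (f := fun k => 1 + gaussMoment (m k)) (fun k _ => h0 k)
      (Finset.mem_range.2 (Nat.lt_succ_of_le hq))
  have h2 : K ^ (2 * q) ≤ K ^ (2 * p) := pow_le_pow_right₀ hK (by omega)
  exact mul_le_mul h2 h1 (h0 q) (by positivity)

/-- A neuron's contribution is centred because its outer weight is centred and independent of its
preactivation; boundedness of `Φ` makes the moments uniform in the input and the widths. -/
theorem exists_moment_network_le (A : ℝ) (p : ℕ) : ∃ C : ℝ, 0 ≤ C ∧
    ∀ {Φ : ℝ → ℝ}, BoundedActivation Φ A → ∀ {n₀ n₁ : ℕ}, 0 < n₁ →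
      ∀ x : EuclideanSpace ℝ (Fin n₀),
      Integrable (fun θ : Params n₀ n₁ => network Φ x θ ^ (2 * p)) (initLaw n₀ n₁) ∧
      ∫ θ, network Φ x θ ^ (2 * p) ∂(initLaw n₀ n₁) ≤ C := by
  rcases lt_or_ge A 1 with hA1 | hA1
  · exact ⟨0, le_rfl, fun h => absurd h.one_le (not_le.2 hA1)⟩
  obtain ⟨C, hC0, hC⟩ := exists_moment_sum_neurons_le p
    (A ^ (2 * p) * ∑ k ∈ Finset.range (p + 1), (1 + gaussMoment (id k)))
    (mul_nonneg (by positivity) (Finset.sum_nonneg fun k _ => by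
      linarith [gaussMoment_nonneg (id k)]))
  refine ⟨C, hC0, fun {Φ} hΦ {n₀ n₁} h₁ x => ?_⟩
  have hΦc := hΦ.continuous
  have hpc := continuous_preact (n₁ := n₁) x
  have hZc (j : Fin n₁) : Continuous fun θ : Params n₀ n₁ =>
      Φ (preact x θ j) * θ (Sum.inr j) := by
    have := hpc j
    fun_prop
  refine hC h₁ (fun j θ => Φ (preact x θ j) * θ (Sum.inr j)) (fun j => (hZc j).measurable)
    (fun j θ θ' h h' => ?_) (fun j q => ?_) (fun j => ?_) (fun j q hq => ?_)
  · simp only [preact_congr h, h']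
  · refine MemLp.of_le_mul (c := A) (memLp_coord (Sum.inr j) q) (hZc j).aestronglyMeasurable
      (Filter.Eventually.of_forall fun θ => ?_)
    rw [norm_mul]
    gcongr
    exact hΦ.abs_le _
  · have hpj := hpc j
    have hm : Continuous fun θ : Params n₀ n₁ => Φ (preact x θ j) := by fun_prop
    have hi : IndepFun (fun θ : Params n₀ n₁ => Φ (preact x θ j))
        (fun θ => θ (Sum.inr j)) (initLaw n₀ n₁) :=
      indepFun_preact_outer hm.measurable j fun θ θ' h => by simp only [preact_congr h]
    rw [hi.integral_fun_mul_eq_mul_integral hm.aestronglyMeasurable (by fun_prop),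
      integral_coord, mul_zero]
  · refine le_trans ?_ (moment_le_sum_gaussMoment hq hA1 id)
    have hb := integrable_pow_of_memLp (memLp_coord (n₀ := n₀) (Sum.inr j) (2 * q))
    calc ∫ θ, (Φ (preact x θ j) * θ (Sum.inr j)) ^ (2 * q) ∂(initLaw n₀ n₁)
        ≤ ∫ θ : Params n₀ n₁, A ^ (2 * q) * θ (Sum.inr j) ^ (2 * q) ∂(initLaw n₀ n₁) := by
          refine integral_mono_of_nonneg (Filter.Eventually.of_forall fun θ =>
            (even_two_mul q).pow_nonneg _) (hb.const_mul _)
            (Filter.Eventually.of_forall fun θ => ?_)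
          simp only
          rw [mul_pow]
          refine mul_le_mul_of_nonneg_right ?_ ((even_two_mul q).pow_nonneg _)
          rw [← (even_two_mul q).pow_abs]
          gcongr
          exact hΦ.abs_le _
      _ ≤ A ^ (2 * q) * (1 + gaussMoment (id q)) := by
          rw [integral_const_mul, integral_coord_pow]
          gcongr
          simp

theorem abs_inputKernel_le {A : ℝ} {n₀ : ℕ} {x x' : EuclideanSpace ℝ (Fin n₀)} (hx : ‖x‖ ≤ A)
    (hx' : ‖x'‖ ≤ A) : |inputKernel x x'| ≤ A ^ 2 := by
  have hA : 0 ≤ A := (norm_nonneg _).trans hx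
  rw [inputKernel, abs_mul]
  have h1 : |1 / (n₀ : ℝ)| ≤ 1 := by
    rw [abs_of_nonneg (by positivity)]
    rcases Nat.eq_zero_or_pos n₀ with rfl | h
    · simp
    · rw [div_le_one (by positivity)]
      exact_mod_cast h
  have h2 : |inner ℝ x x'| ≤ A * A := (abs_real_inner_le_norm x x').trans (by gcongr)
  calc _ ≤ 1 * (A * A) := by gcongr
    _ = A ^ 2 := by ring

theorem abs_gaussPair_le {ψ : ℝ → ℝ} {A : ℝ} (hψ : ∀ z, |ψ z| ≤ A) {n₀ : ℕ}
    (x x' : EuclideanSpace ℝ (Fin n₀)) : |gaussPair ψ x x'| ≤ A ^ 2 := by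
  have hA : 0 ≤ A := (abs_nonneg _).trans (hψ 0)
  rw [gaussPair, ← Real.norm_eq_abs]
  have := norm_integral_le_of_norm_le_const (μ := multivariateGaussian 0 (inputCov x x'))
    (f := fun w => ψ (w 0) * ψ (w 1)) (C := A ^ 2) (Filter.Eventually.of_forall fun w => by
      rw [norm_mul, sq]
      exact mul_le_mul (hψ _) (hψ _) (norm_nonneg _) hA)
  simpa using this

theorem abs_ntkLimit_le {Φ : ℝ → ℝ} {A : ℝ} (hΦ : BoundedActivation Φ A) {n₀ : ℕ}
    {x x' : EuclideanSpace ℝ (Fin n₀)} (hx : ‖x‖ ≤ A) (hx' : ‖x'‖ ≤ A) :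
    |ntkLimit Φ x x'| ≤ 2 * A ^ 4 := by
  have hA := hΦ.one_le
  rw [ntkLimit]
  refine (abs_add_le _ _).trans ?_
  rw [abs_mul]
  have h1 := abs_gaussPair_le hΦ.abs_le x x'
  have h2 := abs_gaussPair_le hΦ.abs_deriv_le x x'
  have h3 := abs_inputKernel_le hx hx'
  calc _ ≤ A ^ 2 + A ^ 2 * A ^ 2 := by gcongr
    _ ≤ _ := by nlinarith [one_le_pow₀ (n := 2) hA]

theorem continuous_netGrad {Φ : ℝ → ℝ} {A : ℝ} (hΦ : BoundedActivation Φ A) {n₀ n₁ : ℕ}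
    (x : EuclideanSpace ℝ (Fin n₀)) :
    Continuous (netGrad Φ x : Params n₀ n₁ → Params n₀ n₁) := by
  have h1 := hΦ.continuous
  have h2 := hΦ.continuous_deriv
  have h3 := continuous_preact (n₁ := n₁) x
  unfold netGrad colComb
  refine (PiLp.continuous_toLp 2 _).comp (continuous_pi fun c => ?_)
  rcases c with c | j
  · have := h3 c.2
    simp only [Sum.elim_inl]
    fun_prop
  · have := h3 j
    simp only [Sum.elim_inr]
    fun_prop

/-- The rescaled deviation of the empirical neural tangent kernel from its limit. -/
noncomputable def kernelDev (Φ : ℝ → ℝ) {n₀ n₁ : ℕ} (x x' : EuclideanSpace ℝ (Fin n₀))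
    (θ : Params n₀ n₁) : ℝ :=
  √(n₁ : ℝ) * (inner ℝ (netGrad Φ x θ) (netGrad Φ x' θ) - ntkLimit Φ x x')

theorem kernelDev_eq (Φ : ℝ → ℝ) {n₀ n₁ : ℕ} (h₁ : 0 < n₁) (x x' : EuclideanSpace ℝ (Fin n₀))
    (θ : Params n₀ n₁) : kernelDev Φ x x' θ = 1 / √(n₁ : ℝ) * ∑ j,
      (Φ (preact x θ j) * Φ (preact x' θ j) + inputKernel x x' *
        (deriv Φ (preact x θ j) * deriv Φ (preact x' θ j) * θ (Sum.inr j) ^ 2)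
        - ntkLimit Φ x x') := by
  have hn : (0 : ℝ) < n₁ := by exact_mod_cast h₁
  have hs : 1 / √(n₁ : ℝ) * (1 / √(n₁ : ℝ)) = 1 / n₁ := by
    rw [div_mul_div_comm, one_mul, Real.mul_self_sqrt hn.le]
  have h1 : inner ℝ (netGrad Φ x θ) (netGrad Φ x' θ) - ntkLimit Φ x x' = 1 / n₁ * ∑ j,
      (Φ (preact x θ j) * Φ (preact x' θ j) + inputKernel x x' *
        (deriv Φ (preact x θ j) * deriv Φ (preact x' θ j) * θ (Sum.inr j) ^ 2)
        - ntkLimit Φ x x') := by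
    rw [netGrad, netGrad, inner_colComb_colComb, Finset.sum_sub_distrib, Finset.sum_add_distrib,
      mul_sub, mul_add, ← Finset.mul_sum, add_comm]
    congr 1
    · congr 1
      · rw [Finset.mul_sum]
        refine Finset.sum_congr rfl fun j _ => ?_
        rw [← hs]; ring
      · rw [mul_left_comm]
        congr 1
        rw [Finset.mul_sum]
        refine Finset.sum_congr rfl fun j _ => ?_
        rw [← hs]; ring
    · simp
      field_simp
  rw [kernelDev, h1, ← mul_assoc]
  congr 1
  have := Real.sq_sqrt hn.le
  field_simp
  exact this

/-- The empirical kernel is an average over neurons whose mean is exactly the limit kernel, because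
outer weights have unit second moment and are independent of the preactivations. Its fluctuations
are thus of order `n₁^(-1/2)` in every moment. -/
theorem exists_moment_kernelDev_le (A : ℝ) (p : ℕ) : ∃ C : ℝ, 0 ≤ C ∧
    ∀ {Φ : ℝ → ℝ}, BoundedActivation Φ A → ∀ {n₀ n₁ : ℕ}, 0 < n₁ →
      ∀ x x' : EuclideanSpace ℝ (Fin n₀), ‖x‖ ≤ A → ‖x'‖ ≤ A →
      Integrable (fun θ : Params n₀ n₁ => kernelDev Φ x x' θ ^ (2 * p)) (initLaw n₀ n₁) ∧
      ∫ θ, kernelDev Φ x x' θ ^ (2 * p) ∂(initLaw n₀ n₁) ≤ C := by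
  rcases lt_or_ge A 1 with hA1 | hA1
  · exact ⟨0, le_rfl, fun h => absurd h.one_le (not_le.2 hA1)⟩
  have hA0 : 0 ≤ A := zero_le_one.trans hA1
  -- `16 A⁴` is the factor `4 A⁴` of the pointwise bound `hZle` times the `4` of `one_add_pow_le`.
  have hK1 : 1 ≤ 16 * A ^ 4 := by linarith [one_le_pow₀ (n := 4) hA1]
  obtain ⟨C, hC0, hC⟩ := exists_moment_sum_neurons_le p
    ((16 * A ^ 4) ^ (2 * p) * ∑ k ∈ Finset.range (p + 1), (1 + gaussMoment (4 * k)))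
    (mul_nonneg (by positivity) (Finset.sum_nonneg fun k _ => by
      linarith [gaussMoment_nonneg (4 * k)]))
  refine ⟨C, hC0, fun {Φ} hΦ {n₀ n₁} h₁ x x' hx hx' => ?_⟩
  have hΦc := hΦ.continuous
  have hΦc' := hΦ.continuous_deriv
  have hpc := continuous_preact (n₁ := n₁) x
  have hpc' := continuous_preact (n₁ := n₁) x'
  simp_rw [kernelDev_eq Φ h₁]
  set Z : Fin n₁ → Params n₀ n₁ → ℝ := fun j θ =>
    Φ (preact x θ j) * Φ (preact x' θ j) + inputKernel x x' *
        (deriv Φ (preact x θ j) * deriv Φ (preact x' θ j) * θ (Sum.inr j) ^ 2)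
        - ntkLimit Φ x x' with hZ
  have hZc (j : Fin n₁) : Continuous (Z j) := by
    have := hpc j
    have := hpc' j
    fun_prop
  have hZle (j : Fin n₁) (θ : Params n₀ n₁) : |Z j θ| ≤ 4 * A ^ 4 * (1 + θ (Sum.inr j) ^ 2) := by
    have h1 := abs_ntkLimit_le hΦ hx hx'
    have h2 := abs_inputKernel_le hx hx'
    have h3 := hΦ.abs_le (preact x θ j)
    have h4 := hΦ.abs_le (preact x' θ j)
    have h5 := hΦ.abs_deriv_le (preact x θ j)
    have h6 := hΦ.abs_deriv_le (preact x' θ j)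
    have h7 : A * A ≤ A ^ 4 := by nlinarith [one_le_pow₀ (n := 2) hA1]
    calc |Z j θ| ≤ |Φ (preact x θ j) * Φ (preact x' θ j)| + |inputKernel x x' *
          (deriv Φ (preact x θ j) * deriv Φ (preact x' θ j) * θ (Sum.inr j) ^ 2)|
          + |ntkLimit Φ x x'| :=
          (abs_sub _ _).trans (add_le_add_left (abs_add_le _ _) _)
      _ = |Φ (preact x θ j)| * |Φ (preact x' θ j)| + |inputKernel x x'| *
          (|deriv Φ (preact x θ j)| * |deriv Φ (preact x' θ j)| * θ (Sum.inr j) ^ 2)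
          + |ntkLimit Φ x x'| := by simp only [abs_mul, abs_pow, sq_abs]
      _ ≤ A * A + A ^ 2 * (A * A * θ (Sum.inr j) ^ 2) + 2 * A ^ 4 := by gcongr
      _ ≤ _ := by nlinarith [mul_nonneg (pow_nonneg hA0 4) (sq_nonneg (θ (Sum.inr j)))]
  refine hC h₁ Z (fun j => (hZc j).measurable)
    (fun j θ θ' h h' => ?_) (fun j q => ?_) (fun j => ?_) (fun j q hq => ?_)
  · simp only [hZ, preact_congr h, h']
  · have hsq : MemLp (fun θ : Params n₀ n₁ => θ (Sum.inr j) ^ 2) q (initLaw n₀ n₁) := by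
      have h4 := (memLp_coord (n₀ := n₀) (Sum.inr j) (q * 2)).norm_rpow_div 2
      rw [Nat.cast_mul, Nat.cast_ofNat, ENNReal.mul_div_cancel_right two_ne_zero
        ENNReal.ofNat_ne_top] at h4
      simpa using h4
    refine MemLp.of_le_mul (c := 4 * A ^ 4) ((memLp_const (1 : ℝ)).add hsq)
      (hZc j).aestronglyMeasurable (Filter.Eventually.of_forall fun θ => ?_)
    refine (hZle j θ).trans ?_
    gcongr
    exact le_abs_self _
  · have hpj := hpc j
    have hpj' := hpc' j
    have hm : Continuous fun θ : Params n₀ n₁ =>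
      deriv Φ (preact x θ j) * deriv Φ (preact x' θ j) := by fun_prop
    have hm1 : Continuous fun θ : Params n₀ n₁ => Φ (preact x θ j) * Φ (preact x' θ j) := by
      fun_prop
    have hi : IndepFun (fun θ : Params n₀ n₁ => deriv Φ (preact x θ j) * deriv Φ (preact x' θ j))
        (fun θ => θ (Sum.inr j) ^ 2) (initLaw n₀ n₁) :=
      (indepFun_preact_outer hm.measurable j fun θ θ' h => by simp only [preact_congr h]).comp
        measurable_id (measurable_id.pow_const 2)
    have hs := integrable_pow_of_memLp (memLp_coord (n₀ := n₀) (Sum.inr j) 2)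
    have hI1 : Integrable (fun θ : Params n₀ n₁ => Φ (preact x θ j) * Φ (preact x' θ j))
        (initLaw n₀ n₁) :=
      Integrable.of_bound hm1.aestronglyMeasurable (A * A) (Filter.Eventually.of_forall fun θ => by
        rw [norm_mul]
        exact mul_le_mul (hΦ.abs_le _) (hΦ.abs_le _) (norm_nonneg _) hA0)
    have hI2' : Integrable (fun θ : Params n₀ n₁ =>
        deriv Φ (preact x θ j) * deriv Φ (preact x' θ j)) (initLaw n₀ n₁) :=
      Integrable.of_bound hm.aestronglyMeasurable (A * A) (Filter.Eventually.of_forall fun θ => by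
        rw [norm_mul]
        exact mul_le_mul (hΦ.abs_deriv_le _) (hΦ.abs_deriv_le _) (norm_nonneg _) hA0)
    have hI2 : Integrable (fun θ : Params n₀ n₁ => inputKernel x x' *
        (deriv Φ (preact x θ j) * deriv Φ (preact x' θ j) * θ (Sum.inr j) ^ 2)) (initLaw n₀ n₁) :=
      (hi.integrable_mul hI2' hs).const_mul _
    have hI12 : Integrable (fun θ : Params n₀ n₁ => Φ (preact x θ j) * Φ (preact x' θ j)
        + inputKernel x x' * (deriv Φ (preact x θ j) * deriv Φ (preact x' θ j)
          * θ (Sum.inr j) ^ 2)) (initLaw n₀ n₁) := hI1.add hI2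
    rw [hZ, integral_sub hI12 (integrable_const _), integral_add hI1 hI2, integral_const_mul,
      hi.integral_fun_mul_eq_mul_integral hm.aestronglyMeasurable hs.aestronglyMeasurable,
      integral_preact_pair hΦc, integral_preact_pair hΦc', integral_coord_sq]
    simp [ntkLimit]
  · refine le_trans ?_ (moment_le_sum_gaussMoment hq hK1 (4 * ·))
    have hb := integrable_pow_of_memLp (memLp_coord (n₀ := n₀) (Sum.inr j) (2 * (4 * q)))
    have hpw (θ : Params n₀ n₁) : Z j θ ^ (2 * q)
        ≤ (16 * A ^ 4) ^ (2 * q) * (1 + θ (Sum.inr j) ^ (2 * (4 * q))) := by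
      rw [← (even_two_mul q).pow_abs]
      calc |Z j θ| ^ (2 * q) ≤ (4 * A ^ 4 * (1 + θ (Sum.inr j) ^ 2)) ^ (2 * q) := by
            gcongr; exact hZle j θ
        _ = (4 * A ^ 4) ^ (2 * q) * (1 + θ (Sum.inr j) ^ 2) ^ (2 * q) := mul_pow _ _ _
        _ ≤ (4 * A ^ 4) ^ (2 * q) * (4 ^ (2 * q) * (1 + (θ (Sum.inr j) ^ 2) ^ (2 * (2 * q)))) := by
            gcongr; exact one_add_pow_le (sq_nonneg _) _
        _ = _ := by
            rw [← mul_assoc, ← mul_pow, ← pow_mul]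
            congr 2
            · ring
            · congr 2; ring
    calc ∫ θ, Z j θ ^ (2 * q) ∂(initLaw n₀ n₁)
        ≤ ∫ θ : Params n₀ n₁, (16 * A ^ 4) ^ (2 * q) * (1 + θ (Sum.inr j) ^ (2 * (4 * q)))
            ∂(initLaw n₀ n₁) :=
          integral_mono_of_nonneg (Filter.Eventually.of_forall fun θ =>
            (even_two_mul q).pow_nonneg _) (((integrable_const 1).add hb).const_mul _)
            (Filter.Eventually.of_forall hpw)
      _ = _ := by
          rw [integral_const_mul, integral_add (integrable_const 1) hb, integral_coord_pow]
          simp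

variable {n₀ n₁ : ℕ}

theorem continuous_outerMean : Continuous (outerMean : Params n₀ n₁ → ℝ) := by
  unfold outerMean; fun_prop

theorem continuous_outerMax : Continuous (outerMax : Params n₀ n₁ → ℝ) := by
  unfold outerMax; fun_prop

/-- Jensen's inequality for the uniform average over neurons. -/
theorem moment_outerMean_le (h₁ : 0 < n₁) (q : ℕ) :
    Integrable (fun θ : Params n₀ n₁ => (1 + outerMean θ) ^ q) (initLaw n₀ n₁) ∧
      ∫ θ, (1 + outerMean θ) ^ q ∂(initLaw n₀ n₁) ≤ 4 ^ q * (1 + gaussMoment q) := by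
  have hb (j : Fin n₁) := integrable_pow_of_memLp (memLp_coord (n₀ := n₀) (Sum.inr j) (2 * q))
  have hle (θ : Params n₀ n₁) :
      outerMean θ ^ (2 * q) ≤ ∑ j, 1 / (n₁ : ℝ) * θ (Sum.inr j) ^ (2 * q) := by
    rw [pow_mul, outerMean_sq, Finset.mul_sum]
    simp_rw [pow_mul]
    refine Real.pow_arith_mean_le_arith_mean_pow _ _ _ (fun _ _ => by positivity) ?_
      (fun _ _ => sq_nonneg _) q
    simp; field_simp
  have hbs : Integrable (fun θ : Params n₀ n₁ => ∑ j, 1 / (n₁ : ℝ) * θ (Sum.inr j) ^ (2 * q))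
      (initLaw n₀ n₁) := integrable_finsetSum _ fun j _ => (hb j).const_mul _
  have hc := continuous_outerMean (n₀ := n₀) (n₁ := n₁)
  have hint : Integrable (fun θ : Params n₀ n₁ => outerMean θ ^ (2 * q)) (initLaw n₀ n₁) := by
    refine hbs.mono' (by fun_prop) (Filter.Eventually.of_forall fun θ => ?_)
    rw [Real.norm_of_nonneg ((even_two_mul q).pow_nonneg _)]
    exact hle θ
  refine moment_one_add_le outerMean_nonneg hc.measurable hint
    ((integral_mono hint hbs hle).trans (le_of_eq ?_))
  rw [integral_finsetSum _ fun j _ => (hb j).const_mul _]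
  simp_rw [integral_const_mul, integral_coord_pow]
  simp; field_simp

theorem exists_outerMax_eq (h₁ : 0 < n₁) (θ : Params n₀ n₁) :
    ∃ j, outerMax θ = |θ (Sum.inr j)| := by
  have : Nonempty (Fin n₁) := ⟨⟨0, h₁⟩⟩
  obtain ⟨j, -, hj⟩ := Finset.exists_max_image Finset.univ (fun j => |θ (Sum.inr j)|)
    Finset.univ_nonempty
  exact ⟨j, le_antisymm ((pi_norm_le_iff_of_nonneg (abs_nonneg _)).2
    fun i => hj i (Finset.mem_univ i))
    (abs_outer_le θ j)⟩

/-- The maximum is bounded by the sum. The factor `n₁` is affordable in the non-lazy term, where a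
spare power of `n₁` is available. -/
theorem moment_outerMax_le (h₁ : 0 < n₁) (q : ℕ) :
    Integrable (fun θ : Params n₀ n₁ => (1 + outerMax θ) ^ q) (initLaw n₀ n₁) ∧
      ∫ θ, (1 + outerMax θ) ^ q ∂(initLaw n₀ n₁) ≤ 4 ^ q * (1 + gaussMoment q) * n₁ := by
  have hn : (1 : ℝ) ≤ n₁ := by exact_mod_cast h₁
  have hb (j : Fin n₁) := integrable_pow_of_memLp (memLp_coord (n₀ := n₀) (Sum.inr j) (2 * q))
  have hle (θ : Params n₀ n₁) : outerMax θ ^ (2 * q) ≤ ∑ j, θ (Sum.inr j) ^ (2 * q) := by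
    obtain ⟨j, hj⟩ := exists_outerMax_eq h₁ θ
    rw [hj, (even_two_mul q).pow_abs]
    exact Finset.single_le_sum (f := fun j => θ (Sum.inr j) ^ (2 * q))
      (fun j _ => (even_two_mul q).pow_nonneg _) (Finset.mem_univ j)
  have hbs := integrable_finsetSum Finset.univ fun j _ => hb j
  have hc := continuous_outerMax (n₀ := n₀) (n₁ := n₁)
  have hint : Integrable (fun θ : Params n₀ n₁ => outerMax θ ^ (2 * q)) (initLaw n₀ n₁) := by
    refine hbs.mono' (by fun_prop) (Filter.Eventually.of_forall fun θ => ?_)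
    rw [Real.norm_of_nonneg ((even_two_mul q).pow_nonneg _)]
    exact hle θ
  have hI : ∫ θ, outerMax θ ^ (2 * q) ∂(initLaw n₀ n₁) ≤ n₁ * gaussMoment q := by
    refine (integral_mono hint hbs hle).trans (le_of_eq ?_)
    rw [integral_finsetSum _ fun j _ => hb j]
    simp_rw [integral_coord_pow]
    simp
  obtain ⟨h1, h2⟩ := moment_one_add_le outerMax_nonneg hc.measurable hint hI
  refine ⟨h1, h2.trans ?_⟩
  rw [mul_assoc]
  gcongr
  linarith

/-- Used with `s = n₁` and `u` a multiple of the squared maximum: `exp u` is then at most a sum of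
`n₁` terms of bounded mean, which `1 / s` compensates. -/
theorem sq_le_log_sq_add_exp {u s : ℝ} (hu : 0 ≤ u) (hs : 1 ≤ s) :
    u ^ 2 ≤ 2 * Real.log s ^ 2 + 4 * (1 / s * Real.exp u) := by
  have hs0 : 0 < s := by linarith
  have hl := Real.log_nonneg hs
  have he : 1 / s * Real.exp u = Real.exp (u - Real.log s) := by
    rw [Real.exp_sub, Real.exp_log hs0]; ring
  rw [he]
  have hp := Real.exp_pos (u - Real.log s)
  rcases le_total u (Real.log s) with h | h
  · nlinarith
  · have := Real.quadratic_le_exp_of_nonneg (sub_nonneg.2 h)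
    nlinarith [sq_nonneg (2 * Real.log s - u)]

/-- Square-exponential integrability of the Gaussian makes the maximum of `n₁` weights of order
`√(log n₁)`. At `n₁ = 1` the right side would be zero; for `n₁ ≥ 2` the logarithm is at least `1 /
2` and absorbs constants. -/
theorem exists_moment_outerMax_four_le : ∃ C : ℝ, 0 ≤ C ∧ ∀ {n₀ n₁ : ℕ}, 2 ≤ n₁ →
    ∫ θ : Params n₀ n₁, (1 + outerMax θ) ^ 4 ∂(initLaw n₀ n₁) ≤ C * Real.log n₁ ^ 2 := by
  obtain ⟨ε, hε, hexp⟩ := IsGaussian.exists_integrable_exp_sq (gaussianReal 0 1)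
  set e₀ := ∫ x, Real.exp (ε * ‖x‖ ^ 2) ∂(gaussianReal 0 1) with he₀
  have he₀0 : 0 ≤ e₀ := integral_nonneg fun x => (Real.exp_pos _).le
  refine ⟨8 * (4 + (2 + 16 * e₀) / ε ^ 2), by positivity, fun {n₀ n₁} h₂ => ?_⟩
  have h₁ : 0 < n₁ := by omega
  have hn : (2 : ℝ) ≤ n₁ := by exact_mod_cast h₂
  have hlog : 1 / 2 ≤ Real.log n₁ := by
    have h1 := Real.log_le_log two_pos hn
    linarith [Real.log_two_gt_d9]
  have hi (j : Fin n₁) : Integrable (fun θ : Params n₀ n₁ =>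
      Real.exp (ε * ‖θ (Sum.inr j)‖ ^ 2)) (initLaw n₀ n₁) :=
    (measurePreserving_coord (Sum.inr j)).integrable_comp_of_integrable hexp
  have hI (j : Fin n₁) : ∫ θ : Params n₀ n₁, Real.exp (ε * ‖θ (Sum.inr j)‖ ^ 2)
      ∂(initLaw n₀ n₁) = e₀ := by
    rw [he₀, ← (measurePreserving_coord (n₀ := n₀) (Sum.inr j)).map_eq,
      integral_map (measurePreserving_coord _).measurable.aemeasurable (by fun_prop)]
  have hle (θ : Params n₀ n₁) : (1 + outerMax θ) ^ 4 ≤ 8 * (1 + (2 * Real.log n₁ ^ 2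
      + 4 * (1 / n₁ * ∑ j, Real.exp (ε * ‖θ (Sum.inr j)‖ ^ 2))) / ε ^ 2) := by
    obtain ⟨j, hj⟩ := exists_outerMax_eq h₁ θ
    have h1 := sq_le_log_sq_add_exp (u := ε * outerMax θ ^ 2) (s := n₁) (by positivity)
      (by linarith)
    have h2 : Real.exp (ε * outerMax θ ^ 2) ≤ ∑ j, Real.exp (ε * ‖θ (Sum.inr j)‖ ^ 2) := by
      rw [hj, ← Real.norm_eq_abs]
      exact Finset.single_le_sum (f := fun j => Real.exp (ε * ‖θ (Sum.inr j)‖ ^ 2))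
        (fun j _ => (Real.exp_pos _).le) (Finset.mem_univ j)
    have h3 : outerMax θ ^ 4 ≤ (2 * Real.log n₁ ^ 2
        + 4 * (1 / n₁ * ∑ j, Real.exp (ε * ‖θ (Sum.inr j)‖ ^ 2))) / ε ^ 2 := by
      rw [le_div_iff₀ (by positivity)]
      calc outerMax θ ^ 4 * ε ^ 2 = (ε * outerMax θ ^ 2) ^ 2 := by ring
        _ ≤ _ := h1
        _ ≤ _ := by gcongr
    calc (1 + outerMax θ) ^ 4 ≤ 8 * (1 + outerMax θ ^ 4) := by
          nlinarith [sq_nonneg (outerMax θ - 1), sq_nonneg (outerMax θ ^ 2 - 1),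
            sq_nonneg (outerMax θ ^ 2 - outerMax θ)]
      _ ≤ _ := by gcongr
  have hbi := integrable_finsetSum Finset.univ fun j _ => hi j
  have hbi2 : Integrable (fun θ : Params n₀ n₁ =>
      4 * (1 / (n₁ : ℝ) * ∑ j, Real.exp (ε * ‖θ (Sum.inr j)‖ ^ 2))) (initLaw n₀ n₁) :=
    (hbi.const_mul _).const_mul _
  have hbi3 : Integrable (fun θ : Params n₀ n₁ => (2 * Real.log n₁ ^ 2
      + 4 * (1 / n₁ * ∑ j, Real.exp (ε * ‖θ (Sum.inr j)‖ ^ 2))) / ε ^ 2) (initLaw n₀ n₁) :=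
    ((integrable_const _).add hbi2).div_const _
  calc ∫ θ : Params n₀ n₁, (1 + outerMax θ) ^ 4 ∂(initLaw n₀ n₁)
      ≤ ∫ θ : Params n₀ n₁, 8 * (1 + (2 * Real.log n₁ ^ 2
        + 4 * (1 / n₁ * ∑ j, Real.exp (ε * ‖θ (Sum.inr j)‖ ^ 2))) / ε ^ 2) ∂(initLaw n₀ n₁) :=
        integral_mono (moment_outerMax_le h₁ 4).1
          (((integrable_const 1).add hbi3).const_mul 8) hle
    _ = 8 * (1 + (2 * Real.log n₁ ^ 2 + 4 * e₀) / ε ^ 2) := by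
        rw [integral_const_mul, integral_add (integrable_const 1) hbi3, integral_div,
          integral_add (integrable_const _) hbi2, integral_const_mul, integral_const_mul,
          integral_const_mul,
          integral_finsetSum _ fun j _ => hi j]
        simp_rw [hI]
        simp
        field_simp
    _ ≤ 8 * (4 * Real.log n₁ ^ 2
        + (2 * Real.log n₁ ^ 2 + 4 * e₀ * (4 * Real.log n₁ ^ 2)) / ε ^ 2) := by
        have h1 : 1 ≤ 4 * Real.log n₁ ^ 2 := by nlinarith
        have h2 : 4 * e₀ ≤ 4 * e₀ * (4 * Real.log n₁ ^ 2) :=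
          le_mul_of_one_le_right (by positivity) h1
        gcongr
    _ = _ := by ring

end InitMoments

/-! ### Pathwise bounds for the deviation from the linearized flow -/

section Pathwise

theorem minEigenvalue_mul_le {n : ℕ} {K : Matrix (Fin n) (Fin n) ℝ} (hK : K.IsHermitian)
    (v : EuclideanSpace ℝ (Fin n)) :
    minEigenvalue K * ‖v‖ ^ 2 ≤ ∑ i, ∑ j, v i * v j * K i j := by
  set l := minEigenvalue K
  have hH : (K - l • (1 : Matrix (Fin n) (Fin n) ℝ)).IsHermitian :=
    hK.sub (by simp [Matrix.IsHermitian])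
  have hpsd : (K - l • (1 : Matrix (Fin n) (Fin n) ℝ)).PosSemidef := by
    refine hH.posSemidef_iff_eigenvalues_nonneg.2 fun i => ?_
    have h1 := hH.mulVec_eigenvectorBasis i
    have h2 : Module.End.HasEigenvalue (Matrix.toLin' K) (hH.eigenvalues i + l) := by
      refine Module.End.hasEigenvalue_of_hasEigenvector (x := (hH.eigenvectorBasis i).ofLp)
        ⟨Module.End.mem_eigenspace_iff.2 ?_, ?_⟩
      · rw [Matrix.sub_mulVec, Matrix.smul_mulVec, Matrix.one_mulVec, sub_eq_iff_eq_add] at h1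
        rw [Matrix.toLin'_apply, h1, add_smul]
      · intro h0
        have := hH.eigenvectorBasis.orthonormal.ne_zero i
        exact this (by ext j; simpa using congrFun h0 j)
    have h3 : l ≤ hH.eigenvalues i + l :=
      csInf_le (Module.End.finite_hasEigenvalue (Matrix.toLin' K)).bddBelow h2
    simpa using h3
  have h := hpsd.dotProduct_mulVec_nonneg v.ofLp
  rw [star_trivial, Matrix.sub_mulVec, Matrix.smul_mulVec, Matrix.one_mulVec, dotProduct_sub,
    dotProduct_smul, smul_eq_mul, sub_nonneg] at h
  have e1 : v.ofLp ⬝ᵥ v.ofLp = ‖v‖ ^ 2 := by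
    rw [EuclideanSpace.real_norm_sq_eq, dotProduct]
    exact Finset.sum_congr rfl fun i _ => (sq _).symm
  rw [e1] at h
  refine h.trans (le_of_eq ?_)
  simp only [dotProduct, Matrix.mulVec, Finset.mul_sum]
  exact Finset.sum_congr rfl fun i _ => Finset.sum_congr rfl fun j _ => by ring

theorem norm_gradComb_sq {E ι : Type*} [NormedAddCommGroup E] [InnerProductSpace ℝ E] [Fintype ι]
    (g : ι → E) (v : EuclideanSpace ℝ ι) :
    ‖gradComb g v‖ ^ 2 = ∑ i, ∑ j, v i * v j * inner ℝ (g i) (g j) := by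
  rw [← real_inner_self_eq_norm_sq, gradComb, sum_inner]
  simp only [inner_sum, inner_smul_left, inner_smul_right, conj_trivial]
  exact Finset.sum_congr rfl fun i _ => Finset.sum_congr rfl fun j _ => by ring

/-- An entrywise error of at most `λ / (2 n²)` perturbs the quadratic form by at most `λ / 2`, so
half of the lower bound survives. -/
theorem sqrt_mul_norm_le_norm_gradComb {E : Type*} [NormedAddCommGroup E] [InnerProductSpace ℝ E]
    {n : ℕ} {K : Matrix (Fin n) (Fin n) ℝ} (hK : K.IsHermitian) (g : Fin n → E)
    (hg : ∀ i j, 2 * (n : ℝ) ^ 2 * |inner ℝ (g i) (g j) - K i j| ≤ minEigenvalue K)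
    (v : EuclideanSpace ℝ (Fin n)) :
    √(minEigenvalue K / 2) * ‖v‖ ≤ ‖gradComb g v‖ := by
  rcases Nat.eq_zero_or_pos n with rfl | hn
  · have : v = 0 := Subsingleton.elim _ _
    simp [this]
  have hl : 0 ≤ minEigenvalue K := by
    refine le_trans ?_ (hg ⟨0, hn⟩ ⟨0, hn⟩)
    positivity
  refine (sq_le_sq₀ (by positivity) (norm_nonneg _)).1 ?_
  rw [mul_pow, Real.sq_sqrt (by positivity), norm_gradComb_sq]
  have h1 := minEigenvalue_mul_le hK v
  have h2 : ∑ i, ∑ j, v i * v j * K i j - ∑ i, ∑ j, v i * v j * inner ℝ (g i) (g j)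
      ≤ minEigenvalue K / 2 * ‖v‖ ^ 2 := by
    rw [← Finset.sum_sub_distrib]
    simp_rw [← Finset.sum_sub_distrib, ← mul_sub]
    calc ∑ i, ∑ j, v i * v j * (K i j - inner ℝ (g i) (g j))
        ≤ ∑ _i : Fin n, ∑ _j : Fin n, ‖v‖ ^ 2 * (minEigenvalue K / (2 * (n : ℝ) ^ 2)) := by
          refine Finset.sum_le_sum fun i _ => Finset.sum_le_sum fun j _ => ?_
          refine (le_abs_self _).trans ?_
          rw [abs_mul, abs_mul]
          have f1 : |v i| ≤ ‖v‖ := PiLp.norm_apply_le v i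
          have f2 : |v j| ≤ ‖v‖ := PiLp.norm_apply_le v j
          have f3 : |K i j - inner ℝ (g i) (g j)| ≤ minEigenvalue K / (2 * (n : ℝ) ^ 2) := by
            rw [abs_sub_comm, le_div_iff₀ (by positivity), mul_comm]
            exact hg i j
          calc _ ≤ ‖v‖ * ‖v‖ * (minEigenvalue K / (2 * (n : ℝ) ^ 2)) := by gcongr
            _ = _ := by ring
      _ = _ := by simp; field_simp
  linarith

variable {n n₀ n₁ : ℕ} {Φ : ℝ → ℝ} {A : ℝ} {X : Fin n → EuclideanSpace ℝ (Fin n₀)}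
  {y : EuclideanSpace ℝ (Fin n)} {x : EuclideanSpace ℝ (Fin n₀)}

/-- Test on a coordinate vector. The bound gives `σ ≤ A²` and rules out lazy training at `n₁ = 1`.
-/
theorem minEigenvalue_ntkLimitMatrix_le (hn : 0 < n) (hΦ : BoundedActivation Φ A)
    (hX : ∀ i, ‖X i‖ ≤ A) (hK : (ntkLimitMatrix Φ X).IsHermitian) :
    minEigenvalue (ntkLimitMatrix Φ X) ≤ 2 * A ^ 4 := by
  have h := minEigenvalue_mul_le hK (EuclideanSpace.single ⟨0, hn⟩ 1)
  have h2 := (abs_le.1 (abs_ntkLimit_le hΦ (hX ⟨0, hn⟩) (hX ⟨0, hn⟩))).2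
  have e : ntkLimitMatrix Φ X ⟨0, hn⟩ ⟨0, hn⟩ = ntkLimit Φ (X ⟨0, hn⟩) (X ⟨0, hn⟩) := rfl
  simp at h
  rw [e] at h
  linarith

/-- A size bound for the residual of the network at initialization. -/
noncomputable def residualSize (Φ : ℝ → ℝ) (A : ℝ) (X : Fin n → EuclideanSpace ℝ (Fin n₀))
    (θ : Params n₀ n₁) : ℝ :=
  (1 + A) * (1 + ∑ i, |network Φ (X i) θ|)

/-- A size bound for the deviation of the neural tangent kernel at initialization. -/
noncomputable def kernelDevSize (Φ : ℝ → ℝ) (X : Fin n → EuclideanSpace ℝ (Fin n₀))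
    (θ : Params n₀ n₁) : ℝ :=
  1 + ∑ p : Fin n × Fin n, |kernelDev Φ (X p.1) (X p.2) θ|

/-- The random quantity whose smallness ensures lazy training. -/
noncomputable def lazySize (Φ : ℝ → ℝ) (A : ℝ) (X : Fin n → EuclideanSpace ℝ (Fin n₀))
    (θ : Params n₀ n₁) : ℝ :=
  (24 * A ^ 3 * n + 2 * n ^ 2 + 2 * A ^ 4)
    * ((1 + outerMax θ) * residualSize Φ A X θ * kernelDevSize Φ X θ)

theorem norm_lsResidual_le (hy : ‖y‖ ≤ A) (θ : Params n₀ n₁) :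
    ‖lsResidual (fun i => network Φ (X i)) y θ‖ ≤ residualSize Φ A X θ := by
  have hA : 0 ≤ A := (norm_nonneg _).trans hy
  have h1 : lsResidual (fun i => network Φ (X i)) y θ
      = (WithLp.toLp 2 fun i => network Φ (X i) θ : EuclideanSpace ℝ (Fin n)) - y := by
    ext i; simp [lsResidual]
  have hs : 0 ≤ ∑ i, |network Φ (X i) θ| := Finset.sum_nonneg fun i _ => abs_nonneg _
  have h2 : ‖(WithLp.toLp 2 fun i => network Φ (X i) θ : EuclideanSpace ℝ (Fin n))‖
      ≤ ∑ i, |network Φ (X i) θ| := by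
    refine (sq_le_sq₀ (norm_nonneg _) hs).1 ?_
    rw [EuclideanSpace.norm_sq_eq]
    exact Finset.sum_sq_le_sq_sum_of_nonneg fun i _ => abs_nonneg _
  rw [h1, residualSize]
  refine (norm_sub_le _ _).trans ?_
  nlinarith [mul_nonneg hA hs]

theorem one_le_residualSize (hA : 1 ≤ A) (θ : Params n₀ n₁) : 1 ≤ residualSize Φ A X θ := by
  have hs : 0 ≤ ∑ i, |network Φ (X i) θ| := Finset.sum_nonneg fun i _ => abs_nonneg _
  rw [residualSize]
  nlinarith

theorem one_le_kernelDevSize (θ : Params n₀ n₁) : 1 ≤ kernelDevSize Φ X θ :=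
  le_add_of_nonneg_right (Finset.sum_nonneg fun _ _ => abs_nonneg _)

theorem norm_gradComb_netGrad_sub_le (hΦ : BoundedActivation Φ A) (hX : ∀ i, ‖X i‖ ≤ A)
    (h₀ : 0 < n₀) (h₁ : 0 < n₁) (θ θ₀ : Params n₀ n₁) (v : EuclideanSpace ℝ (Fin n)) :
    ‖gradComb (fun i => netGrad Φ (X i) θ) v - gradComb (fun i => netGrad Φ (X i) θ₀) v‖
      ≤ 3 * A ^ 3 * n * (1 + outerMax θ₀) / √((n₁ : ℝ) * n₀) * ‖θ - θ₀‖ * ‖v‖ := by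
  have h : gradComb (fun i => netGrad Φ (X i) θ) v - gradComb (fun i => netGrad Φ (X i) θ₀) v
      = ∑ i, v i • (netGrad Φ (X i) θ - netGrad Φ (X i) θ₀) := by
    simp [gradComb, smul_sub, Finset.sum_sub_distrib]
  rw [h]
  calc _ ≤ ∑ _i : Fin n, ‖v‖ * (3 * A ^ 3 * (1 + outerMax θ₀) / √((n₁ : ℝ) * n₀) * ‖θ - θ₀‖) := by
        refine norm_sum_le_of_le _ fun i _ => ?_
        rw [norm_smul]
        exact mul_le_mul (PiLp.norm_apply_le v i) (norm_netGrad_sub_le hΦ (hX i) h₀ h₁ θ θ₀)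
          (norm_nonneg _) (norm_nonneg _)
    _ = _ := by simp; ring

/-- The output difference is the Taylor remainder of the network along its flow plus the gradient at
`θ₀` paired with the difference of the flows. All factors in `lazySize` are at least `1`, so its
bound implies both `4 κ R ≤ σ²` and the closeness of the kernels. -/
theorem sq_network_sub_linNetwork_le_of_lazy (hn : 0 < n) (hΦ : BoundedActivation Φ A)
    (hX : ∀ i, ‖X i‖ ≤ A) (hy : ‖y‖ ≤ A) (hx : ‖x‖ ≤ A) (h₀ : 0 < n₀) (h₁ : 0 < n₁)
    (hK : (ntkLimitMatrix Φ X).IsHermitian) (hpos : 0 < minEigenvalue (ntkLimitMatrix Φ X))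
    {θ₀ : Params n₀ n₁} {γ η : ℝ → Params n₀ n₁} (hγ : IsGradientFlow Φ X y θ₀ γ)
    (hη : IsLinGradientFlow Φ X y θ₀ η)
    (hlazy : lazySize Φ A X θ₀ < minEigenvalue (ntkLimitMatrix Φ X) * √(n₁ : ℝ))
    {t : ℝ} (ht : 0 ≤ t) :
    (network Φ x (γ t) - linNetwork Φ x θ₀ (η t)) ^ 2 ≤
      25088 * (A ^ 2) ^ 2 * (3 * A ^ 3 * n) ^ 2
      * ((1 + outerMean θ₀) ^ 2 * (1 + outerMax θ₀) ^ 2 * residualSize Φ A X θ₀ ^ 4)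
      / (minEigenvalue (ntkLimitMatrix Φ X) ^ 3 * n₁ * n₀) := by
  set l := minEigenvalue (ntkLimitMatrix Φ X)
  set R := residualSize Φ A X θ₀ with hRdef
  set S := kernelDevSize Φ X θ₀ with hSdef
  set M := outerMax θ₀ with hMdef
  have hA := hΦ.one_le
  have hn' : (1 : ℝ) ≤ n := by exact_mod_cast hn
  have hn1 : (0 : ℝ) < n₁ := by exact_mod_cast h₁
  have hn0 : (1 : ℝ) ≤ n₀ := by exact_mod_cast h₀
  have hR : 1 ≤ R := one_le_residualSize hA θ₀
  have hS : 1 ≤ S := one_le_kernelDevSize θ₀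
  have hM : 0 ≤ M := outerMax_nonneg θ₀
  have hG := outerMean_nonneg θ₀
  have hs1 : 0 < √(n₁ : ℝ) := Real.sqrt_pos.2 hn1
  have hs10 : √(n₁ : ℝ) ≤ √((n₁ : ℝ) * n₀) := by
    gcongr; exact le_mul_of_one_le_right hn1.le hn0
  have hW1 : 24 * A ^ 3 * n * ((1 + M) * R) ≤ lazySize Φ A X θ₀ := by
    rw [lazySize, ← hMdef, ← hRdef, ← hSdef]
    have e1 : 24 * A ^ 3 * n ≤ 24 * A ^ 3 * n + 2 * (n : ℝ) ^ 2 + 2 * A ^ 4 := by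
      have : 0 < 2 * (n : ℝ) ^ 2 + 2 * A ^ 4 := by positivity
      linarith
    have e2 : (1 + M) * R ≤ (1 + M) * R * S := le_mul_of_one_le_right (by positivity) hS
    gcongr
  have hW2 : 2 * (n : ℝ) ^ 2 * S ≤ lazySize Φ A X θ₀ := by
    rw [lazySize, ← hMdef, ← hRdef, ← hSdef]
    have e1 : 2 * (n : ℝ) ^ 2 ≤ 24 * A ^ 3 * n + 2 * (n : ℝ) ^ 2 + 2 * A ^ 4 := by
      have : 0 < 24 * A ^ 3 * n + 2 * A ^ 4 := by positivity
      linarith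
    have e2 : S ≤ (1 + M) * R * S := le_mul_of_one_le_left (by positivity) (by nlinarith)
    gcongr
  set κ := 3 * A ^ 3 * n * (1 + M) / √((n₁ : ℝ) * n₀) with hκdef
  set σ := √(l / 2)
  have hs1n0 : 0 < √((n₁ : ℝ) * n₀) := hs1.trans_le hs10
  have hκ0 : 0 < κ := by positivity
  have hσ : 0 < σ := Real.sqrt_pos.2 (by positivity)
  have hσ2 : σ ^ 2 = l / 2 := Real.sq_sqrt (by positivity)
  have hsmall : 4 * κ * R ≤ σ ^ 2 := by
    rw [hσ2, hκdef]
    have e1 : 24 * A ^ 3 * n * ((1 + M) * R) ≤ l * √((n₁ : ℝ) * n₀) :=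
      hW1.trans (hlazy.le.trans (by gcongr))
    calc 4 * (3 * A ^ 3 * n * (1 + M) / √((n₁ : ℝ) * n₀)) * R
        = (24 * A ^ 3 * n * ((1 + M) * R)) / √((n₁ : ℝ) * n₀) / 2 := by ring
      _ ≤ (l * √((n₁ : ℝ) * n₀)) / √((n₁ : ℝ) * n₀) / 2 := by gcongr
      _ = l / 2 := by field_simp
  have hlow : ∀ v, σ * ‖v‖ ≤ ‖gradComb (fun i => netGrad Φ (X i) θ₀) v‖ := by
    refine sqrt_mul_norm_le_norm_gradComb hK _ fun i j => ?_
    have e1 : |kernelDev Φ (X i) (X j) θ₀| ≤ S := by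
      have := Finset.single_le_sum (f := fun p : Fin n × Fin n =>
        |kernelDev Φ (X p.1) (X p.2) θ₀|) (fun _ _ => abs_nonneg _) (Finset.mem_univ (i, j))
      rw [hSdef, kernelDevSize]
      exact this.trans (by linarith)
    rw [kernelDev, abs_mul, abs_of_pos hs1] at e1
    have e2 : 2 * (n : ℝ) ^ 2 * |inner ℝ (netGrad Φ (X i) θ₀) (netGrad Φ (X j) θ₀)
        - ntkLimit Φ (X i) (X j)| * √(n₁ : ℝ) ≤ l * √(n₁ : ℝ) := by
      calc _ = 2 * (n : ℝ) ^ 2 * (√(n₁ : ℝ) * |inner ℝ (netGrad Φ (X i) θ₀) (netGrad Φ (X j) θ₀)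
            - ntkLimit Φ (X i) (X j)|) := by ring
        _ ≤ 2 * (n : ℝ) ^ 2 * S := by gcongr
        _ ≤ _ := hW2.trans hlazy.le
    exact le_of_mul_le_mul_right e2 hs1
  obtain ⟨hb, hw⟩ := (hγ.isLSFlow hΦ.differentiable).norm_sub_linearized_le
    (hη.isLSFlow hΦ.differentiable) hγ.1 hη.1 hσ (by linarith : 0 < R) (norm_lsResidual_le hy θ₀)
    hlow (fun θ v => norm_gradComb_netGrad_sub_le hΦ hX h₀ h₁ θ θ₀ v) hsmall hκ0 ht
  have hκx (θ : Params n₀ n₁) : ‖netGrad Φ x θ - netGrad Φ x θ₀‖ ≤ κ * ‖θ - θ₀‖ := by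
    refine (norm_netGrad_sub_le hΦ hx h₀ h₁ θ θ₀).trans ?_
    have e : 3 * A ^ 3 ≤ 3 * A ^ 3 * n := le_mul_of_one_le_right (by positivity) hn'
    exact mul_le_mul_of_nonneg_right (div_le_div_of_nonneg_right
      (mul_le_mul_of_nonneg_right e (by linarith)) hs1n0.le) (norm_nonneg _)
  have htay := abs_sub_linearization_le hκ0.le
    (fun θ => hasGradientAt_network hΦ.differentiable x θ) hκx (γ t)
  have hgr := norm_netGrad_le hΦ hx h₀ h₁ θ₀
  have hσA : σ ≤ A ^ 2 := by
    refine (sq_le_sq₀ hσ.le (by positivity)).1 ?_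
    rw [hσ2]
    have := minEigenvalue_ntkLimitMatrix_le hn hΦ hX hK
    linarith
  have hmain : |network Φ x (γ t) - linNetwork Φ x θ₀ (η t)|
      ≤ 56 * A ^ 2 * (1 + outerMean θ₀) * (κ * R ^ 2 / σ ^ 3) := by
    have e1 : network Φ x (γ t) - linNetwork Φ x θ₀ (η t)
        = (network Φ x (γ t) - network Φ x θ₀ - inner ℝ (netGrad Φ x θ₀) (γ t - θ₀))
          + inner ℝ (netGrad Φ x θ₀) (γ t - η t) := by
      rw [linNetwork_eq hΦ.differentiable]
      simp only [inner_sub_right]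
      ring
    rw [e1]
    calc _ ≤ κ * (2 * R / σ) ^ 2
          + A ^ 2 * (1 + outerMean θ₀) * (52 * (κ * R ^ 2 / σ ^ 3)) := by
          refine (abs_add_le _ _).trans (add_le_add (htay.trans (by gcongr)) ?_)
          refine (abs_real_inner_le_norm _ _).trans ?_
          gcongr
      _ = (4 * σ + 52 * (A ^ 2 * (1 + outerMean θ₀))) * (κ * R ^ 2 / σ ^ 3) := by
          field_simp
          ring
      _ ≤ _ := by
          gcongr
          nlinarith [mul_nonneg (sq_nonneg A) hG]
  calc (network Φ x (γ t) - linNetwork Φ x θ₀ (η t)) ^ 2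
      = |network Φ x (γ t) - linNetwork Φ x θ₀ (η t)| ^ 2 := (sq_abs _).symm
    _ ≤ (56 * A ^ 2 * (1 + outerMean θ₀) * (κ * R ^ 2 / σ ^ 3)) ^ 2 := by gcongr
    -- `3136 = 56²`; substituting `σ² = λ / 2` brings another factor `8`, hence `25088`.
    _ = 3136 * (A ^ 2) ^ 2 * (1 + outerMean θ₀) ^ 2 * (κ ^ 2 * R ^ 4 / (σ ^ 2) ^ 3) := by ring
    _ = _ := by
        rw [hσ2, hκdef, div_pow, Real.sq_sqrt (by positivity)]
        field_simp
        ring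

theorem sq_network_sub_linNetwork_le (hΦ : BoundedActivation Φ A)
    (hy : ‖y‖ ≤ A) (hx : ‖x‖ ≤ A) (h₀ : 0 < n₀) (h₁ : 0 < n₁)
    {θ₀ : Params n₀ n₁} {γ η : ℝ → Params n₀ n₁} (hγ : IsGradientFlow Φ X y θ₀ γ)
    (hη : IsLinGradientFlow Φ X y θ₀ η) {t : ℝ} (ht : 0 ≤ t) :
    (network Φ x (γ t) - linNetwork Φ x θ₀ (η t)) ^ 2 ≤
      4 * (A ^ 2) ^ 2 * (1 + t ^ 8) * ((1 + outerMean θ₀) ^ 2 * residualSize Φ A X θ₀ ^ 4) := by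
  set R := residualSize Φ A X θ₀
  have hA := hΦ.one_le
  have hR : 1 ≤ R := one_le_residualSize hA θ₀
  have hG := outerMean_nonneg θ₀
  have hr := norm_lsResidual_le (X := X) (Φ := Φ) hy θ₀
  have hbd : R ^ 2 / 4 + t / 2 ≤ R ^ 2 * (1 + t) / 2 := by
    have h1R : 1 ≤ R ^ 2 := one_le_pow₀ hR
    nlinarith [mul_le_mul_of_nonneg_right h1R ht]
  have h1 : ‖γ t - θ₀‖ ≤ R ^ 2 * (1 + t) / 2 := by
    have := (hγ.isLSFlow hΦ.differentiable).norm_sub_le ht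
    rw [hγ.1] at this
    refine this.trans (le_trans ?_ hbd)
    gcongr
  have h2 : ‖η t - θ₀‖ ≤ R ^ 2 * (1 + t) / 2 := by
    have := (hη.isLSFlow hΦ.differentiable).norm_sub_le ht
    rw [hη.1] at this
    refine this.trans (le_trans ?_ hbd)
    have h3 : lsResidual (fun i θ => network Φ (X i) θ₀
        + inner ℝ (netGrad Φ (X i) θ₀) (θ - θ₀)) y θ₀
        = lsResidual (fun i => network Φ (X i)) y θ₀ := by
      ext i; simp [lsResidual]
    rw [h3]
    gcongr
  have h4 := abs_network_sub_le hΦ hx h₀ h₁ (γ t) θ₀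
  have h5 : |inner ℝ (netGrad Φ x θ₀) (η t - θ₀)| ≤ A ^ 2 * (1 + outerMean θ₀) * ‖η t - θ₀‖ :=
    (abs_real_inner_le_norm _ _).trans (by gcongr; exact norm_netGrad_le hΦ hx h₀ h₁ θ₀)
  have hmain : |network Φ x (γ t) - linNetwork Φ x θ₀ (η t)|
      ≤ A ^ 2 * (1 + outerMean θ₀) * (R ^ 2 * (1 + t)) := by
    rw [linNetwork_eq hΦ.differentiable, ← sub_sub]
    calc _ ≤ A ^ 2 * (1 + outerMean θ₀) * (R ^ 2 * (1 + t) / 2)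
          + A ^ 2 * (1 + outerMean θ₀) * (R ^ 2 * (1 + t) / 2) := by
          refine (abs_sub _ _).trans (add_le_add (h4.trans ?_) (h5.trans ?_)) <;> gcongr
      _ = _ := by ring
  calc (network Φ x (γ t) - linNetwork Φ x θ₀ (η t)) ^ 2
      = |network Φ x (γ t) - linNetwork Φ x θ₀ (η t)| ^ 2 := (sq_abs _).symm
    _ ≤ (A ^ 2 * (1 + outerMean θ₀) * (R ^ 2 * (1 + t))) ^ 2 := by gcongr
    _ = (A ^ 2) ^ 2 * (1 + t) ^ 2 * ((1 + outerMean θ₀) ^ 2 * R ^ 4) := by ring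
    _ ≤ (A ^ 2) ^ 2 * (4 * (1 + t ^ 8)) * ((1 + outerMean θ₀) ^ 2 * R ^ 4) := by
        gcongr
        nlinarith [sq_nonneg (t - 1), sq_nonneg (t ^ 2 - 1), sq_nonneg (t ^ 4 - 1)]
    _ = _ := by ring

end Pathwise

/-! ### The Wasserstein bound -/

section Wasserstein

/-- The joint law of `(U, V)` is one admissible coupling. -/
theorem wasserstein_two_sq_map_le {Ω : Type*} [MeasurableSpace Ω] {μ : Measure Ω} {U V F : Ω → ℝ}
    (hU : Measurable U) (hV : Measurable V) (hF : Integrable F μ)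
    (h : ∀ ω, (U ω - V ω) ^ 2 ≤ F ω) :
    wasserstein 2 (μ.map U) (μ.map V) ^ 2 ≤ ENNReal.ofReal (∫ ω, F ω ∂μ) := by
  have hUV : Measurable fun ω => (U ω, V ω) := hU.prodMk hV
  have h1 : wasserstein 2 (μ.map U) (μ.map V)
      ≤ (∫⁻ z, edist z.1 z.2 ^ (2 : ℝ) ∂(μ.map fun ω => (U ω, V ω))) ^ (1 / (2 : ℝ)) := by
    refine iInf₂_le (μ.map fun ω => (U ω, V ω)) ⟨?_, ?_⟩ <;>
    · rw [Measure.map_map (by fun_prop) hUV]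
      rfl
  have h2 : ∫⁻ z, edist z.1 z.2 ^ (2 : ℝ) ∂(μ.map fun ω => (U ω, V ω))
      ≤ ENNReal.ofReal (∫ ω, F ω ∂μ) := by
    rw [lintegral_map (by fun_prop) hUV, ofReal_integral_eq_lintegral_ofReal hF
      (Filter.Eventually.of_forall fun ω => (sq_nonneg _).trans (h ω))]
    refine lintegral_mono fun ω => ?_
    rw [edist_dist, ENNReal.ofReal_rpow_of_nonneg dist_nonneg (by norm_num), Real.dist_eq]
    refine ENNReal.ofReal_le_ofReal ?_
    rw [Real.rpow_two, sq_abs]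
    exact h ω
  calc _ ≤ ((∫⁻ z, edist z.1 z.2 ^ (2 : ℝ) ∂(μ.map fun ω => (U ω, V ω))) ^ (1 / (2 : ℝ))) ^ 2 := by
        gcongr
    _ = ∫⁻ z, edist z.1 z.2 ^ (2 : ℝ) ∂(μ.map fun ω => (U ω, V ω)) := by
        rw [← ENNReal.rpow_natCast, ← ENNReal.rpow_mul]
        norm_num
    _ ≤ _ := h2

theorem exists_moment_residualSize_le (n : ℕ) (A : ℝ) (q : ℕ) : ∃ C : ℝ, 0 ≤ C ∧
    ∀ {Φ : ℝ → ℝ}, BoundedActivation Φ A → ∀ {n₀ n₁ : ℕ}, 0 < n₁ →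
      ∀ X : Fin n → EuclideanSpace ℝ (Fin n₀),
      Integrable (fun θ : Params n₀ n₁ => residualSize Φ A X θ ^ q) (initLaw n₀ n₁) ∧
      ∫ θ, residualSize Φ A X θ ^ q ∂(initLaw n₀ n₁) ≤ C := by
  obtain ⟨C, hC, h⟩ := exists_moment_network_le A q
  refine ⟨|(1 + A) ^ q| * (4 ^ q * (1 + (1 + (n : ℝ) ^ (2 * q) * (n * C)))), by positivity,
    fun {Φ} hΦ {n₀ n₁} h₁ X => ?_⟩
  have hA := hΦ.one_le
  have hc (i) : Continuous (network Φ (X i) : Params n₀ n₁ → ℝ) := by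
    have := hΦ.continuous
    have := continuous_preact (n₁ := n₁) (X i)
    unfold network
    fun_prop
  have hm := moment_one_add_sum_le (μ := initLaw n₀ n₁) (fun i => (hc i).measurable)
    (fun i => (h hΦ h₁ (X i)).1) (fun i => (h hΦ h₁ (X i)).2)
  rw [Fintype.card_fin] at hm
  simp only [residualSize, mul_pow]
  refine ⟨hm.1.const_mul _, ?_⟩
  rw [integral_const_mul, abs_of_nonneg (by positivity)]
  exact mul_le_mul_of_nonneg_left hm.2 (by positivity)

theorem exists_moment_kernelDevSize_le (n : ℕ) (A : ℝ) (q : ℕ) : ∃ C : ℝ, 0 ≤ C ∧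
    ∀ {Φ : ℝ → ℝ}, BoundedActivation Φ A → ∀ {n₀ n₁ : ℕ}, 0 < n₁ →
      ∀ X : Fin n → EuclideanSpace ℝ (Fin n₀), (∀ i, ‖X i‖ ≤ A) →
      Integrable (fun θ : Params n₀ n₁ => kernelDevSize Φ X θ ^ q) (initLaw n₀ n₁) ∧
      ∫ θ, kernelDevSize Φ X θ ^ q ∂(initLaw n₀ n₁) ≤ C := by
  obtain ⟨C, hC, h⟩ := exists_moment_kernelDev_le A q
  refine ⟨4 ^ q * (1 + (1 + (Fintype.card (Fin n × Fin n) : ℝ) ^ (2 * q)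
    * (Fintype.card (Fin n × Fin n) * C))), by positivity, fun {Φ} hΦ {n₀ n₁} h₁ X hX => ?_⟩
  refine moment_one_add_sum_le (fun p => ?_) (fun p => (h hΦ h₁ _ _ (hX p.1) (hX p.2)).1)
    (fun p => (h hΦ h₁ _ _ (hX p.1) (hX p.2)).2)
  have h1 := continuous_netGrad (n₁ := n₁) hΦ (X p.1)
  have h2 := continuous_netGrad (n₁ := n₁) hΦ (X p.2)
  unfold kernelDev
  exact Continuous.measurable (by fun_prop)

theorem mul_mul_mul_le_sum_pow_four (a b c d : ℝ) :
    a * b * c * d ≤ a ^ 4 + b ^ 4 + c ^ 4 + d ^ 4 := by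
  nlinarith [sq_nonneg (a * b - c * d), sq_nonneg (a ^ 2 - b ^ 2), sq_nonneg (c ^ 2 - d ^ 2),
    sq_nonneg (a ^ 2), sq_nonneg (b ^ 2), sq_nonneg (c ^ 2), sq_nonneg (d ^ 2)]

/-- Weighted Young inequality. With `b` from the largest outer weight, whose fourth moment is of
order `L²` for `L = log n₁`, both terms have expectation of order `L`. -/
theorem sq_mul_sq_mul_pow_four_le {a b c L : ℝ} (hL : 0 < L) :
    a ^ 2 * b ^ 2 * c ^ 4 ≤ b ^ 4 / L + L * (a ^ 8 + c ^ 16) := by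
  have h1 : b ^ 2 * (a ^ 2 * c ^ 4) ≤ b ^ 4 / L + L * (a ^ 2 * c ^ 4) ^ 2 := by
    rw [← sub_nonneg]
    have : b ^ 4 / L + L * (a ^ 2 * c ^ 4) ^ 2 - b ^ 2 * (a ^ 2 * c ^ 4)
        = ((b ^ 2 - L * (a ^ 2 * c ^ 4)) ^ 2 + b ^ 2 * L * (a ^ 2 * c ^ 4)) / L := by
      field_simp; ring
    rw [this]; positivity
  have h2 : (a ^ 2 * c ^ 4) ^ 2 ≤ a ^ 8 + c ^ 16 := by
    nlinarith [sq_nonneg (a ^ 4 - c ^ 8), sq_nonneg (a ^ 4), sq_nonneg (c ^ 8)]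
  have h3 := mul_le_mul_of_nonneg_left h2 hL.le
  linarith [h1, h3]

variable {n n₀ n₁ : ℕ} {Φ : ℝ → ℝ} {A : ℝ} {X : Fin n → EuclideanSpace ℝ (Fin n₀)}
  {y : EuclideanSpace ℝ (Fin n)} {x : EuclideanSpace ℝ (Fin n₀)}

/-- The summand `2 A⁴` in `lazySize` dominates the smallest eigenvalue, so the lazy case is empty
for `n₁ = 1`, where `log n₁` vanishes. -/
theorem two_mul_pow_four_le_lazySize (hA : 1 ≤ A) (θ : Params n₀ n₁) :
    2 * A ^ 4 ≤ lazySize Φ A X θ := by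
  have h1 : 1 ≤ (1 + outerMax θ) * residualSize Φ A X θ * kernelDevSize Φ X θ :=
    one_le_mul_of_one_le_of_one_le (one_le_mul_of_one_le_of_one_le
      (by linarith [outerMax_nonneg θ]) (one_le_residualSize hA θ)) (one_le_kernelDevSize θ)
  have h2 : 2 * A ^ 4 ≤ 24 * A ^ 3 * n + 2 * (n : ℝ) ^ 2 + 2 * A ^ 4 :=
    le_add_of_nonneg_left (by positivity)
  exact h2.trans (le_mul_of_one_le_right (by positivity) h1)

/-- The lazy and crude bounds are added, each being nonnegative, so no probability of an event has
to be estimated. Products of random factors are replaced by sums of powers, so only separate moments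
are needed later. -/
theorem sq_network_sub_linNetwork_le_add (hn : 0 < n) (hΦ : BoundedActivation Φ A)
    (hX : ∀ i, ‖X i‖ ≤ A) (hy : ‖y‖ ≤ A) (hx : ‖x‖ ≤ A) (h₀ : 0 < n₀) (h₁ : 0 < n₁)
    (hK : (ntkLimitMatrix Φ X).IsHermitian) (hpos : 0 < minEigenvalue (ntkLimitMatrix Φ X))
    {θ₀ : Params n₀ n₁} {γ η : ℝ → Params n₀ n₁} (hγ : IsGradientFlow Φ X y θ₀ γ)
    (hη : IsLinGradientFlow Φ X y θ₀ η) {r : ℝ} (hr : 0 ≤ r) {m : ℕ} (hm : r ≤ m)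
    {t : ℝ} (ht : 0 ≤ t) :
    (network Φ x (γ t) - linNetwork Φ x θ₀ (η t)) ^ 2 ≤
      25088 * (A ^ 2) ^ 2 * (3 * A ^ 3 * n) ^ 2
          / (minEigenvalue (ntkLimitMatrix Φ X) ^ 3 * n₁ * n₀)
        * ((1 + outerMax θ₀) ^ 4 / Real.log n₁
          + Real.log n₁ * ((1 + outerMean θ₀) ^ 8 + residualSize Φ A X θ₀ ^ 16))
      + 4 * (A ^ 2) ^ 2 * (24 * A ^ 3 * n + 2 * n ^ 2 + 2 * A ^ 4) ^ m * (1 + t ^ 8)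
          / (minEigenvalue (ntkLimitMatrix Φ X) ^ r * (n₁ : ℝ) ^ (r / 2))
        * ((1 + outerMean θ₀) ^ 8 + (1 + outerMax θ₀) ^ (m * 4)
          + residualSize Φ A X θ₀ ^ ((m + 4) * 4) + kernelDevSize Φ X θ₀ ^ (m * 4)) := by
  set l := minEigenvalue (ntkLimitMatrix Φ X)
  set R := residualSize Φ A X θ₀ with hRdef
  set S := kernelDevSize Φ X θ₀ with hSdef
  set M := outerMax θ₀ with hMdef
  set G := outerMean θ₀ with hGdef
  have hA := hΦ.one_le
  have hn1 : (0 : ℝ) < n₁ := by exact_mod_cast h₁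
  have hR : 1 ≤ R := one_le_residualSize hA θ₀
  have hS : 1 ≤ S := one_le_kernelDevSize θ₀
  have hM : 0 ≤ M := outerMax_nonneg θ₀
  have hG : 0 ≤ G := outerMean_nonneg θ₀
  have hL0 : 0 ≤ Real.log n₁ := Real.log_natCast_nonneg n₁
  have hW := two_mul_pow_four_le_lazySize (Φ := Φ) (X := X) hA θ₀
  rcases lt_or_ge (lazySize Φ A X θ₀) (l * √(n₁ : ℝ)) with hlazy | hlazy
  · have hn2 : 1 < n₁ := by
      by_contra hcon
      have h1 : n₁ = 1 := by omega
      have h2 := minEigenvalue_ntkLimitMatrix_le hn hΦ hX hK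
      subst h1
      simp only [Nat.cast_one, Real.sqrt_one, mul_one] at hlazy
      linarith
    have hL : 0 < Real.log n₁ := Real.log_pos (by exact_mod_cast hn2)
    have h1 := sq_network_sub_linNetwork_le_of_lazy hn hΦ hX hy hx h₀ h₁ hK hpos hγ hη hlazy ht
    refine (h1.trans ?_).trans (le_add_of_nonneg_right (by positivity))
    rw [mul_div_right_comm]
    gcongr
    exact sq_mul_sq_mul_pow_four_le hL
  · have h1 := sq_network_sub_linNetwork_le hΦ hy hx h₀ h₁ hγ hη ht
    refine (h1.trans ?_).trans (le_add_of_nonneg_left (by positivity))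
    set W := lazySize Φ A X θ₀ with hWdef
    have hW1 : 1 ≤ W := by nlinarith [one_le_pow₀ hA (n := 4)]
    -- Pathwise Markov inequality: outside the lazy case `W / (λ √n₁)` is at least `1`, and so is
    -- its `r`-th power. The integer `m ≥ r` replaces the exponent on `W`, as `W ≥ 1`.
    have h2 : l ^ r * (n₁ : ℝ) ^ (r / 2) ≤ W ^ m := by
      calc l ^ r * (n₁ : ℝ) ^ (r / 2) = (l * √(n₁ : ℝ)) ^ r := by
            rw [Real.mul_rpow hpos.le (Real.sqrt_nonneg _), Real.sqrt_eq_rpow,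
              ← Real.rpow_mul hn1.le]
            ring_nf
        _ ≤ W ^ r := Real.rpow_le_rpow (by positivity) hlazy hr
        _ ≤ W ^ (m : ℝ) := Real.rpow_le_rpow_of_exponent_le hW1 hm
        _ = W ^ m := Real.rpow_natCast _ _
    have hd : 0 < l ^ r * (n₁ : ℝ) ^ (r / 2) := by positivity
    set d := l ^ r * (n₁ : ℝ) ^ (r / 2)
    calc 4 * (A ^ 2) ^ 2 * (1 + t ^ 8) * ((1 + G) ^ 2 * R ^ 4)
        = 4 * (A ^ 2) ^ 2 * (1 + t ^ 8) / d * ((1 + G) ^ 2 * R ^ 4) * d := by field_simp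
      _ ≤ 4 * (A ^ 2) ^ 2 * (1 + t ^ 8) / d * ((1 + G) ^ 2 * R ^ 4) * W ^ m := by gcongr
      _ = 4 * (A ^ 2) ^ 2 * (24 * A ^ 3 * n + 2 * n ^ 2 + 2 * A ^ 4) ^ m * (1 + t ^ 8) / d
          * ((1 + G) ^ 2 * (1 + M) ^ m * R ^ (m + 4) * S ^ m) := by
          rw [hWdef, lazySize]
          simp only [mul_pow, pow_add]
          ring
      _ ≤ _ := by
          gcongr
          refine (mul_mul_mul_le_sum_pow_four _ _ _ _).trans (le_of_eq ?_)
          simp only [← pow_mul]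

theorem norm_le_inputNorm (X : Fin n → EuclideanSpace ℝ (Fin n₀)) (i : Fin n) :
    ‖X i‖ ≤ inputNorm X :=
  Real.le_sqrt_of_sq_le (Finset.single_le_sum (f := fun i => ‖X i‖ ^ 2)
    (fun _ _ => sq_nonneg _) (Finset.mem_univ i))

theorem Overparam.minEigenvalue_pos {r : ℝ} (h : Overparam Φ n₁ X y r) :
    0 < minEigenvalue (ntkLimitMatrix Φ X) := by
  have h1 (g : ℝ → ℝ) : 0 ≤ supNorm g := Real.iSup_nonneg fun _ => abs_nonneg _
  have h2 (g : ℝ → ℝ) : 0 ≤ lipConst g := Real.sInf_nonneg fun _ hK => hK.1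
  have h3 : 0 ≤ inputNorm X := Real.sqrt_nonneg _
  refine lt_of_le_of_lt ?_ h
  have := h1 Φ
  have := h1 (deriv Φ)
  have := h2 Φ
  have := h2 (deriv Φ)
  positivity

end Wasserstein

theorem proposition3p2 (Φ : ℝ → ℝ) (hΦ : RegularActivation Φ) (n : ℕ) (hn : 0 < n)
    (r : ℝ) (hr : 5 ≤ r) (B : ℝ) :
    ∃ a₁ a₂ : ℝ, 0 < a₁ ∧ 0 < a₂ ∧
      ∀ (n₀ n₁ : ℕ), 0 < n₀ → 0 < n₁ →
      ∀ (X : Fin n → EuclideanSpace ℝ (Fin n₀)) (y : EuclideanSpace ℝ (Fin n))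
        (x : EuclideanSpace ℝ (Fin n₀)),
      inputNorm X ≤ B → ‖y‖ ≤ B → ‖x‖ ≤ B →
      (ntkLimitMatrix Φ X).PosDef →
      Overparam Φ n₁ X y r →
      ∀ (θ θlin : Params n₀ n₁ → ℝ → Params n₀ n₁),
      (∀ θ₀, IsGradientFlow Φ X y θ₀ (θ θ₀)) →
      (∀ θ₀, IsLinGradientFlow Φ X y θ₀ (θlin θ₀)) →
      ∀ t : ℝ, 0 ≤ t →
        wasserstein 2
            ((initLaw n₀ n₁).map fun θ₀ => network Φ x (θ θ₀ t))
            ((initLaw n₀ n₁).map fun θ₀ => linNetwork Φ x θ₀ (θlin θ₀ t)) ^ 2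
          ≤ ENNReal.ofReal
              (r * (a₁ * Real.log n₁ /
                    (minEigenvalue (ntkLimitMatrix Φ X) ^ 3 * (n₁ : ℝ) * (n₀ : ℝ))
                + a₂ * (n₀ : ℝ) /
                    (minEigenvalue (ntkLimitMatrix Φ X) ^ r * (n₁ : ℝ) ^ (r / 4))
                  * (1 + t ^ 8))) := by
  obtain ⟨A, hBA, hA⟩ := hΦ.exists_bounded B
  have hA1 := hA.one_le
  obtain ⟨m, hm⟩ := exists_nat_ge r
  obtain ⟨C₁, hC₁, hmax⟩ := exists_moment_outerMax_four_le
  obtain ⟨C₂, hC₂, hres⟩ := exists_moment_residualSize_le n A 16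
  obtain ⟨C₃, hC₃, hres'⟩ := exists_moment_residualSize_le n A ((m + 4) * 4)
  obtain ⟨C₄, hC₄, hdev⟩ := exists_moment_kernelDevSize_le n A (m * 4)
  set G : ℝ := 4 ^ 8 * (1 + gaussMoment 8)
  have hG0 : 0 ≤ G := mul_nonneg (by positivity) (add_nonneg zero_le_one (gaussMoment_nonneg _))
  set H : ℝ := 4 ^ (m * 4) * (1 + gaussMoment (m * 4))
  have hH0 : 0 ≤ H := mul_nonneg (by positivity) (add_nonneg zero_le_one (gaussMoment_nonneg _))
  set D₁ : ℝ := 25088 * (A ^ 2) ^ 2 * (3 * A ^ 3 * n) ^ 2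
  set D₂ : ℝ := 4 * (A ^ 2) ^ 2 * (24 * A ^ 3 * n + 2 * n ^ 2 + 2 * A ^ 4) ^ m
  have hD₂0 : 0 ≤ D₂ := by positivity
  -- The added `1` ensures strict positivity.
  refine ⟨D₁ * (C₁ + (G + C₂)) + 1, D₂ * (G + H + C₃ + C₄) + 1, by positivity, by positivity, ?_⟩
  intro n₀ n₁ h₀ h₁ X y x hX hy hx hK hover θ θlin hθ hθlin t ht
  have hX' (i) : ‖X i‖ ≤ A := (norm_le_inputNorm X i).trans (hX.trans hBA)
  have hy' := hy.trans hBA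
  have hx' := hx.trans hBA
  have hpos := hover.minEigenvalue_pos
  set l := minEigenvalue (ntkLimitMatrix Φ X)
  have hn0 : (1 : ℝ) ≤ n₀ := by exact_mod_cast h₀
  have hn1 : (1 : ℝ) ≤ n₁ := by exact_mod_cast h₁
  have hL : 0 ≤ Real.log n₁ := Real.log_natCast_nonneg n₁
  have hcθ := continuous_gradientFlow hA h₀ h₁ hX' hθ ht
  have hclin := continuous_linGradientFlow hA h₀ h₁ hX' hθlin ht
  have hnet := (lipOnBalls_network hA h₀ h₁ hx').continuous
  have hgrad := continuous_netGrad (n₁ := n₁) hA x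
  have hU : Continuous fun θ₀ => network Φ x (θ θ₀ t) := by fun_prop
  have hV : Continuous fun θ₀ => linNetwork Φ x θ₀ (θlin θ₀ t) := by
    simp only [linNetwork_eq hA.differentiable]
    fun_prop
  have i1 := moment_outerMax_le (n₀ := n₀) h₁ 4
  have i2 := moment_outerMean_le (n₀ := n₀) h₁ 8
  have i3 := hres hA h₁ X
  have i4 := moment_outerMax_le (n₀ := n₀) h₁ (m * 4)
  have i5 := hres' hA h₁ X
  have i6 := hdev hA h₁ X hX'
  have j1 := (i1.1.div_const (Real.log n₁)).fun_add ((i2.1.fun_add i3.1).const_mul (Real.log n₁))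
  have j2 := ((i2.1.fun_add i4.1).fun_add i5.1).fun_add i6.1
  have hd2 : 0 < l ^ r * (n₁ : ℝ) ^ (r / 2) := by positivity
  have hd4 : 0 < l ^ r * (n₁ : ℝ) ^ (r / 4) := by positivity
  refine (wasserstein_two_sq_map_le hU.measurable hV.measurable
    ((j1.const_mul (D₁ / (l ^ 3 * n₁ * n₀))).add
      (j2.const_mul (D₂ * (1 + t ^ 8) / (l ^ r * (n₁ : ℝ) ^ (r / 2)))))
    fun θ₀ => sq_network_sub_linNetwork_le_add hn hA hX' hy' hx' h₀ h₁ hK.isHermitian hpos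
      (hθ θ₀) (hθlin θ₀) (by linarith) hm ht).trans (ENNReal.ofReal_le_ofReal ?_)
  have k1 : ∫ θ₀ : Params n₀ n₁, ((1 + outerMax θ₀) ^ 4 / Real.log n₁ + Real.log n₁ *
      ((1 + outerMean θ₀) ^ 8 + residualSize Φ A X θ₀ ^ 16)) ∂(initLaw n₀ n₁)
      ≤ (C₁ + (G + C₂)) * Real.log n₁ := by
    rw [integral_add (i1.1.div_const _) ((i2.1.fun_add i3.1).const_mul _), integral_div,
      integral_const_mul, integral_add i2.1 i3.1, add_mul, mul_comm (Real.log n₁)]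
    refine add_le_add ?_ (mul_le_mul_of_nonneg_right (add_le_add i2.2 i3.2) hL)
    -- For `n₁ = 1` the logarithm is zero and division by it gives zero, so both sides vanish.
    rcases Nat.lt_or_ge n₁ 2 with h2 | h2
    · have : n₁ = 1 := by omega
      simp [this]
    · have hLpos : 0 < Real.log n₁ := Real.log_pos (by exact_mod_cast h2)
      rw [div_le_iff₀ hLpos]
      exact (hmax h2).trans (le_of_eq (by ring))
  have k2 : ∫ θ₀ : Params n₀ n₁, ((1 + outerMean θ₀) ^ 8 + (1 + outerMax θ₀) ^ (m * 4)
      + residualSize Φ A X θ₀ ^ ((m + 4) * 4) + kernelDevSize Φ X θ₀ ^ (m * 4)) ∂(initLaw n₀ n₁)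
      ≤ (G + H + C₃ + C₄) * n₁ := by
    rw [integral_add ((i2.1.fun_add i4.1).fun_add i5.1) i6.1, integral_add (i2.1.fun_add i4.1) i5.1,
      integral_add i2.1 i4.1]
    have := le_mul_of_one_le_right hG0 hn1
    have := le_mul_of_one_le_right hC₃ hn1
    have := le_mul_of_one_le_right hC₄ hn1
    linarith [i2.2, i4.2, i5.2, i6.2]
  -- The factor `n₁` from the moments of the maximum is absorbed because `1 + r / 4 ≤ r / 2` for `r
  -- ≥ 4`.
  have k3 : (n₁ : ℝ) / (l ^ r * (n₁ : ℝ) ^ (r / 2)) ≤ 1 / (l ^ r * (n₁ : ℝ) ^ (r / 4)) := by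
    rw [div_le_div_iff₀ hd2 hd4, one_mul, mul_left_comm]
    gcongr
    calc (n₁ : ℝ) * (n₁ : ℝ) ^ (r / 4) = (n₁ : ℝ) ^ (1 + r / 4) := by
          rw [Real.rpow_add (by linarith), Real.rpow_one]
      _ ≤ _ := Real.rpow_le_rpow_of_exponent_le hn1 (by linarith)
  calc _ = D₁ / (l ^ 3 * n₁ * n₀) * ∫ θ₀ : Params n₀ n₁, ((1 + outerMax θ₀) ^ 4 / Real.log n₁ +
        Real.log n₁ * ((1 + outerMean θ₀) ^ 8 + residualSize Φ A X θ₀ ^ 16)) ∂(initLaw n₀ n₁)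
      + D₂ * (1 + t ^ 8) / (l ^ r * (n₁ : ℝ) ^ (r / 2)) * ∫ θ₀ : Params n₀ n₁,
        ((1 + outerMean θ₀) ^ 8 + (1 + outerMax θ₀) ^ (m * 4)
        + residualSize Φ A X θ₀ ^ ((m + 4) * 4) + kernelDevSize Φ X θ₀ ^ (m * 4))
        ∂(initLaw n₀ n₁) := by
        rw [← integral_const_mul, ← integral_const_mul]
        exact integral_add (j1.const_mul _) (j2.const_mul _)
    _ ≤ D₁ / (l ^ 3 * n₁ * n₀) * ((C₁ + (G + C₂)) * Real.log n₁)
      + D₂ * (1 + t ^ 8) / (l ^ r * (n₁ : ℝ) ^ (r / 2)) * ((G + H + C₃ + C₄) * n₁) := by gcongr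
    _ = D₁ * (C₁ + (G + C₂)) * Real.log n₁ / (l ^ 3 * n₁ * n₀)
      + D₂ * (G + H + C₃ + C₄) * (1 + t ^ 8) * (n₁ / (l ^ r * (n₁ : ℝ) ^ (r / 2))) := by ring
    -- The factor `n₀` here and the factor `r` in the last step are at least `1` and are inserted
    -- for free.
    _ ≤ (D₁ * (C₁ + (G + C₂)) + 1) * Real.log n₁ / (l ^ 3 * n₁ * n₀)
      + (D₂ * (G + H + C₃ + C₄) + 1) * n₀ * (1 + t ^ 8)
        * (1 / (l ^ r * (n₁ : ℝ) ^ (r / 4))) := by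
        have e1 : D₁ * (C₁ + (G + C₂)) ≤ D₁ * (C₁ + (G + C₂)) + 1 := by linarith
        have e2 : D₂ * (G + H + C₃ + C₄) ≤ (D₂ * (G + H + C₃ + C₄) + 1) * n₀ := by
          nlinarith [mul_nonneg hD₂0 (by positivity : 0 ≤ G + H + C₃ + C₄)]
        gcongr
    _ = (D₁ * (C₁ + (G + C₂)) + 1) * Real.log n₁ / (l ^ 3 * n₁ * n₀)
      + (D₂ * (G + H + C₃ + C₄) + 1) * n₀ / (l ^ r * (n₁ : ℝ) ^ (r / 4)) * (1 + t ^ 8) := by ring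
    _ ≤ _ := le_mul_of_one_le_left (by positivity) (by linarith)
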